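/- Let $p(z)=e^{z-1}\mathbf 1\{z\le 1\}$ be the density of $1-\mathrm{Exp}(1)$, the step of the one-minus-exp walk. For $H>0$, a left eigenfunction with eigenvalue $\lambda\in\mathbb C$ of the walk killed outside $[0,H]$ is an integrable function $g:\mathbb R\to\mathbb C$ supported on $[0,H]$, not identically zero, with $$\lambda g(x)=\int_0^H g(u)\,p(x-u)\,du=e^{x-1}\int_0^H \mathbf 1\{u\ge x-1\}\,g(u)e^{-u}\,du,\qquad 0\le x\le H .$$ Eigenvalues of the exp-minus-one walk (step $\mathrm{Exp}(1)-1$, density $p(-z)$) killed outside $[0,H]$ are defined in the same way. The principal eigenvalue is the positive eigenvalue which is at least the modulus of every complex eigenvalue. For $\lambda\ne0$ put $$g_\lambda(x)=e^x\sum_{0\le k\le x}\frac{(x-k)^k}{(-\lambda e)^k\,k!}\quad(x\ge 0),\qquad g_\lambda(x)=0\quad(x<0),$$ with $0^0=1$, and $\tau_\lambda(s)=1/\lambda-e^s+se^s$. Let $W_k$ ($k\in\mathbb Z$) be the branches of the Lambert $W$ function ($W e^{W}=z$), with the usual convention that the branch images are closed in the direction of increasing imaginary part. 1. Let $H>0$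 and $0\neq\lambda\in\mathbb C$. Then $\lambda$ is an eigenvalue of the one-minus-exp walk killed outside $[0,H]$ if and only if $g_\lambda(H+1)=0$. A function $g$ is a left eigenfunction with eigenvalue $\lambda$ if and only if $g_\lambda(H+1)=0$ and $g=c\,g_\lambda\mathbf 1_{[0,H]}$ for some constant $c\ne0$. 2. Let $\lambda\in(0,1]$. For each $k\in\mathbb Z$, $W_k(-1/(e\lambda))$ is well defined: the $k$-th branch image contains exactly one $w$ with $we^w=-1/(e\lambda)$. Put $s_k=1+W_k(-1/(e\lambda))$. If $\lambda<1$, then $k\mapsto s_k$ is a bijection from $\mathbb Z$ onto the zero set of $\tau_\lambda$. If $\lambda=1$, then $s_0=s_{-1}=0$ and $k\mapsto s_k$ is a bijection from $\mathbb Z\setminus\{-1\}$ onto the zero set of $\tau_1$. 3. For all $x>0$, with absolutely convergent sums, $$g_\lambda(x)=\sum_{\tau_\lambda(s)=0}\frac{e^{sx}}{s}\quad(0<\lambda<1),\qquad g_1(x)=2\left(x+\tfrac13\right)+\sum_{\tau_1(s)=0,\ s\ne0}\frac{e^{sx}}{s}.$$ 4. For every $H>0$ the one-minus-exp walk killed outside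 $[0,H]$ has exactly one principal eigenvalue. For $H,\lambda>0$, $\lambda$ is this principal eigenvalue if and only if $H+1$ is the smallest positive zero of $g_\lambda$. 5. For all sufficiently small $\delta>0$ there is exactly one $H>0$ for which the principal eigenvalue is $\lambda=e^{-\delta}$, and, as $\delta\downarrow0$, $$H=\frac{\pi}{\sqrt{2\delta}}-\frac43+O(\sqrt\delta).$$ Conversely, if $e^{-\delta}$ is the principal eigenvalue for $[0,H]$, then, as $H\to\infty$, $$\delta=\frac{\pi^2}{2}\,\frac{1+O(1/H^2)}{(H+4/3)^2}.$$ 6. For every $A>0$ the exp-minus-one walk killed outside $[0,A]$ has the same principal eigenvalue $\lambda_A$ as the one-minus-exp walk killed outside $[0,A]$, and, as $A\to\infty$, $$\lambda_A=\exp\left\{-\frac{\pi^2}{2A^2}+O(A^{-3})\right\}.$$ -/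

import Mathlib

open MeasureTheory Set

/-- The law of a step `1 - Exp(1)` of the one-minus-exp walk. -/
noncomputable def oneMinusExpLaw : Measure ℝ :=
  (ProbabilityTheory.expMeasure 1).map (fun t => 1 - t)

/-- The law of a step `Exp(1) - 1` of the exp-minus-one walk. -/
noncomputable def expMinusOneLaw : Measure ℝ :=
  (ProbabilityTheory.expMeasure 1).map (fun t => t - 1)

/-- The density of a step `1 - Exp(1)`, namely `e^{z-1}` for `z ≤ 1` and `0` for `z > 1`. -/
noncomputable def oneMinusExpDensity (z : ℝ) : ℝ :=
  if z ≤ 1 then Real.exp (z - 1) else 0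

/-- The density of a step `Exp(1) - 1`, namely `e^{-(z+1)}` for `z ≥ -1` and `0` for `z < -1`. -/
noncomputable def expMinusOneDensity (z : ℝ) : ℝ :=
  if -1 ≤ z then Real.exp (-(z + 1)) else 0

theorem oneMinusExpLaw_eq_withDensity :
    oneMinusExpLaw = volume.withDensity (fun z => ENNReal.ofReal (oneMinusExpDensity z)) := by
  have hpdf : ∀ z : ℝ, ENNReal.ofReal (oneMinusExpDensity z)
      = ProbabilityTheory.exponentialPDF 1 (1 - z) := by
    intro z
    rw [ProbabilityTheory.exponentialPDF_eq, oneMinusExpDensity]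
    congr 1
    by_cases h : z ≤ 1
    · rw [if_pos h, if_pos (by linarith)]; simp
    · rw [if_neg h, if_neg (by linarith)]
  ext s hs
  have hm : Measurable (fun t : ℝ => 1 - t) := by fun_prop
  rw [oneMinusExpLaw, Measure.map_apply hm hs, withDensity_apply _ hs]
  change (volume.withDensity (ProbabilityTheory.exponentialPDF 1)) _ = _
  rw [withDensity_apply _ (hm hs), ← lintegral_indicator (hm hs), ← lintegral_indicator hs,
    ← lintegral_sub_left_eq_self _ (1 : ℝ)]
  refine lintegral_congr fun z => ?_
  by_cases h : z ∈ s <;> simp [Set.indicator, h, hpdf]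

theorem expMinusOneLaw_eq_withDensity :
    expMinusOneLaw = volume.withDensity (fun z => ENNReal.ofReal (expMinusOneDensity z)) := by
  have hpdf : ∀ z : ℝ, ENNReal.ofReal (expMinusOneDensity z)
      = ProbabilityTheory.exponentialPDF 1 (z + 1) := by
    intro z
    rw [ProbabilityTheory.exponentialPDF_eq, expMinusOneDensity]
    congr 1
    by_cases h : -1 ≤ z
    · rw [if_pos h, if_pos (by linarith)]; simp
    · rw [if_neg h, if_neg (by linarith)]
  ext s hs
  have hm : Measurable (fun t : ℝ => t - 1) := by fun_prop
  rw [expMinusOneLaw, Measure.map_apply hm hs, withDensity_apply _ hs]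
  change (volume.withDensity (ProbabilityTheory.exponentialPDF 1)) _ = _
  rw [withDensity_apply _ (hm hs), ← lintegral_indicator (hm hs), ← lintegral_indicator hs,
    ← lintegral_add_right_eq_self _ (1 : ℝ)]
  refine lintegral_congr fun z => ?_
  by_cases h : z ∈ s <;> simp [Set.indicator, h, hpdf]

/-- `g` is a left eigenfunction, with eigenvalue `lam`, of the walk with step density `p` killed
outside `[0, H]`: `g` is an integrable function supported on `[0, H]`, not identically zero, with
`lam * g x = ∫_0^H g u * p (x - u) du` for all `x` in `[0, H]`. -/
def IsLeftEigenfunction (p : ℝ → ℝ) (H : ℝ) (lam : ℂ) (g : ℝ → ℂ) : Prop :=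
  IntegrableOn g (Icc 0 H) ∧ (∀ x, x ∉ Icc 0 H → g x = 0) ∧ (∃ x, g x ≠ 0) ∧
    ∀ x ∈ Icc 0 H, lam * g x = ∫ u in (0 : ℝ)..H, g u * (p (x - u) : ℂ)

def IsKilledEigenvalue (p : ℝ → ℝ) (H : ℝ) (lam : ℂ) : Prop :=
  ∃ g : ℝ → ℂ, IsLeftEigenfunction p H lam g

/-- The principal eigenvalue: the positive eigenvalue that dominates the modulus of every
(complex) eigenvalue. -/
def IsPrincipalEigenvalue (p : ℝ → ℝ) (H lam : ℝ) : Prop :=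
  0 < lam ∧ IsKilledEigenvalue p H (lam : ℂ) ∧
    ∀ mu : ℂ, IsKilledEigenvalue p H mu → ‖mu‖ ≤ lam

/-- `g_lam x = e^x ∑_{0 ≤ k ≤ x} (x-k)^k / ((-lam e)^k k!)` for `x ≥ 0`, and `0` for `x < 0`. -/
noncomputable def gFun (lam : ℂ) (x : ℝ) : ℂ :=
  if x < 0 then 0 else
    (Real.exp x : ℂ) * ∑ k ∈ Finset.range (⌊x⌋₊ + 1),
      (((x - (k : ℝ)) ^ k : ℝ) : ℂ) / ((-lam * (Real.exp 1 : ℂ)) ^ k * (k.factorial : ℂ))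

/-- `τ(s) = 1/lam - e^s + s e^s`. -/
noncomputable def tauFun (lam : ℝ) (s : ℂ) : ℂ :=
  1 / (lam : ℂ) - Complex.exp s + s * Complex.exp s

/-- The image of the `k`-th branch of the Lambert `W` function. The curves on which
`w * e^w` is a negative real are those where `im w + arg w` is an odd multiple of `π`; they bound
the regions, which are closed in the direction of increasing imaginary part. The ray
`(-∞, -1)` belongs to the branch `-1` only, and the branch point `-1` to the branches `0`
and `-1`. -/
def lambertBranch (k : ℤ) : Set ℂ :=
  {w | (k = -1 ∧ w.im = 0 ∧ w.re ≤ -1) ∨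
    (¬ (w.im = 0 ∧ w.re < -1) ∧
      (2 * (k : ℝ) - 1) * Real.pi < w.im + w.arg ∧
      w.im + w.arg ≤ (2 * (k : ℝ) + 1) * Real.pi)}

/-- The `k`-th branch of the Lambert `W` function: the solution `w` of `w * e^w = z` in the `k`-th
region (an unspecified number if there is none). -/
noncomputable def lambertW (k : ℤ) (z : ℂ) : ℂ :=
  Classical.epsilon fun w : ℂ => w ∈ lambertBranch k ∧ w * Complex.exp w = z

/-- `s_k = 1 + W_k(-1/(e lam))`. -/
noncomputable def tauRoot (lam : ℝ) (k : ℤ) : ℂ :=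
  1 + lambertW k ((-1 / (Real.exp 1 * lam) : ℝ) : ℂ)

/-! Put `f(u) = g(u) e^{-u}` and `t = -1/(λe)`. The eigenvalue equation becomes `f(x) = -t ∫ f` over
`[max(x-1, 0), H]`. Hence `f` is constant on `[0, 1]` and then solves the delay equation `f'(x) = t
f(x-1)`. Unit interval by unit interval this forces `f = f(0) · delayExp t`. The equation at `x = 0`
is the one remaining condition, and it says that `delayExp t` vanishes at `H + 1`. This settles the
eigenfunctions (`eigenfunction_eq`, `isLeftEigenfunction_gFun`).

The principal eigenvalue is a Perron–Frobenius matter. If `delayExp t` is positive before `H + 1`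
and zero there, the resulting positive eigenfunction dominates every other eigenfunction through the
maximum of a quotient (`norm_le_of_isKilledEigenvalue`). Such a `t` exists: take the smallest `c`
for which `delayExp (-c)` fails to be positive somewhere on `[0, H + 1]`
(`exists_delayExp_least_zero`). The exp-minus-one walk is the reflection of the interval.

The roots of `τ` are `1 + w` with `w e^w = -a`, `a = 1/(eλ) ≥ 1/e`. In polar form this fixes `im w +
arg w` to be an odd multiple of `π` and leaves one real equation `lambertLog η = log a` in `η = im
w`. Its left side is strictly increasing on each interval `(2kπ, (2k+1)π)`, so each branch carries
exactly one root.

The expansion over the roots is a partial fraction expansion of `e^{zu}/τ(z)` evaluated at `z = 1`,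
for `0 < u ≤ 1`. After subtraction of the poles with `|im| < 2πn` and of the principal part at `0`,
what remains is bounded on the strip by its values on the lines `|im z| = 2πn` (Phragmén–Lindelöf),
and these tend to `0` (`TauZero.norm_partial_fraction_le`, `tendsto_convolution`). At `z = 1` the
residue at `s` contributes `λ e^{su}/s`. This proves the expansion on `(0, 1]`; both sides solve the
same delay equation, so it holds on `(0, ∞)`.

For `λ = e^{-δ}` the pair of roots nearest the real axis, `σ ± iη`, contributes `(2 e^{σx}/r) sin(ηx
+ θ)`, and all other roots together at most `e^{-(x-1)}/4` (`abs_gFun_sub_le`). The first zero is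
therefore near `(π - θ)/η`. Since `δ = η²/2 + O(η⁴)` and `θ/η = 1/3 + O(η)`, it is `π/√(2δ) - 1/3 +
O(√δ)`, and `H` is smaller by `1`. Inverting this relation, with monotonicity in `H`, gives the
asymptotics of the eigenvalue. -/

/-! ### The solution of the delay equation `f' (x) = t f (x - 1)` -/

/-- The continuous function equal to `1` on `(-∞, 1]` with `f' (x) = t f (x - 1)` for `x > 1`. -/
noncomputable def delayExp {𝕜 : Type*} [RCLike 𝕜] (t : 𝕜) (x : ℝ) : 𝕜 :=
  ∑ k ∈ Finset.range (⌊x⌋₊ + 1), (((x - (k : ℝ)) ^ k : ℝ) : 𝕜) * t ^ k / (k.factorial : 𝕜)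

section delayExp

variable {𝕜 : Type*} [RCLike 𝕜]

/-- Truncated powers remove the floor from the range of summation, so that continuity and
integration can be done term by term. The term `k = 0` is `1` for every `x`, also a negative one,
since `0 ^ 0 = 1`. -/
theorem delayExp_eq_sum_max (t : 𝕜) {x : ℝ} {N : ℕ} (hx : x ≤ N) :
    delayExp t x = ∑ k ∈ Finset.range (N + 1),
      (((max (x - (k : ℝ)) 0) ^ k : ℝ) : 𝕜) * t ^ k / (k.factorial : 𝕜) := by
  have hN : ⌊x⌋₊ ≤ N := Nat.floor_le_of_le hx
  rw [delayExp]
  have hsub : Finset.range (⌊x⌋₊ + 1) ⊆ Finset.range (N + 1) :=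
    Finset.range_subset_range.2 (by omega)
  rw [← Finset.sum_subset hsub]
  · refine Finset.sum_congr rfl fun k hk => ?_
    rcases Nat.eq_zero_or_pos k with rfl | hk0
    · simp
    · have hk' : k ≤ ⌊x⌋₊ := by simpa [Nat.lt_succ_iff] using hk
      have : (k : ℝ) ≤ x := (Nat.le_floor_iff' hk0.ne').1 hk'
      rw [max_eq_left (by linarith)]
  · intro k _ hk
    have hk' : ⌊x⌋₊ < k := by simpa using hk
    have : x < k := (Nat.floor_lt' (by omega)).1 hk'
    rw [max_eq_right (by linarith), zero_pow (by omega)]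
    simp

theorem delayExp_of_le_one (t : 𝕜) {x : ℝ} (hx : x ≤ 1) : delayExp t x = 1 := by
  rw [delayExp_eq_sum_max t (N := 1) (by simpa using hx), Finset.sum_range_succ,
    Finset.sum_range_one]
  simp [max_eq_right (sub_nonpos.2 hx)]

theorem continuous_delayExp_uncurry : Continuous fun p : 𝕜 × ℝ => delayExp p.1 p.2 := by
  rw [continuous_iff_continuousAt]
  rintro ⟨t, x⟩
  obtain ⟨N, hN⟩ := exists_nat_gt x
  have hc : Continuous fun p : 𝕜 × ℝ => ∑ k ∈ Finset.range (N + 1),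
      (((max (p.2 - (k : ℝ)) 0) ^ k : ℝ) : 𝕜) * p.1 ^ k / (k.factorial : 𝕜) := by
    refine continuous_finsetSum _ fun k _ => ?_
    refine Continuous.div_const (Continuous.mul ?_ (by fun_prop)) _
    exact RCLike.continuous_ofReal.comp (by fun_prop)
  refine hc.continuousAt.congr ?_
  filter_upwards [(isOpen_Iio.preimage continuous_snd).mem_nhds (show (t, x).2 ∈ Iio (N : ℝ) from hN)]
    with p hp
  exact (delayExp_eq_sum_max p.1 (le_of_lt hp)).symm

theorem continuous_delayExp (t : 𝕜) : Continuous (delayExp t) :=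
  continuous_delayExp_uncurry.comp (continuous_const.prodMk continuous_id)

theorem integral_max_sub_pow (k : ℕ) {y : ℝ} (hy : 0 ≤ y) :
    ∫ u in (0 : ℝ)..y, (max (u - (k : ℝ)) 0) ^ k = (max (y - k) 0) ^ (k + 1) / (k + 1) := by
  rcases Nat.eq_zero_or_pos k with rfl | hk
  · simp [hy]
  have hzero : ∀ b : ℝ, 0 ≤ b → b ≤ k →
      ∫ u in (0 : ℝ)..b, (max (u - (k : ℝ)) 0) ^ k = 0 := by
    intro b hb hbk
    rw [intervalIntegral.integral_congr (g := fun _ => (0 : ℝ)), intervalIntegral.integral_zero]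
    intro u hu
    rw [uIcc_of_le hb] at hu
    have : u - k ≤ 0 := by linarith [hu.2]
    simp [max_eq_right this, hk.ne']
  rcases le_total y k with h | h
  · rw [hzero y hy h, max_eq_right (by linarith)]; simp
  · have hi : ∀ a b : ℝ, IntervalIntegrable (fun u : ℝ => (max (u - (k : ℝ)) 0) ^ k) volume a b :=
      fun a b => Continuous.intervalIntegrable (by fun_prop) _ _
    rw [← intervalIntegral.integral_add_adjacent_intervals (hi 0 k) (hi k y),
      hzero k (by positivity) le_rfl, zero_add,
      intervalIntegral.integral_congr (g := fun u : ℝ => (u - k) ^ k)]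
    · rw [intervalIntegral.integral_comp_sub_right (fun u => u ^ k) (k : ℝ), integral_pow,
        max_eq_left (by linarith)]
      simp
    · intro u hu
      rw [uIcc_of_le h] at hu
      simp [max_eq_left (sub_nonneg.2 hu.1)]

theorem delayExp_eq_integral (t : 𝕜) {x : ℝ} (hx : 1 ≤ x) :
    delayExp t x = 1 + t * ∫ u in (0 : ℝ)..(x - 1), delayExp t u := by
  obtain ⟨N, hN⟩ := exists_nat_ge x
  have h1 : ∀ u ∈ uIcc 0 (x - 1), delayExp t u = ∑ k ∈ Finset.range (N + 1),
      (((max (u - (k : ℝ)) 0) ^ k : ℝ) : 𝕜) * (t ^ k / (k.factorial : 𝕜)) := by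
    intro u hu
    rw [uIcc_of_le (by linarith)] at hu
    rw [delayExp_eq_sum_max t (N := N) (by linarith [hu.2])]
    exact Finset.sum_congr rfl fun k _ => by ring
  have hN' : x ≤ ((N + 1 : ℕ) : ℝ) := by push_cast; linarith
  rw [intervalIntegral.integral_congr h1, intervalIntegral.integral_finsetSum,
    delayExp_eq_sum_max t hN', Finset.sum_range_succ', add_comm, Finset.mul_sum]
  · congr 1
    · simp
    · refine Finset.sum_congr rfl fun k _ => ?_
      rw [intervalIntegral.integral_mul_const, RCLike.intervalIntegral_ofReal,
        integral_max_sub_pow k (by linarith)]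
      have h2 : ((k : 𝕜) + 1) ≠ 0 := by exact_mod_cast Nat.succ_ne_zero k
      have h3 : (k.factorial : 𝕜) ≠ 0 := by exact_mod_cast k.factorial_ne_zero
      have h4 : x - ((k + 1 : ℕ) : ℝ) = x - 1 - k := by push_cast; ring
      rw [h4, Nat.factorial_succ]
      push_cast
      field_simp
      ring
  · intro k _
    refine Continuous.intervalIntegrable (Continuous.mul ?_ continuous_const) _ _
    exact RCLike.continuous_ofReal.comp (by fun_prop)

/-- The delay equation in the form used later: no reference to the initial value, and valid from the
kink at `1` onwards. -/
theorem delayExp_sub (t : 𝕜) {x y : ℝ} (hx : 1 ≤ x) (hy : 1 ≤ y) :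
    delayExp t y - delayExp t x = t * ∫ u in (x - 1)..(y - 1), delayExp t u := by
  have hi : ∀ a b : ℝ, IntervalIntegrable (delayExp t) volume a b :=
    fun a b => (continuous_delayExp t).intervalIntegrable a b
  rw [delayExp_eq_integral t hx, delayExp_eq_integral t hy,
    ← intervalIntegral.integral_interval_sub_left (hi 0 (y - 1)) (hi 0 (x - 1))]
  ring

/-- The delay equation in integrated form has at most one continuous solution. -/
theorem eq_mul_delayExp (t : 𝕜) {L : ℝ} {f : ℝ → 𝕜} {c : 𝕜}
    (h0 : ∀ x ∈ Icc 0 L, x ≤ 1 → f x = c)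
    (h1 : ∀ x ∈ Icc 1 L, f x = c + t * ∫ u in (0 : ℝ)..(x - 1), f u) :
    ∀ x ∈ Icc 0 L, f x = c * delayExp t x := by
  -- Method of steps: the values on `[0, n+1]` determine those on `[0, n+2]`, because the integral
  -- only reaches `x - 1`.
  have key : ∀ n : ℕ, ∀ x ∈ Icc 0 L, x ≤ n + 1 → f x = c * delayExp t x := by
    intro n
    induction n with
    | zero =>
      intro x hx hxn
      have hx1 : x ≤ 1 := by simpa using hxn
      rw [h0 x hx hx1, delayExp_of_le_one t hx1, mul_one]
    | succ n ih =>
      intro x hx hxn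
      rcases le_total x 1 with hx1 | hx1
      · rw [h0 x hx hx1, delayExp_of_le_one t hx1, mul_one]
      · rw [h1 x ⟨hx1, hx.2⟩, delayExp_eq_integral t hx1,
          intervalIntegral.integral_congr (g := fun u => c * delayExp t u)]
        · rw [intervalIntegral.integral_const_mul]; ring
        · intro u hu
          rw [uIcc_of_le (by linarith)] at hu
          push_cast at hxn
          exact ih u ⟨hu.1, by linarith [hu.2, hx.2]⟩ (by linarith [hu.2])
  intro x hx
  obtain ⟨n, hn⟩ := exists_nat_ge x
  exact key n x hx (by linarith)

theorem delayExp_ofReal (t x : ℝ) : delayExp (t : ℂ) x = ((delayExp t x : ℝ) : ℂ) := by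
  simp [delayExp]

end delayExp

theorem gFun_eq_exp_mul_delayExp (lam : ℂ) {x : ℝ} (hx : 0 ≤ x) :
    gFun lam x = Real.exp x * delayExp (-(lam * Real.exp 1)⁻¹) x := by
  rw [gFun, if_neg (by linarith), delayExp]
  congr 1
  refine Finset.sum_congr rfl fun k _ => ?_
  rw [← inv_neg, neg_mul, inv_pow]
  simp only [Complex.coe_algebraMap]
  rw [div_eq_mul_inv, div_eq_mul_inv, mul_inv]
  simp [mul_assoc]

theorem gFun_ofReal_eq (lam : ℝ) {x : ℝ} (hx : 0 ≤ x) :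
    gFun lam x = ((Real.exp x * delayExp (-(lam * Real.exp 1)⁻¹) x : ℝ) : ℂ) := by
  rw [gFun_eq_exp_mul_delayExp _ hx]
  push_cast
  rw [← delayExp_ofReal]
  push_cast
  rfl

theorem gFun_eq_zero_iff (lam : ℂ) {x : ℝ} (hx : 0 ≤ x) :
    gFun lam x = 0 ↔ delayExp (-(lam * Real.exp 1)⁻¹) x = 0 := by
  rw [gFun_eq_exp_mul_delayExp _ hx, mul_eq_zero, or_iff_right]
  exact_mod_cast (Real.exp_pos x).ne'

theorem gFun_ofReal_eq_zero_iff (lam : ℝ) {x : ℝ} (hx : 0 ≤ x) :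
    gFun lam x = 0 ↔ delayExp (-(lam * Real.exp 1)⁻¹) x = 0 := by
  rw [gFun_ofReal_eq _ hx, Complex.ofReal_eq_zero, mul_eq_zero, or_iff_right (Real.exp_pos x).ne']

/-! ### Eigenfunctions of the killed walk -/

theorem oneMinusExpDensity_nonneg (z : ℝ) : 0 ≤ oneMinusExpDensity z := by
  rw [oneMinusExpDensity]; split_ifs <;> positivity

theorem oneMinusExpDensity_le_one (z : ℝ) : oneMinusExpDensity z ≤ 1 := by
  rw [oneMinusExpDensity]
  split_ifs with h
  · exact Real.exp_le_one_iff.2 (by linarith)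
  · exact zero_le_one

theorem measurable_oneMinusExpDensity : Measurable oneMinusExpDensity :=
  Measurable.ite measurableSet_Iic (by fun_prop) measurable_const

theorem intervalIntegrable_mul_density {𝕜 : Type*} [RCLike 𝕜] {a b : ℝ} {g : ℝ → 𝕜}
    (hg : IntervalIntegrable g volume a b) (x : ℝ) :
    IntervalIntegrable (fun u => g u * (oneMinusExpDensity (x - u) : 𝕜)) volume a b := by
  have hm : Measurable fun u : ℝ => ((oneMinusExpDensity (x - u) : ℝ) : 𝕜) :=
    RCLike.measurable_ofReal.comp
      (measurable_oneMinusExpDensity.comp (measurable_const.sub measurable_id))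
  have hb : ∀ u : ℝ, ‖((oneMinusExpDensity (x - u) : ℝ) : 𝕜)‖ ≤ 1 := fun u => by
    rw [RCLike.norm_ofReal, abs_of_nonneg (oneMinusExpDensity_nonneg _)]
    exact oneMinusExpDensity_le_one _
  exact ⟨hg.1.mul_bdd hm.aestronglyMeasurable (Filter.Eventually.of_forall hb),
    hg.2.mul_bdd hm.aestronglyMeasurable (Filter.Eventually.of_forall hb)⟩

/-- The killed kernel, in terms of `f (u) = g (u) e^{-u}`. -/
theorem integral_mul_density {𝕜 : Type*} [RCLike 𝕜] {H : ℝ} {g : ℝ → 𝕜}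
    (hg : IntervalIntegrable g volume 0 H) {x : ℝ} (hx : x ∈ Icc 0 H) :
    ∫ u in (0 : ℝ)..H, g u * (oneMinusExpDensity (x - u) : 𝕜)
      = (Real.exp (x - 1) : 𝕜) * ∫ u in (max (x - 1) 0)..H, g u * (Real.exp (-u) : 𝕜) := by
  set m := max (x - 1) 0 with hm
  have hm0 : 0 ≤ m := le_max_right _ _
  have hmH : m ≤ H := max_le (by linarith [hx.2]) (hx.1.trans hx.2)
  have hi := intervalIntegrable_mul_density hg x
  have hmem : m ∈ uIcc 0 H := by rw [uIcc_of_le (hm0.trans hmH)]; exact ⟨hm0, hmH⟩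
  have h0 : uIcc 0 m ⊆ uIcc 0 H := uIcc_subset_uIcc left_mem_uIcc hmem
  have hH : uIcc m H ⊆ uIcc 0 H := uIcc_subset_uIcc hmem right_mem_uIcc
  rw [← intervalIntegral.integral_add_adjacent_intervals (hi.mono_set h0) (hi.mono_set hH)]
  have hz : ∫ u in (0 : ℝ)..m, g u * (oneMinusExpDensity (x - u) : 𝕜) = 0 := by
    rw [intervalIntegral.integral_of_le hm0, integral_Ioc_eq_integral_Ioo]
    refine setIntegral_eq_zero_of_forall_eq_zero fun u hu => ?_
    have : ¬ x - u ≤ 1 := by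
      rcases le_total (x - 1) 0 with h | h
      · rw [hm, max_eq_right h] at hu; exact absurd hu.1 (not_lt.2 hu.2.le)
      · rw [hm, max_eq_left h] at hu; linarith [hu.2]
    simp [oneMinusExpDensity, this]
  rw [hz, zero_add, ← intervalIntegral.integral_const_mul]
  refine intervalIntegral.integral_congr fun u hu => ?_
  rw [uIcc_of_le hmH] at hu
  have : x - u ≤ 1 := by linarith [hu.1, le_max_left (x - 1) 0]
  simp only [oneMinusExpDensity, if_pos this]
  rw [mul_left_comm, ← RCLike.ofReal_mul, ← Real.exp_add]
  congr 3
  ring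

/-- Subtracting the delay equation at `H + 1`, where the value is zero, from the one at `x` turns
the initial value problem into an integral up to the right end `H`. For `x ≤ 1` the value is the
same as at `1`, which accounts for the maximum. -/
theorem delayExp_integral_of_zero {𝕜 : Type*} [RCLike 𝕜] {t : 𝕜} {H x : ℝ}
    (hz : delayExp t (H + 1) = 0) (hx : x ∈ Icc 0 H) :
    delayExp t x = -t * ∫ u in (max (x - 1) 0)..H, delayExp t u := by
  have hx0 := hx.1.trans hx.2
  rcases le_total x 1 with h | h
  · have := delayExp_eq_integral t (x := H + 1) (by linarith)
    rw [hz, add_sub_cancel_right] at this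
    rw [delayExp_of_le_one t h, max_eq_right (by linarith), neg_mul]
    exact eq_neg_of_add_eq_zero_left this.symm
  · have := delayExp_sub t (x := x) (y := H + 1) h (by linarith)
    rw [hz, add_sub_cancel_right] at this
    rw [max_eq_left (by linarith), neg_mul, ← this]
    ring

/-- Stated over both fields: the complex case yields the eigenfunctions, the real case the positive
function with which they are compared. -/
theorem exp_mul_delayExp_eigen {𝕜 : Type*} [RCLike 𝕜] {H : ℝ} {lam : 𝕜} (hlam : lam ≠ 0)
    (hz : delayExp (-(lam * (Real.exp 1 : 𝕜))⁻¹) (H + 1) = 0) {x : ℝ} (hx : x ∈ Icc 0 H) :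
    lam * ((Real.exp x : 𝕜) * delayExp (-(lam * (Real.exp 1 : 𝕜))⁻¹) x) =
      ∫ u in (0 : ℝ)..H, ((Real.exp u : 𝕜) * delayExp (-(lam * (Real.exp 1 : 𝕜))⁻¹) u) *
        (oneMinusExpDensity (x - u) : 𝕜) := by
  set t : 𝕜 := -(lam * (Real.exp 1 : 𝕜))⁻¹ with ht
  have hc : Continuous (fun u : ℝ => (Real.exp u : 𝕜) * delayExp t u) :=
    (RCLike.continuous_ofReal.comp Real.continuous_exp).mul (continuous_delayExp t)
  rw [integral_mul_density (hc.intervalIntegrable _ _) hx]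
  have : ∀ u : ℝ, (Real.exp u : 𝕜) * delayExp t u * (Real.exp (-u) : 𝕜) = delayExp t u := by
    intro u
    rw [mul_right_comm, ← RCLike.ofReal_mul, ← Real.exp_add]
    simp
  simp only [this]
  rw [delayExp_integral_of_zero hz hx, Real.exp_sub, ht]
  have he : (Real.exp 1 : 𝕜) ≠ 0 := by exact_mod_cast (Real.exp_pos 1).ne'
  push_cast at he ⊢
  field_simp

theorem gFun_eigen {H : ℝ} {lam : ℂ} (hlam : lam ≠ 0)
    (hz : gFun lam (H + 1) = 0) {x : ℝ} (hx : x ∈ Icc 0 H) :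
    lam * gFun lam x = ∫ u in (0 : ℝ)..H, gFun lam u * (oneMinusExpDensity (x - u) : ℂ) := by
  have hH : 0 ≤ H := hx.1.trans hx.2
  rw [gFun_eq_zero_iff _ (by linarith)] at hz
  rw [gFun_eq_exp_mul_delayExp _ hx.1]
  refine (exp_mul_delayExp_eigen hlam hz hx).trans (intervalIntegral.integral_congr fun u hu => ?_)
  rw [uIcc_of_le hH] at hu
  simp only [gFun_eq_exp_mul_delayExp _ hu.1, Complex.coe_algebraMap]

/-- The eigenvalue equation holds at every point of `[0, H]`, so an eigenfunction that is merely
integrable is determined pointwise. Its constant `c` is its value at `0`, which cannot vanish, and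
the equation at `0` then becomes the condition at `H + 1`. -/
theorem eigenfunction_eq {H : ℝ} {lam : ℂ} {g : ℝ → ℂ} (hH : 0 < H) (hlam : lam ≠ 0)
    (hg : IsLeftEigenfunction oneMinusExpDensity H lam g) :
    gFun lam (H + 1) = 0 ∧
      ∃ c : ℂ, c ≠ 0 ∧ g = (Set.Icc 0 H).indicator (fun x => c * gFun lam x) := by
  obtain ⟨hint, hsupp, ⟨x₀, hx₀⟩, heq⟩ := hg
  set t : ℂ := -(lam * Real.exp 1)⁻¹ with ht
  have he : (Real.exp 1 : ℂ) ≠ 0 := by exact_mod_cast (Real.exp_pos 1).ne'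
  have hgi : IntervalIntegrable g volume 0 H :=
    (intervalIntegrable_iff_integrableOn_Icc_of_le hH.le).2 hint
  set f : ℝ → ℂ := fun u => g u * (Real.exp (-u) : ℂ) with hf
  have hfi : IntervalIntegrable f volume 0 H :=
    hgi.mul_continuousOn (Complex.continuous_ofReal.comp (by fun_prop)).continuousOn
  -- The factor `e^{x-1} e^{-x} = 1/e` merges with `1/λ` into `-t`.
  have hfx : ∀ x ∈ Icc 0 H, f x = -t * ∫ u in (max (x - 1) 0)..H, f u := by
    intro x hx
    have h := heq x hx
    rw [show (∫ u in (0 : ℝ)..H, g u * ((oneMinusExpDensity (x - u) : ℝ) : ℂ)) = _ from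
      integral_mul_density hgi hx] at h
    have hgx : g x = lam⁻¹ * ((Real.exp (x - 1) : ℂ) * ∫ u in (max (x - 1) 0)..H, f u) := by
      rw [eq_inv_mul_iff_mul_eq₀ hlam]; exact h
    have hee : (Real.exp (x - 1) : ℂ) * (Real.exp (-x) : ℂ) = (Real.exp 1 : ℂ)⁻¹ := by
      rw [← Complex.ofReal_mul, ← Real.exp_add, ← Complex.ofReal_inv, ← Real.exp_neg]
      congr 2; ring
    calc f x = lam⁻¹ * ((Real.exp (x - 1) : ℂ) * (Real.exp (-x) : ℂ)) *
          ∫ u in (max (x - 1) 0)..H, f u := by rw [hf]; simp only; rw [hgx]; ring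
      _ = -t * ∫ u in (max (x - 1) 0)..H, f u := by rw [hee, ht, mul_inv, neg_neg]
  have hsub : ∀ y ∈ Icc 0 H, uIcc 0 y ⊆ uIcc 0 H := fun y hy =>
    uIcc_subset_uIcc left_mem_uIcc (by rw [uIcc_of_le hH.le]; exact hy)
  have h0 : f 0 = -t * ∫ u in (0 : ℝ)..H, f u := by
    rw [hfx 0 ⟨le_rfl, hH.le⟩, max_eq_right (by norm_num)]
  have hsol := eq_mul_delayExp t (L := H) (f := f) (c := f 0)
    (fun x hx hx1 => by rw [hfx x hx, h0, max_eq_right (by linarith)])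
    (fun x hx => by
      have hx1 : x - 1 ∈ Icc 0 H := ⟨by linarith [hx.1], by linarith [hx.2]⟩
      rw [hfx x ⟨by linarith [hx.1], hx.2⟩, h0, max_eq_left hx1.1,
        ← intervalIntegral.integral_interval_sub_left hfi (hfi.mono_set (hsub _ hx1))]
      ring)
  have hgsol : ∀ x ∈ Icc 0 H, g x = f 0 * gFun lam x := by
    intro x hx
    have h1 := hsol x hx
    have hee : (Real.exp (-x) : ℂ) * (Real.exp x : ℂ) = 1 := by
      rw [← Complex.ofReal_mul, ← Real.exp_add]; simp
    calc g x = f x * (Real.exp x : ℂ) := by rw [hf]; simp only; rw [mul_assoc, hee, mul_one]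
      _ = f 0 * gFun lam x := by rw [h1, gFun_eq_exp_mul_delayExp _ hx.1]; ring
  have hgind : g = (Set.Icc 0 H).indicator (fun x => f 0 * gFun lam x) := by
    ext x
    by_cases hx : x ∈ Icc 0 H
    · rw [indicator_of_mem hx, hgsol x hx]
    · rw [indicator_of_notMem hx, hsupp x hx]
  have hc : f 0 ≠ 0 := by
    intro hc
    refine hx₀ ?_
    rw [hgind, hc]
    simp
  refine ⟨?_, f 0, hc, hgind⟩
  rw [gFun_eq_zero_iff _ (by linarith), ← ht, delayExp_eq_integral t (by linarith),
    add_sub_cancel_right]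
  rw [intervalIntegral.integral_congr (g := fun u => f 0 * delayExp t u)
    (fun u hu => hsol u (by rwa [uIcc_of_le hH.le] at hu)),
    intervalIntegral.integral_const_mul] at h0
  -- The equation at `0` reads `f 0 = -t f 0 ∫ delayExp t`, and `f 0` cancels.
  refine mul_left_cancel₀ hc ?_
  linear_combination h0

theorem isLeftEigenfunction_gFun {H : ℝ} {lam c : ℂ} (hH : 0 < H) (hlam : lam ≠ 0) (hc : c ≠ 0)
    (hz : gFun lam (H + 1) = 0) :
    IsLeftEigenfunction oneMinusExpDensity H lam
      ((Set.Icc 0 H).indicator (fun x => c * gFun lam x)) := by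
  have hcont : ContinuousOn (fun x => c * gFun lam x) (Icc 0 H) := by
    refine ContinuousOn.mul continuousOn_const ?_
    refine ContinuousOn.congr (f := fun u : ℝ => (Real.exp u : ℂ) *
      delayExp (-(lam * Real.exp 1)⁻¹) u) ?_ fun u hu => gFun_eq_exp_mul_delayExp _ hu.1
    exact ((Complex.continuous_ofReal.comp Real.continuous_exp).mul
      (continuous_delayExp _)).continuousOn
  refine ⟨?_, fun x hx => indicator_of_notMem hx _, ⟨0, ?_⟩, fun x hx => ?_⟩
  · refine IntegrableOn.congr_fun (hcont.integrableOn_Icc) (fun x hx => ?_) measurableSet_Icc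
    rw [indicator_of_mem hx]
  · rw [indicator_of_mem (show (0 : ℝ) ∈ Icc 0 H from ⟨le_rfl, hH.le⟩), gFun_eq_exp_mul_delayExp _ le_rfl,
      delayExp_of_le_one _ zero_le_one]
    simpa using hc
  · rw [indicator_of_mem hx, mul_left_comm, gFun_eigen hlam hz hx,
      ← intervalIntegral.integral_const_mul]
    refine intervalIntegral.integral_congr fun u hu => ?_
    rw [uIcc_of_le hH.le] at hu
    simp only [indicator_of_mem hu]
    ring

theorem isLeftEigenfunction_iff {H : ℝ} {lam : ℂ} (hH : 0 < H) (hlam : lam ≠ 0) (g : ℝ → ℂ) :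
    IsLeftEigenfunction oneMinusExpDensity H lam g ↔ gFun lam (H + 1) = 0 ∧
      ∃ c : ℂ, c ≠ 0 ∧ g = (Set.Icc 0 H).indicator (fun x => c * gFun lam x) := by
  refine ⟨eigenfunction_eq hH hlam, ?_⟩
  rintro ⟨hz, c, hc, rfl⟩
  exact isLeftEigenfunction_gFun hH hlam hc hz

theorem isKilledEigenvalue_iff {H : ℝ} {lam : ℂ} (hH : 0 < H) (hlam : lam ≠ 0) :
    IsKilledEigenvalue oneMinusExpDensity H lam ↔ gFun lam (H + 1) = 0 := by
  refine ⟨?_, fun hz => ?_⟩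
  · rintro ⟨g, hg⟩
    exact (eigenfunction_eq hH hlam hg).1
  exact ⟨_, isLeftEigenfunction_gFun hH hlam one_ne_zero hz⟩

/-! ### Reflection of the walk -/

theorem expMinusOneDensity_eq (z : ℝ) : expMinusOneDensity z = oneMinusExpDensity (-z) := by
  rw [expMinusOneDensity, oneMinusExpDensity]
  by_cases h : -1 ≤ z
  · rw [if_pos h, if_pos (by linarith)]; congr 1; ring
  · rw [if_neg h, if_neg (by linarith)]

/-- The substitution `x ↦ H - x`, `u ↦ H - u` preserves the interval and changes the sign of `x -
u`. -/
theorem IsLeftEigenfunction.reflect {p q : ℝ → ℝ} (hpq : ∀ z, q z = p (-z)) {H : ℝ} (hH : 0 ≤ H)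
    {lam : ℂ} {g : ℝ → ℂ} (hg : IsLeftEigenfunction p H lam g) :
    IsLeftEigenfunction q H lam fun x => g (H - x) := by
  obtain ⟨hint, hsupp, ⟨x₀, hx₀⟩, heq⟩ := hg
  have hmem : ∀ {x}, x ∈ Icc 0 H → H - x ∈ Icc 0 H := fun hx =>
    ⟨by linarith [hx.2], by linarith [hx.1]⟩
  refine ⟨?_, fun x hx => hsupp _ fun h => hx ?_, ⟨H - x₀, by simpa using hx₀⟩, fun x hx => ?_⟩
  · rw [← intervalIntegrable_iff_integrableOn_Icc_of_le hH] at hint ⊢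
    simpa using (hint.comp_sub_left H).symm
  · simpa using hmem h
  · rw [heq _ (hmem hx)]
    have := intervalIntegral.integral_comp_sub_left (a := 0) (b := H)
      (fun u => g u * (p (H - x - u) : ℂ)) H
    rw [sub_self, sub_zero] at this
    rw [← this]
    refine intervalIntegral.integral_congr fun u _ => ?_
    simp only [hpq]
    congr 3
    ring

theorem isKilledEigenvalue_expMinusOne_iff {A : ℝ} (hA : 0 ≤ A) (lam : ℂ) :
    IsKilledEigenvalue expMinusOneDensity A lam ↔ IsKilledEigenvalue oneMinusExpDensity A lam := by
  constructor
  · rintro ⟨g, hg⟩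
    exact ⟨_, hg.reflect (fun z => by rw [expMinusOneDensity_eq, neg_neg]) hA⟩
  · rintro ⟨g, hg⟩
    exact ⟨_, hg.reflect expMinusOneDensity_eq hA⟩

theorem isPrincipalEigenvalue_expMinusOne_iff {A : ℝ} (hA : 0 < A) (lam : ℝ) :
    IsPrincipalEigenvalue expMinusOneDensity A lam ↔
      IsPrincipalEigenvalue oneMinusExpDensity A lam := by
  simp only [IsPrincipalEigenvalue, isKilledEigenvalue_expMinusOne_iff hA.le]

/-! ### The principal eigenvalue -/

theorem IsPrincipalEigenvalue.unique {p : ℝ → ℝ} {H lam mu : ℝ}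
    (h₁ : IsPrincipalEigenvalue p H lam) (h₂ : IsPrincipalEigenvalue p H mu) : lam = mu := by
  refine le_antisymm ?_ ?_
  · simpa [abs_of_pos h₁.1] using h₂.2.2 _ h₁.2.1
  · simpa [abs_of_pos h₂.1] using h₁.2.2 _ h₂.2.1

/-- Intermediate values, starting from the value `1` at `1`. -/
theorem delayExp_pos_of_ne_zero {t b : ℝ} (h : ∀ x, 0 < x → x < b → delayExp t x ≠ 0)
    {x : ℝ} (hx : x < b) : 0 < delayExp t x := by
  rcases le_total x 1 with hx1 | hx1
  · rw [delayExp_of_le_one t hx1]; exact one_pos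
  by_contra! hneg
  obtain ⟨y, hy, hy0⟩ := intermediate_value_Icc' hx1 (continuous_delayExp t).continuousOn
    ⟨hneg, by rw [delayExp_of_le_one t le_rfl]; exact zero_le_one⟩
  exact h y (by linarith [hy.1]) (by linarith [hy.2]) hy0

theorem isLeast_zero_iff {lam H : ℝ} (hH : 0 ≤ H) :
    IsLeast {x : ℝ | 0 < x ∧ gFun (lam : ℂ) x = 0} (H + 1) ↔
      delayExp (-(lam * Real.exp 1)⁻¹) (H + 1) = 0 ∧
        ∀ x, x < H + 1 → 0 < delayExp (-(lam * Real.exp 1)⁻¹) x := by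
  constructor
  · rintro ⟨⟨h0, hz⟩, hmin⟩
    refine ⟨(gFun_ofReal_eq_zero_iff _ h0.le).1 hz, fun x => delayExp_pos_of_ne_zero ?_⟩
    intro y hy hyH hy0
    exact absurd (hmin ⟨hy, (gFun_ofReal_eq_zero_iff _ hy.le).2 hy0⟩) (not_le.2 hyH)
  · rintro ⟨hz, hpos⟩
    refine ⟨⟨by linarith, (gFun_ofReal_eq_zero_iff _ (by linarith)).2 hz⟩, fun y hy => ?_⟩
    by_contra! hlt
    exact (hpos y hlt).ne' ((gFun_ofReal_eq_zero_iff _ hy.1.le).1 hy.2)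

theorem norm_mul_gFun_le {H : ℝ} {mu : ℂ} (hmu : mu ≠ 0)
    (hz : delayExp (-(mu * Real.exp 1)⁻¹) (H + 1) = 0) {x : ℝ} (hx : x ∈ Icc 0 H) :
    ‖mu‖ * ‖(Real.exp x : ℂ) * delayExp (-(mu * Real.exp 1)⁻¹) x‖ ≤
      ∫ u in (0 : ℝ)..H, ‖(Real.exp u : ℂ) * delayExp (-(mu * Real.exp 1)⁻¹) u‖ *
        oneMinusExpDensity (x - u) := by
  rw [← norm_mul]
  refine (congrArg norm (exp_mul_delayExp_eigen hmu hz hx)).trans_le ?_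
  refine (intervalIntegral.norm_integral_le_integral_norm (hx.1.trans hx.2)).trans_eq ?_
  refine intervalIntegral.integral_congr fun u _ => ?_
  refine (norm_mul _ _).trans (congrArg _ ?_)
  rw [RCLike.norm_ofReal, abs_of_nonneg (oneMinusExpDensity_nonneg _)]

theorem continuous_exp_mul_delayExp {𝕜 : Type*} [RCLike 𝕜] (t : 𝕜) :
    Continuous fun u : ℝ => (Real.exp u : 𝕜) * delayExp t u :=
  (RCLike.continuous_ofReal.comp Real.continuous_exp).mul (continuous_delayExp t)

/-- A positive solution on `[0, H₂]` dominates all eigenvalues on smaller intervals. -/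
theorem norm_le_of_isKilledEigenvalue {H₁ H₂ lam : ℝ} (hH₁ : 0 < H₁) (h12 : H₁ ≤ H₂)
    (hlam : 0 < lam) (hz : delayExp (-(lam * Real.exp 1)⁻¹) (H₂ + 1) = 0)
    (hpos : ∀ x, x < H₂ + 1 → 0 < delayExp (-(lam * Real.exp 1)⁻¹) x)
    {mu : ℂ} (hmu : IsKilledEigenvalue oneMinusExpDensity H₁ mu) : ‖mu‖ ≤ lam := by
  rcases eq_or_ne mu 0 with rfl | hmu0
  · simpa using hlam.le
  rw [isKilledEigenvalue_iff hH₁ hmu0, gFun_eq_zero_iff _ (by linarith)] at hmu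
  set F : ℝ → ℂ := fun u => (Real.exp u : ℂ) * delayExp (-(mu * Real.exp 1)⁻¹) u with hF
  set G : ℝ → ℝ := fun u => Real.exp u * delayExp (-(lam * Real.exp 1)⁻¹) u with hG
  have hFc : Continuous F := continuous_exp_mul_delayExp _
  have hGc : Continuous G := continuous_exp_mul_delayExp (𝕜 := ℝ) _
  have hGpos : ∀ x, x < H₂ + 1 → 0 < G x := fun x hx => mul_pos (Real.exp_pos x) (hpos x hx)
  -- Collatz–Wielandt argument: at a maximum point of `|F|/G` the two eigenvalue equations can be
  -- compared. The quotient is continuous because `G` is positive up to, but not including, `H₂ +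
  -- 1`.
  obtain ⟨x₀, hx₀, hmax⟩ := isCompact_Icc.exists_isMaxOn (nonempty_Icc.2 hH₁.le)
    (f := fun u => ‖F u‖ / G u)
    (hFc.norm.continuousOn.div hGc.continuousOn fun x hx => (hGpos x (by linarith [hx.2])).ne')
  set M := ‖F x₀‖ / G x₀ with hM
  have hle : ∀ u ∈ Icc 0 H₁, ‖F u‖ ≤ M * G u := fun u hu =>
    (div_le_iff₀ (hGpos u (by linarith [hu.2]))).1 (hmax hu)
  have hG0 : 0 < G x₀ := hGpos x₀ (by linarith [hx₀.2])
  have hM0 : 0 < M := by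
    have := hmax (left_mem_Icc.2 hH₁.le)
    have h1 : ‖F 0‖ / G 0 = 1 := by
      simp [hF, hG, delayExp_of_le_one]
    simp only [mem_ofPred_eq, h1] at this
    exact one_pos.trans_le this
  have hFx₀ : ‖F x₀‖ = M * G x₀ := by rw [hM]; field_simp
  have hFpos : 0 < ‖F x₀‖ := by rw [hFx₀]; positivity
  have hGi : ∀ a b, IntervalIntegrable (fun u => G u * oneMinusExpDensity (x₀ - u)) volume a b :=
    fun a b => intervalIntegrable_mul_density (𝕜 := ℝ) (hGc.intervalIntegrable a b) x₀
  have key : ‖mu‖ * ‖F x₀‖ ≤ lam * ‖F x₀‖ := calc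
    ‖mu‖ * ‖F x₀‖ ≤ ∫ u in (0 : ℝ)..H₁, ‖F u‖ * oneMinusExpDensity (x₀ - u) :=
      norm_mul_gFun_le hmu0 hmu hx₀
    _ ≤ ∫ u in (0 : ℝ)..H₁, M * (G u * oneMinusExpDensity (x₀ - u)) := by
      refine intervalIntegral.integral_mono_on hH₁.le
        (intervalIntegrable_mul_density (𝕜 := ℝ) (hFc.norm.intervalIntegrable _ _) x₀)
        ((hGi _ _).const_mul M) fun u hu => ?_
      rw [← mul_assoc]
      exact mul_le_mul_of_nonneg_right (hle u hu) (oneMinusExpDensity_nonneg _)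
    _ = M * ∫ u in (0 : ℝ)..H₁, G u * oneMinusExpDensity (x₀ - u) :=
      intervalIntegral.integral_const_mul _ _
    -- Enlarging the interval only adds mass; this is why one estimate gives both maximality and
    -- monotonicity in `H`.
    _ ≤ M * ∫ u in (0 : ℝ)..H₂, G u * oneMinusExpDensity (x₀ - u) := by
      refine mul_le_mul_of_nonneg_left ?_ hM0.le
      rw [← intervalIntegral.integral_add_adjacent_intervals (hGi 0 H₁) (hGi H₁ H₂)]
      refine le_add_of_nonneg_right (intervalIntegral.integral_nonneg h12 fun u hu => ?_)
      exact mul_nonneg (hGpos u (by linarith [hu.2])).le (oneMinusExpDensity_nonneg _)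
    _ = M * (lam * G x₀) := by
      congr 1
      exact (exp_mul_delayExp_eigen (𝕜 := ℝ) hlam.ne' hz ⟨hx₀.1, hx₀.2.trans h12⟩).symm
    _ = lam * ‖F x₀‖ := by rw [hFx₀]; ring
  exact le_of_mul_le_mul_right key hFpos

theorem isPrincipalEigenvalue_of_delayExp {H lam : ℝ} (hH : 0 < H) (hlam : 0 < lam)
    (hz : delayExp (-(lam * Real.exp 1)⁻¹) (H + 1) = 0)
    (hpos : ∀ x, x < H + 1 → 0 < delayExp (-(lam * Real.exp 1)⁻¹) x) :
    IsPrincipalEigenvalue oneMinusExpDensity H lam := by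
  refine ⟨hlam, ?_, fun mu hmu => norm_le_of_isKilledEigenvalue hH le_rfl hlam hz hpos hmu⟩
  rw [isKilledEigenvalue_iff hH (by exact_mod_cast hlam.ne'),
    gFun_ofReal_eq_zero_iff _ (by linarith)]
  exact hz

/-- The derivative at a point is `-c` times the value one unit earlier. -/
theorem delayExp_lt_of_pos {c y x : ℝ} (hc : 0 < c) (hy : 1 ≤ y) (hyx : y < x)
    (hpos : ∀ u, u < x - 1 → 0 < delayExp (-c) u) : delayExp (-c) x < delayExp (-c) y := by
  have h := delayExp_sub (-c) (x := y) (y := x) hy (hy.trans hyx.le)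
  have hI : 0 < ∫ u in (y - 1)..(x - 1), delayExp (-c) u :=
    intervalIntegral.intervalIntegral_pos_of_pos_on
      ((continuous_delayExp (-c)).intervalIntegrable _ _) (fun u hu => hpos u hu.2) (by linarith)
  nlinarith

/-- Take the smallest `c` at which the solution reaches zero somewhere on `[0, H + 1]`. By
continuity in `c` the solution is still nonnegative there; a zero before `H + 1` would be followed
by negative values, since the solution strictly decreases while its delayed values are positive. So
the zero sits at `H + 1`. Existence of the principal eigenvalue thus needs no spectral theory. -/
theorem exists_delayExp_least_zero {H : ℝ} (hH : 0 < H) :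
    ∃ c : ℝ, 0 < c ∧ delayExp (-c) (H + 1) = 0 ∧ ∀ x, x < H + 1 → 0 < delayExp (-c) x := by
  set y := min H 1 with hy
  have hy0 : 0 < y := lt_min hH one_pos
  have hDc : Continuous fun p : ℝ × ℝ => delayExp (-p.1) p.2 :=
    continuous_delayExp_uncurry.comp (continuous_fst.neg.prodMk continuous_snd)
  set T : Set (ℝ × ℝ) := (Icc 0 y⁻¹ ×ˢ Icc 0 (H + 1)) ∩ {p | delayExp (-p.1) p.2 ≤ 0} with hT
  have hTc : IsCompact T :=
    (isCompact_Icc.prod isCompact_Icc).inter_right (isClosed_le hDc continuous_const)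
  have hTn : T.Nonempty := by
    -- As `y ≤ 1`, the solution is `1` on `[0, y]`, so its value at `y + 1` is `1 - y⁻¹ y = 0`.
    refine ⟨(y⁻¹, y + 1), ⟨⟨⟨by positivity, le_rfl⟩, ⟨by positivity, ?_⟩⟩, ?_⟩⟩
    · simp only
      linarith [min_le_left H 1]
    · have h1 : ∫ u in (0 : ℝ)..y, delayExp (-y⁻¹) u = y := by
        rw [intervalIntegral.integral_congr (g := fun _ => (1 : ℝ))]
        · simp
        · intro u hu
          rw [uIcc_of_le hy0.le] at hu
          exact delayExp_of_le_one _ (hu.2.trans (min_le_right H 1))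
      have h2 := delayExp_eq_integral (-y⁻¹) (x := y + 1) (by linarith)
      rw [add_sub_cancel_right, h1] at h2
      simp only [mem_ofPred_eq, h2]
      field_simp
      simp
  obtain ⟨⟨c, x₁⟩, ⟨⟨hcI, hx₁⟩, hle⟩, hmin⟩ := hTc.exists_isMinOn hTn continuous_fst.continuousOn
  simp only [mem_ofPred_eq] at hcI hx₁ hle
  have hx₁1 : 1 < x₁ := by
    by_contra! h
    rw [delayExp_of_le_one _ h] at hle
    exact absurd hle (by norm_num)
  have hc0 : 0 < c := by
    refine lt_of_le_of_ne hcI.1 fun h => ?_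
    have := delayExp_eq_integral (-c) hx₁1.le
    rw [← h] at this hle
    simp at this
    rw [neg_zero, this] at hle
    exact absurd hle (by norm_num)
  have hnn : ∀ x ∈ Icc 0 (H + 1), 0 ≤ delayExp (-c) x := by
    intro x hx
    -- For `s < c` the solution is positive on `[0, H + 1]` by minimality of `c`; let `s` increase
    -- to `c`.
    have hlim : Filter.Tendsto (fun s : ℝ => delayExp (-s) x) (nhdsWithin c (Iio c))
        (nhds (delayExp (-c) x)) :=
      ((hDc.comp (continuous_id.prodMk continuous_const)).tendsto c).mono_left nhdsWithin_le_nhds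
    refine ge_of_tendsto hlim ?_
    filter_upwards [Ioo_mem_nhdsLT hc0] with s hs
    by_contra! hneg
    exact absurd (hmin (show (s, x) ∈ T from
      ⟨⟨⟨hs.1.le, hs.2.le.trans hcI.2⟩, hx⟩, hneg.le⟩)) (not_le.2 hs.2)
  have hpos : ∀ x, x < H + 1 → 0 < delayExp (-c) x := by
    have hne : ∀ x, 1 ≤ x → x < H + 1 → (∀ y, y < x → 0 < delayExp (-c) y) →
        delayExp (-c) x ≠ 0 := by
      intro x hx1 hx hlt h0
      -- Up to `x + 1` the delayed values lie before `x`, where the solution is positive, so it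
      -- would be negative at `z`.
      set z := min (H + 1) (x + 1) with hz
      have hxz : x < z := lt_min hx (by linarith)
      have := delayExp_lt_of_pos hc0 hx1 hxz fun u hu => hlt u (by
        linarith [min_le_right (H + 1) (x + 1)])
      linarith [hnn z ⟨by linarith, min_le_left _ _⟩]
    by_contra! hcon
    obtain ⟨x, hxH, hx⟩ := hcon
    set Z : Set ℝ := Icc 1 x ∩ {u | delayExp (-c) u ≤ 0} with hZ
    have hx1 : 1 ≤ x := by
      by_contra! h
      rw [delayExp_of_le_one _ h.le] at hx
      exact absurd hx (by norm_num)
    have hZc : IsCompact Z :=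
      isCompact_Icc.inter_right (isClosed_le (continuous_delayExp _) continuous_const)
    obtain ⟨w, ⟨hwI, hw0⟩, hwmin⟩ := hZc.exists_isLeast ⟨x, ⟨hx1, le_rfl⟩, hx⟩
    have hwH : w < H + 1 := hwI.2.trans_lt hxH
    refine hne w hwI.1 hwH (fun u hu => ?_)
      (le_antisymm hw0 (hnn w ⟨by linarith [hwI.1], hwH.le⟩))
    by_contra! hneg
    have hu1 : 1 ≤ u := by
      by_contra! h
      rw [delayExp_of_le_one _ h.le] at hneg
      exact absurd hneg (by norm_num)
    exact absurd (hwmin ⟨⟨hu1, hu.le.trans hwI.2⟩, hneg⟩) (not_le.2 hu)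
  refine ⟨c, hc0, ?_, hpos⟩
  have : x₁ = H + 1 := le_antisymm hx₁.2 (by
    by_contra! h
    exact absurd hle (not_le.2 (hpos x₁ h)))
  rw [← this]
  exact le_antisymm hle (hnn x₁ hx₁)

theorem exists_principal_delayExp {H : ℝ} (hH : 0 < H) :
    ∃ lam : ℝ, 0 < lam ∧ delayExp (-(lam * Real.exp 1)⁻¹) (H + 1) = 0 ∧
      ∀ x, x < H + 1 → 0 < delayExp (-(lam * Real.exp 1)⁻¹) x := by
  obtain ⟨c, hc, hz, hpos⟩ := exists_delayExp_least_zero hH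
  have : ((c * Real.exp 1)⁻¹ * Real.exp 1)⁻¹ = c := by
    have := Real.exp_pos 1
    field_simp
  exact ⟨(c * Real.exp 1)⁻¹, by positivity, by rwa [this], by rwa [this]⟩

theorem isPrincipalEigenvalue_iff_isLeast {H lam : ℝ} (hH : 0 < H) (hlam : 0 < lam) :
    IsPrincipalEigenvalue oneMinusExpDensity H lam ↔
      IsLeast {x : ℝ | 0 < x ∧ gFun (lam : ℂ) x = 0} (H + 1) := by
  rw [isLeast_zero_iff hH.le]
  constructor
  · intro h
    obtain ⟨mu, hmu, hz, hpos⟩ := exists_principal_delayExp hH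
    rw [h.unique (isPrincipalEigenvalue_of_delayExp hH hmu hz hpos)]
    exact ⟨hz, hpos⟩
  · rintro ⟨hz, hpos⟩
    exact isPrincipalEigenvalue_of_delayExp hH hlam hz hpos

theorem existsUnique_isPrincipalEigenvalue {H : ℝ} (hH : 0 < H) :
    ∃! lam : ℝ, IsPrincipalEigenvalue oneMinusExpDensity H lam := by
  obtain ⟨mu, hmu, hz, hpos⟩ := exists_principal_delayExp hH
  exact ⟨mu, isPrincipalEigenvalue_of_delayExp hH hmu hz hpos,
    fun nu hnu => hnu.unique (isPrincipalEigenvalue_of_delayExp hH hmu hz hpos)⟩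

theorem IsPrincipalEigenvalue.mono {H₁ H₂ lam₁ lam₂ : ℝ} (hH₁ : 0 < H₁) (h12 : H₁ ≤ H₂)
    (h₁ : IsPrincipalEigenvalue oneMinusExpDensity H₁ lam₁)
    (h₂ : IsPrincipalEigenvalue oneMinusExpDensity H₂ lam₂) : lam₁ ≤ lam₂ := by
  have hH₂ := hH₁.trans_le h12
  obtain ⟨hz, hpos⟩ := (isLeast_zero_iff hH₂.le).1
    ((isPrincipalEigenvalue_iff_isLeast hH₂ h₂.1).1 h₂)
  simpa [abs_of_pos h₁.1] using norm_le_of_isKilledEigenvalue hH₁ h12 h₂.1 hz hpos h₁.2.1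

/-- At a maximum point of the positive eigenfunction, the eigenvalue is at most the mass that the
kernel keeps inside `[0, H]`. This is less than `1`, because the tail beyond `H` is lost. -/
theorem IsPrincipalEigenvalue.lt_one {H lam : ℝ} (hH : 0 < H)
    (h : IsPrincipalEigenvalue oneMinusExpDensity H lam) : lam < 1 := by
  obtain ⟨hz, hpos⟩ := (isLeast_zero_iff hH.le).1
    ((isPrincipalEigenvalue_iff_isLeast hH h.1).1 h)
  set G : ℝ → ℝ := fun u => Real.exp u * delayExp (-(lam * Real.exp 1)⁻¹) u with hG
  have hGc : Continuous G := continuous_exp_mul_delayExp (𝕜 := ℝ) _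
  have hGpos : ∀ x, x < H + 1 → 0 < G x := fun x hx => mul_pos (Real.exp_pos x) (hpos x hx)
  obtain ⟨x₀, hx₀, hmax⟩ := isCompact_Icc.exists_isMaxOn (nonempty_Icc.2 hH.le) hGc.continuousOn
  have hG0 := hGpos x₀ (by linarith [hx₀.2])
  have h1 : ∫ u in (0 : ℝ)..H, oneMinusExpDensity (x₀ - u) < 1 := by
    have := integral_mul_density (𝕜 := ℝ) (H := H) (g := fun _ => 1)
      intervalIntegrable_const hx₀
    simp only [one_mul, RCLike.ofReal_real_eq_id, id] at this
    rw [this, intervalIntegral.integral_comp_neg, integral_exp, mul_sub, ← Real.exp_add]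
    have h2 : Real.exp (x₀ - 1 + -max (x₀ - 1) 0) ≤ 1 :=
      Real.exp_le_one_iff.2 (by linarith [le_max_left (x₀ - 1) 0])
    have h3 : 0 < Real.exp (x₀ - 1) * Real.exp (-H) := by positivity
    linarith
  have key : lam * G x₀ ≤ G x₀ * ∫ u in (0 : ℝ)..H, oneMinusExpDensity (x₀ - u) := by
    rw [← intervalIntegral.integral_const_mul]
    refine (exp_mul_delayExp_eigen (𝕜 := ℝ) h.1.ne' hz hx₀).trans_le ?_
    refine intervalIntegral.integral_mono_on hH.le
      (intervalIntegrable_mul_density (𝕜 := ℝ) (hGc.intervalIntegrable _ _) x₀)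
      (intervalIntegrable_mul_density (𝕜 := ℝ) intervalIntegrable_const x₀)
      fun u hu => ?_
    exact mul_le_mul_of_nonneg_right (hmax hu) (oneMinusExpDensity_nonneg _)
  nlinarith

/-! ### The solutions of `w e^w = -a` -/

/-- The point of the upper half plane with imaginary part `η` at which `w e^w` is a negative real,
for `η` in an interval `(2 k π, (2 k + 1) π)`. -/
noncomputable def lambertPoint (η : ℝ) : ℂ := ⟨-(η * Real.cos η / Real.sin η), η⟩

/-- The logarithm of the modulus of `w e^w` at `lambertPoint η`. -/
noncomputable def lambertLog (η : ℝ) : ℝ :=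
  Real.log η - Real.log (Real.sin η) - η * Real.cos η / Real.sin η

theorem sin_pos_of_mem_branch {k : ℕ} {η : ℝ}
    (h : η ∈ Ioo (2 * k * Real.pi) ((2 * k + 1) * Real.pi)) : 0 < Real.sin η := by
  rw [← Real.sin_sub_nat_mul_two_pi η k]
  exact Real.sin_pos_of_pos_of_lt_pi (by linarith [h.1]) (by linarith [h.2])

theorem pos_of_mem_branch {k : ℕ} {η : ℝ}
    (h : η ∈ Ioo (2 * k * Real.pi) ((2 * k + 1) * Real.pi)) : 0 < η :=
  lt_of_le_of_lt (by positivity) h.1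

/-- The derivative is written as a sum of squares over `η`, namely `|s|²/η` for the point `s = 1 +
lambertPoint η`; its sign and its expansion near `0` are both read off this form. -/
theorem hasDerivAt_lambertLog {η : ℝ} (h0 : 0 < η) (hs : 0 < Real.sin η) :
    HasDerivAt lambertLog (((1 - η * Real.cos η / Real.sin η) ^ 2 + η ^ 2) / η) η := by
  have h1 := (Real.hasDerivAt_log h0.ne').sub ((Real.hasDerivAt_sin η).log hs.ne')
  have h2 := h1.sub (((hasDerivAt_id η).mul (Real.hasDerivAt_cos η)).div
    (Real.hasDerivAt_sin η) hs.ne')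
  refine h2.congr_deriv ?_
  simp only [Pi.mul_apply, id]
  field_simp
  ring

theorem strictMonoOn_lambertLog (k : ℕ) :
    StrictMonoOn lambertLog (Ioo (2 * k * Real.pi) ((2 * k + 1) * Real.pi)) := by
  have hd : ∀ η ∈ Ioo (2 * k * Real.pi) ((2 * k + 1) * Real.pi), HasDerivAt lambertLog
      (((1 - η * Real.cos η / Real.sin η) ^ 2 + η ^ 2) / η) η := fun η hη =>
    hasDerivAt_lambertLog (pos_of_mem_branch hη) (sin_pos_of_mem_branch hη)
  refine strictMonoOn_of_deriv_pos (convex_Ioo _ _)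
    (fun η hη => (hd η hη).continuousAt.continuousWithinAt) fun η hη => ?_
  rw [interior_Ioo] at hη
  rw [(hd η hη).deriv]
  have := pos_of_mem_branch hη
  positivity

theorem neg_one_lt_lambertLog {η : ℝ} (h0 : 0 < η) (h1 : η < Real.pi) : -1 < lambertLog η := by
  have hs := Real.sin_pos_of_pos_of_lt_pi h0 h1
  have hsl := Real.sin_lt h0
  have hlog : Real.log (Real.sin η) < Real.log η := Real.log_lt_log hs hsl
  have : η * Real.cos η / Real.sin η ≤ 1 := by
    rw [div_le_one hs]
    rcases lt_or_ge η (Real.pi / 2) with h | h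
    · have ht := Real.lt_tan h0 h
      have hc : 0 < Real.cos η := Real.cos_pos_of_mem_Ioo ⟨by linarith, h⟩
      rw [Real.tan_eq_sin_div_cos, lt_div_iff₀ hc] at ht
      exact ht.le
    · have hc : Real.cos η ≤ 0 := Real.cos_nonpos_of_pi_div_two_le_of_le h (by linarith)
      nlinarith
  rw [lambertLog]
  linarith

theorem lambertLog_le {η : ℝ} (h0 : 0 < η) (h1 : η ≤ 1) : lambertLog η ≤ -1 + η ^ 2 := by
  have hs : 0 < Real.sin η := Real.sin_pos_of_pos_of_le_one h0 h1
  have hsl := Real.sin_lt h0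
  have hs3 := Real.sin_gt_sub_cube h0
  have hc := Real.one_sub_sq_div_two_le_cos (x := η)
  have hlog : Real.log η - Real.log (Real.sin η) ≤ η ^ 2 / 2 := by
    rw [← Real.log_div h0.ne' hs.ne']
    refine (Real.log_le_sub_one_of_pos (by positivity)).trans ?_
    rw [sub_le_iff_le_add, div_le_iff₀ hs]
    have h3 : (η ^ 2 / 2 + 1) * (η - η ^ 3 / 6) ≤ (η ^ 2 / 2 + 1) * Real.sin η :=
      mul_le_mul_of_nonneg_left hs3.le (by positivity)
    refine le_trans ?_ h3
    have : 0 ≤ η ^ 3 * (1 - η ^ 2) := mul_nonneg (by positivity) (by nlinarith)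
    nlinarith
  have : 1 - η ^ 2 / 2 ≤ η * Real.cos η / Real.sin η := by
    refine hc.trans ?_
    rw [le_div_iff₀ hs]
    have : 0 ≤ Real.cos η := by nlinarith
    nlinarith
  rw [lambertLog]
  linarith

/-- The function tends to `+∞` at the right end of each interval. At the left end it tends to `-∞`
if `k ≥ 1`, where `cot` has a pole, but to `-1` if `k = 0`, where the factor `η` cancels the pole.
-/
theorem exists_lambertLog_eq {k : ℕ} {b : ℝ} (hb : 1 ≤ k ∨ -1 < b) :
    ∃ η ∈ Ioo (2 * k * Real.pi) ((2 * k + 1) * Real.pi), lambertLog η = b := by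
  have hpi := Real.pi_gt_three
  have hcont : ContinuousOn lambertLog (Ioo (2 * k * Real.pi) ((2 * k + 1) * Real.pi)) :=
    fun η hη => (hasDerivAt_lambertLog (pos_of_mem_branch hη)
      (sin_pos_of_mem_branch hη)).continuousAt.continuousWithinAt
  obtain ⟨η₁, hη₁, h₁⟩ : ∃ η ∈ Ioo (2 * k * Real.pi) ((2 * k + 1) * Real.pi),
      lambertLog η ≤ b := by
    rcases Nat.eq_zero_or_pos k with rfl | hk
    · have hb' : -1 < b := hb.resolve_left (by norm_num)
      set η := min 1 (b + 1) with hη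
      have h0 : 0 < η := lt_min one_pos (by linarith)
      have h1 : η ≤ 1 := min_le_left _ _
      refine ⟨η, ⟨by simpa using h0, ?_⟩, (lambertLog_le h0 h1).trans ?_⟩
      · simp; linarith
      · nlinarith [min_le_right 1 (b + 1)]
    · have hk1 : (1 : ℝ) ≤ k := by exact_mod_cast hk
      -- With `y = 1 / sin β ≥ M`, the two logarithms contribute at most `(2k+1)π + y` and the
      -- cotangent term at most `-3y`; the sum is at most `(2k+1)π - 2M ≤ b`.
      set M := |b| + (2 * k + 1) * Real.pi with hM
      have hM9 : 9 ≤ M := by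
        have := abs_nonneg b
        nlinarith
      set β := M⁻¹ with hβ
      have hβ0 : 0 < β := by positivity
      have hβ1 : β ≤ 1 := by rw [hβ]; exact inv_le_one_of_one_le₀ (by linarith)
      set η := 2 * k * Real.pi + β with hη
      have hmem : η ∈ Ioo (2 * k * Real.pi) ((2 * k + 1) * Real.pi) :=
        ⟨by linarith, by linarith⟩
      refine ⟨η, hmem, ?_⟩
      have hsin : Real.sin η = Real.sin β := by
        rw [← Real.sin_sub_nat_mul_two_pi η k]; congr 1; rw [hη]; ring
      have hcos : Real.cos η = Real.cos β := by
        rw [← Real.cos_sub_nat_mul_two_pi η k]; congr 1; rw [hη]; ring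
      have hs : 0 < Real.sin β := Real.sin_pos_of_pos_of_le_one hβ0 hβ1
      have hc : 1 / 2 ≤ Real.cos β := by
        have := Real.one_sub_sq_div_two_le_cos (x := β)
        nlinarith
      have hy : M ≤ (Real.sin β)⁻¹ := by
        rw [le_inv_comm₀ (by linarith) hs]
        exact (Real.sin_lt hβ0).le
      have hlog1 : Real.log η ≤ η := Real.log_le_self (pos_of_mem_branch hmem).le
      have hlog2 : -Real.log (Real.sin β) ≤ (Real.sin β)⁻¹ := by
        rw [← Real.log_inv]; exact Real.log_le_self (by positivity)
      have hη6 : 6 ≤ η := by nlinarith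
      have h3 : 3 * (Real.sin β)⁻¹ ≤ η * Real.cos β / Real.sin β := by
        rw [div_eq_mul_inv]
        exact mul_le_mul_of_nonneg_right (by nlinarith) (by positivity)
      have h4 := neg_abs_le b
      have h5 := abs_nonneg b
      rw [lambertLog, hsin, hcos]
      have h6 := hmem.2
      linarith
  obtain ⟨η₂, hη₂, h₂⟩ : ∃ η ∈ Ioo (2 * k * Real.pi) ((2 * k + 1) * Real.pi),
      b ≤ lambertLog η := by
    set β := Real.exp (-|b|) with hβ
    have hβ0 : 0 < β := Real.exp_pos _
    have hβ1 : β ≤ 1 := Real.exp_le_one_iff.2 (by linarith [abs_nonneg b])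
    set η := (2 * k + 1) * Real.pi - β with hη
    have hmem : η ∈ Ioo (2 * k * Real.pi) ((2 * k + 1) * Real.pi) := ⟨by linarith, by linarith⟩
    have harg : η - k * (2 * Real.pi) = Real.pi - β := by rw [hη]; ring
    have hsin : Real.sin η = Real.sin β := by
      rw [← Real.sin_sub_nat_mul_two_pi η k, harg, Real.sin_pi_sub]
    have hcos : Real.cos η = -Real.cos β := by
      rw [← Real.cos_sub_nat_mul_two_pi η k, harg, Real.cos_pi_sub]
    have hs : 0 < Real.sin β := Real.sin_pos_of_pos_of_le_one hβ0 hβ1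
    have hc : 0 ≤ Real.cos β := by
      have := Real.one_sub_sq_div_two_le_cos (x := β)
      nlinarith
    refine ⟨η, hmem, ?_⟩
    have hη1 : 1 ≤ η := by
      have : (0 : ℝ) ≤ k := by positivity
      nlinarith
    have hlog1 : 0 ≤ Real.log η := Real.log_nonneg hη1
    have hlog2 : Real.log (Real.sin β) ≤ -|b| := by
      rw [Real.log_le_iff_le_exp hs]
      exact (Real.sin_lt hβ0).le
    have h3 : 0 ≤ η * Real.cos β / Real.sin β := by positivity
    rw [lambertLog, hsin, hcos, mul_neg, neg_div]
    linarith [le_abs_self b]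
  obtain ⟨η, hη, h⟩ := isPreconnected_Ioo.intermediate_value hη₁ hη₂ hcont ⟨h₁, h₂⟩
  exact ⟨η, hη, h⟩

theorem lambertPoint_eq {k : ℕ} {η : ℝ}
    (h : η ∈ Ioo (2 * k * Real.pi) ((2 * k + 1) * Real.pi)) :
    lambertPoint η = ((η / Real.sin η : ℝ) : ℂ) *
      (Complex.cos (((2 * k + 1) * Real.pi - η : ℝ) : ℂ) +
        Complex.sin (((2 * k + 1) * Real.pi - η : ℝ) : ℂ) * Complex.I) := by
  have hs := sin_pos_of_mem_branch h
  have h1 : (2 * k + 1) * Real.pi - η = Real.pi - (η - k * (2 * Real.pi)) := by ring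
  have hcos : Real.cos ((2 * k + 1) * Real.pi - η) = -Real.cos η := by
    rw [h1, Real.cos_pi_sub, Real.cos_sub_nat_mul_two_pi]
  have hsin : Real.sin ((2 * k + 1) * Real.pi - η) = Real.sin η := by
    rw [h1, Real.sin_pi_sub, Real.sin_sub_nat_mul_two_pi]
  rw [← Complex.ofReal_cos, ← Complex.ofReal_sin, hcos, hsin]
  apply Complex.ext
  · rw [Complex.re_ofReal_mul, Complex.add_re, Complex.mul_I_re]
    simp only [lambertPoint, Complex.ofReal_re, Complex.ofReal_im]
    ring
  · rw [Complex.im_ofReal_mul, Complex.add_im, Complex.mul_I_im]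
    simp only [lambertPoint, Complex.ofReal_re, Complex.ofReal_im, zero_add]
    field_simp

theorem arg_lambertPoint {k : ℕ} {η : ℝ}
    (h : η ∈ Ioo (2 * k * Real.pi) ((2 * k + 1) * Real.pi)) :
    (lambertPoint η).arg = (2 * k + 1) * Real.pi - η := by
  have hs := sin_pos_of_mem_branch h
  have h0 := pos_of_mem_branch h
  rw [lambertPoint_eq h]
  exact Complex.arg_mul_cos_add_sin_mul_I (by positivity) ⟨by linarith [h.2, Real.pi_pos],
    by linarith [h.1]⟩

theorem norm_lambertPoint {k : ℕ} {η : ℝ}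
    (h : η ∈ Ioo (2 * k * Real.pi) ((2 * k + 1) * Real.pi)) :
    ‖lambertPoint η‖ = η / Real.sin η := by
  have hs := sin_pos_of_mem_branch h
  have h0 := pos_of_mem_branch h
  rw [lambertPoint_eq h, norm_mul, Complex.norm_cos_add_sin_mul_I, mul_one, Complex.norm_real,
    Real.norm_of_nonneg (by positivity)]

theorem norm_mul_exp_lambertPoint {k : ℕ} {η : ℝ}
    (h : η ∈ Ioo (2 * k * Real.pi) ((2 * k + 1) * Real.pi)) :
    ‖lambertPoint η‖ * Real.exp (lambertPoint η).re = Real.exp (lambertLog η) := by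
  have hs := sin_pos_of_mem_branch h
  have h0 := pos_of_mem_branch h
  rw [norm_lambertPoint h, lambertLog, ← Real.log_div h0.ne' hs.ne', sub_eq_add_neg, Real.exp_add,
    Real.exp_log (by positivity)]
  rfl

/-- Polar form: `w e^w` has modulus `|w| e^{re w}` and argument `im w + arg w` modulo `2π`. -/
theorem mul_exp_eq_neg_iff {a : ℝ} (ha : 0 < a) {w : ℂ} :
    w * Complex.exp w = ((-a : ℝ) : ℂ) ↔
      ‖w‖ * Real.exp w.re = a ∧ ∃ k : ℤ, w.im + w.arg = (2 * k + 1) * Real.pi := by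
  have hpol : w * Complex.exp w = ((‖w‖ * Real.exp w.re : ℝ) : ℂ) *
      Complex.exp (((w.im + w.arg : ℝ) : ℂ) * Complex.I) := by
    have h1 : Complex.exp w = Complex.exp w.re * Complex.exp (w.im * Complex.I) := by
      rw [← Complex.exp_add, Complex.re_add_im]
    have h2 := Complex.norm_mul_exp_arg_mul_I w
    rw [h1]
    nth_rw 1 [← h2]
    push_cast
    rw [add_mul, Complex.exp_add]
    ring
  constructor
  · intro h
    have hn : ‖w‖ * Real.exp w.re = a := by
      have := congrArg norm h
      rwa [norm_mul, Complex.norm_exp, Complex.norm_real, norm_neg, Real.norm_of_nonneg ha.le]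
        at this
    refine ⟨hn, ?_⟩
    rw [hpol, hn] at h
    have hexp : Complex.exp (((w.im + w.arg : ℝ) : ℂ) * Complex.I) = -1 := by
      have ha' : (a : ℂ) ≠ 0 := by exact_mod_cast ha.ne'
      refine mul_left_cancel₀ ha' ?_
      rw [h]; push_cast; ring
    have hc : Real.cos (w.im + w.arg) = -1 := by
      have := congrArg Complex.re hexp
      rwa [Complex.exp_ofReal_mul_I_re] at this
    obtain ⟨k, hk⟩ := Real.cos_eq_neg_one_iff.1 hc
    exact ⟨k, by rw [← hk]; ring⟩
  · rintro ⟨hn, k, hk⟩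
    rw [hpol, hn, hk]
    have : (((2 * (k : ℝ) + 1) * Real.pi : ℝ) : ℂ) * Complex.I =
        Real.pi * Complex.I + k * (2 * Real.pi * Complex.I) := by push_cast; ring
    rw [this, Complex.exp_periodic.int_mul k, Complex.exp_pi_mul_I]
    push_cast; ring

theorem lambertPoint_mul_exp {k : ℕ} {η a : ℝ} (ha : 0 < a)
    (h : η ∈ Ioo (2 * k * Real.pi) ((2 * k + 1) * Real.pi)) (hη : lambertLog η = Real.log a) :
    lambertPoint η * Complex.exp (lambertPoint η) = ((-a : ℝ) : ℂ) := by
  rw [mul_exp_eq_neg_iff ha, norm_mul_exp_lambertPoint h, hη, Real.exp_log ha,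
    arg_lambertPoint h]
  exact ⟨rfl, k, by simp [lambertPoint]⟩

/-- In the upper half plane `arg w` lies in `(0, π)`, so `arg w = (2k+1)π - im w` confines `im w` to
one interval. Imaginary part and argument together determine the point. -/
theorem eq_lambertPoint {a : ℝ} (ha : 0 < a) {w : ℂ} (hw : 0 < w.im)
    (h : w * Complex.exp w = ((-a : ℝ) : ℂ)) :
    ∃ k : ℕ, w.im ∈ Ioo (2 * k * Real.pi) ((2 * k + 1) * Real.pi) ∧
      w = lambertPoint w.im ∧ lambertLog w.im = Real.log a := by
  obtain ⟨hn, k, hk⟩ := (mul_exp_eq_neg_iff ha).1 h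
  have harg0 : 0 < w.arg := lt_of_le_of_ne (Complex.arg_nonneg_iff.2 hw.le) fun h0 =>
    hw.ne' (Complex.arg_eq_zero_iff.1 h0.symm).2
  have hargpi : w.arg < Real.pi := Complex.arg_lt_pi_iff.2 (Or.inr hw.ne')
  have hpi := Real.pi_pos
  have hk0 : 0 ≤ k := by
    by_contra! hneg
    have : (k : ℝ) ≤ -1 := by exact_mod_cast (by omega : k ≤ -1)
    nlinarith
  lift k to ℕ using hk0
  push_cast at hk
  have hmem : w.im ∈ Ioo (2 * k * Real.pi) ((2 * k + 1) * Real.pi) :=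
    ⟨by linarith, by linarith⟩
  have hs := sin_pos_of_mem_branch hmem
  have hpt : w = lambertPoint w.im := by
    have h1 : w.arg = (2 * k + 1) * Real.pi - w.im := by linarith
    have h2 : w = ((‖w‖ : ℝ) : ℂ) * (Complex.cos (((2 * k + 1) * Real.pi - w.im : ℝ) : ℂ) +
        Complex.sin (((2 * k + 1) * Real.pi - w.im : ℝ) : ℂ) * Complex.I) := by
      rw [← h1]; exact (Complex.norm_mul_cos_add_sin_mul_I w).symm
    have h3 := lambertPoint_eq hmem
    have hsin : Real.sin ((2 * k + 1) * Real.pi - w.im) = Real.sin w.im := by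
      rw [show (2 * k + 1) * Real.pi - w.im = Real.pi - (w.im - k * (2 * Real.pi)) by ring,
        Real.sin_pi_sub, Real.sin_sub_nat_mul_two_pi]
    have h4 : w.im = ‖w‖ * Real.sin w.im := by
      have := congrArg Complex.im h2
      rwa [← Complex.ofReal_cos, ← Complex.ofReal_sin, hsin, Complex.im_ofReal_mul, Complex.add_im,
        Complex.mul_I_im, Complex.ofReal_im, Complex.ofReal_re, zero_add] at this
    rw [h3]
    conv_lhs => rw [h2]
    congr 2
    field_simp
    exact h4.symm
  refine ⟨k, hmem, hpt, ?_⟩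
  rw [hpt, norm_mul_exp_lambertPoint hmem] at hn
  rw [← hn, Real.log_exp]

/-- With `x = -w` the equation gives `x = a e^x ≥ e^{x-1} ≥ x`, and the last inequality is strict
unless `x = 1`. -/
theorem real_mul_exp_eq_neg {a : ℝ} (ha : Real.exp (-1) ≤ a) {w : ℂ} (hw : w.im = 0)
    (h : w * Complex.exp w = ((-a : ℝ) : ℂ)) : w = -1 ∧ a = Real.exp (-1) := by
  have hwre : w = (w.re : ℂ) := Complex.ext rfl (by simp [hw])
  rw [hwre] at h
  have h' : w.re * Real.exp w.re = -a := by
    have := congrArg Complex.re h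
    rwa [← Complex.ofReal_exp, ← Complex.ofReal_mul, Complex.ofReal_re, Complex.ofReal_re] at this
  have h1 : -w.re = a * Real.exp (-w.re) := by
    rw [show a = -(w.re * Real.exp w.re) by linarith, neg_mul, mul_assoc, ← Real.exp_add]
    simp
  have hre : w.re = -1 := by
    by_contra hne
    have h2 := Real.add_one_lt_exp (x := -w.re - 1) (fun h0 => hne (by linarith))
    have h3 : Real.exp (-w.re - 1) ≤ a * Real.exp (-w.re) := by
      rw [show -w.re - 1 = -1 + -w.re by ring, Real.exp_add]
      exact mul_le_mul_of_nonneg_right ha (Real.exp_pos _).le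
    linarith
  refine ⟨by rw [hwre, hre]; simp, ?_⟩
  rw [hre] at h'
  linarith

theorem conj_mul_exp_eq_neg {a : ℝ} {w : ℂ} (h : w * Complex.exp w = ((-a : ℝ) : ℂ)) :
    (starRingEnd ℂ) w * Complex.exp ((starRingEnd ℂ) w) = ((-a : ℝ) : ℂ) := by
  rw [Complex.exp_conj, ← map_mul, h, Complex.conj_ofReal]

/-- Solutions with positive imaginary part in the same interval coincide. -/
theorem eq_of_mul_exp_eq {a : ℝ} (ha : 0 < a) {k : ℕ} {v w : ℂ}
    (hv : v * Complex.exp v = ((-a : ℝ) : ℂ)) (hw : w * Complex.exp w = ((-a : ℝ) : ℂ))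
    (hvk : v.im ∈ Ioo (2 * k * Real.pi) ((2 * k + 1) * Real.pi))
    (hwk : w.im ∈ Ioo (2 * k * Real.pi) ((2 * k + 1) * Real.pi)) : v = w := by
  obtain ⟨_, _, hv1, hv2⟩ := eq_lambertPoint ha (pos_of_mem_branch hvk) hv
  obtain ⟨_, _, hw1, hw2⟩ := eq_lambertPoint ha (pos_of_mem_branch hwk) hw
  rw [hv1, hw1, (strictMonoOn_lambertLog k).injOn hvk hwk (hv2.trans hw2.symm)]

/-! ### The branches of the Lambert function -/

theorem branch_index_unique {k j : ℤ} (h : (2 * (k : ℝ) + 1) * Real.pi = (2 * j + 1) * Real.pi) :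
    k = j := by
  have := mul_right_cancel₀ Real.pi_ne_zero h
  have h2 : (k : ℝ) = j := by linarith
  exact_mod_cast h2

/-- For a solution `im w + arg w` is an odd multiple of `π`, and the half-open interval defining a
branch contains only one of these, its closed upper end. -/
theorem mem_lambertBranch_iff {a : ℝ} (ha : 0 < a) {w : ℂ} (hw : w.im ≠ 0)
    (h : w * Complex.exp w = ((-a : ℝ) : ℂ)) (k : ℤ) :
    w ∈ lambertBranch k ↔ w.im + w.arg = (2 * k + 1) * Real.pi := by
  obtain ⟨-, j, hj⟩ := (mul_exp_eq_neg_iff ha).1 h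
  have hpi := Real.pi_pos
  simp only [lambertBranch, mem_ofPred_eq, hw, false_and, and_false, not_false_eq_true, true_and,
    false_or]
  constructor
  · rintro ⟨h1, h2⟩
    rw [hj] at h1 h2
    have h1' := lt_of_mul_lt_mul_right h1 hpi.le
    have h2' := le_of_mul_le_mul_right h2 hpi
    have h3 : (k : ℝ) < j + 1 := by linarith
    have h4 : (j : ℝ) ≤ k := by linarith
    have h5 : k < j + 1 := by exact_mod_cast h3
    have h6 : j ≤ k := by exact_mod_cast h4
    rw [hj, show j = k by omega]
  · intro h1
    rw [h1]
    exact ⟨mul_lt_mul_of_pos_right (by linarith) hpi, le_rfl⟩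

theorem im_pos_iff_branch_nonneg {w : ℂ} (hw : w.im ≠ 0) {k : ℤ}
    (h : w.im + w.arg = (2 * k + 1) * Real.pi) : 0 < w.im ↔ 0 ≤ k := by
  have hpi := Real.pi_pos
  constructor
  · intro h0
    have := Complex.arg_nonneg_iff.2 h0.le
    by_contra! hk
    have : (k : ℝ) ≤ -1 := by exact_mod_cast (by omega : k ≤ -1)
    nlinarith
  · intro hk
    have hk' : (0 : ℝ) ≤ k := by exact_mod_cast hk
    by_contra! h0
    have := Complex.arg_neg_iff.2 (lt_of_le_of_ne h0 hw)
    nlinarith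

/-- Conjugation exchanges the branches `k` and `-1 - k`, which reduces statements about all branches
to `k ≥ 0`. -/
theorem im_add_arg_conj {w : ℂ} (hw : w.im ≠ 0) {k : ℤ}
    (h : w.im + w.arg = (2 * k + 1) * Real.pi) :
    ((starRingEnd ℂ) w).im + ((starRingEnd ℂ) w).arg
      = (2 * ((-1 - k : ℤ) : ℝ) + 1) * Real.pi := by
  rw [Complex.arg_conj, if_neg fun h0 => hw (Complex.arg_eq_pi_iff.1 h0).2, Complex.conj_im]
  push_cast
  linarith

theorem im_mem_of_im_add_arg {a : ℝ} (ha : 0 < a) {w : ℂ} (hw : 0 < w.im)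
    (h : w * Complex.exp w = ((-a : ℝ) : ℂ)) {k : ℕ} (hk : w.im + w.arg = (2 * k + 1) * Real.pi) :
    w.im ∈ Ioo (2 * k * Real.pi) ((2 * k + 1) * Real.pi) := by
  obtain ⟨j, hj, hp, -⟩ := eq_lambertPoint ha hw h
  have harg := arg_lambertPoint hj
  rw [← hp] at harg
  have : (j : ℤ) = k := branch_index_unique (by push_cast; linarith)
  have : j = k := by exact_mod_cast this
  rwa [this] at hj

theorem eq_of_im_add_arg {a : ℝ} (ha : 0 < a) {v w : ℂ} (hv0 : v.im ≠ 0) (hw0 : w.im ≠ 0)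
    (hv : v * Complex.exp v = ((-a : ℝ) : ℂ)) (hw : w * Complex.exp w = ((-a : ℝ) : ℂ)) {k : ℤ}
    (hvk : v.im + v.arg = (2 * k + 1) * Real.pi) (hwk : w.im + w.arg = (2 * k + 1) * Real.pi) :
    v = w := by
  wlog hk : 0 ≤ k generalizing v w k
  · have := this (v := (starRingEnd ℂ) v) (w := (starRingEnd ℂ) w) (by simpa using hv0)
      (by simpa using hw0) (conj_mul_exp_eq_neg hv) (conj_mul_exp_eq_neg hw)
      (im_add_arg_conj hv0 hvk) (im_add_arg_conj hw0 hwk) (by omega)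
    exact star_injective this
  · have h1 := (im_pos_iff_branch_nonneg hv0 hvk).2 hk
    have h2 := (im_pos_iff_branch_nonneg hw0 hwk).2 hk
    lift k to ℕ using hk
    push_cast at hvk hwk
    exact eq_of_mul_exp_eq ha hv hw (im_mem_of_im_add_arg ha h1 hv hvk)
      (im_mem_of_im_add_arg ha h2 hw hwk)

/-- On `(0, π)` the values of `lambertLog` exceed `-1`. So at `a = 1/e` the branches `0` and `-1`
have no non-real solution, and both contain only the double point `-1`. -/
theorem exp_neg_one_lt_of_branch {a : ℝ} (ha : 0 < a) {w : ℂ} (hw0 : w.im ≠ 0)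
    (hw : w * Complex.exp w = ((-a : ℝ) : ℂ)) {k : ℤ}
    (hk : w.im + w.arg = (2 * k + 1) * Real.pi) (hk0 : k = 0 ∨ k = -1) : Real.exp (-1) < a := by
  wlog h0 : k = 0 generalizing w k
  · exact this (w := (starRingEnd ℂ) w) (by simpa using hw0) (conj_mul_exp_eq_neg hw)
      (im_add_arg_conj hw0 hk) (by omega) (by omega)
  · subst h0
    have hpos := (im_pos_iff_branch_nonneg hw0 hk).2 le_rfl
    have hmem := im_mem_of_im_add_arg ha hpos hw (k := 0) (by simpa using hk)
    obtain ⟨_, _, _, hlog⟩ := eq_lambertPoint ha hpos hw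
    have := neg_one_lt_lambertLog hpos (by simpa using hmem.2)
    rw [hlog] at this
    exact (Real.lt_log_iff_exp_lt ha).1 this

theorem exists_im_add_arg {a : ℝ} (ha : 0 < a) {k : ℤ}
    (hk : (k ≠ 0 ∧ k ≠ -1) ∨ Real.exp (-1) < a) :
    ∃ w : ℂ, w.im ≠ 0 ∧ w * Complex.exp w = ((-a : ℝ) : ℂ) ∧
      w.im + w.arg = (2 * k + 1) * Real.pi := by
  wlog h0 : 0 ≤ k generalizing k
  · obtain ⟨w, h1, h2, h3⟩ := this (k := -1 - k) (hk.imp (by omega) id) (by omega)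
    refine ⟨(starRingEnd ℂ) w, by simpa using h1, conj_mul_exp_eq_neg h2, ?_⟩
    have := im_add_arg_conj h1 h3
    rwa [sub_sub_cancel] at this
  · lift k to ℕ using h0
    obtain ⟨η, hη, hlog⟩ := exists_lambertLog_eq (k := k) (b := Real.log a)
      (hk.imp (by omega) fun h => (Real.lt_log_iff_exp_lt ha).2 h)
    refine ⟨lambertPoint η, (pos_of_mem_branch hη).ne', lambertPoint_mul_exp ha hη hlog, ?_⟩
    rw [arg_lambertPoint hη]
    simp [lambertPoint]

theorem neg_one_mem_lambertBranch_iff (k : ℤ) :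
    (-1 : ℂ) ∈ lambertBranch k ↔ k = 0 ∨ k = -1 := by
  have hpi := Real.pi_pos
  simp only [lambertBranch, mem_ofPred_eq, Complex.arg_neg_one]
  constructor
  · rintro (⟨h, -, -⟩ | ⟨-, h1, h2⟩)
    · exact Or.inr h
    · left
      simp only [Complex.neg_im, Complex.one_im, neg_zero, zero_add] at h1 h2
      have h3 : (k : ℝ) < 1 := by nlinarith
      have h4 : (-1 : ℝ) < k := by nlinarith
      have h5 : k < 1 := by exact_mod_cast h3
      have h6 : -1 < k := by exact_mod_cast h4
      omega
  · rintro (rfl | rfl)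
    · right
      simp [hpi]
    · left; simp

theorem neg_one_mul_exp : (-1 : ℂ) * Complex.exp (-1) = ((-Real.exp (-1) : ℝ) : ℂ) := by
  push_cast; ring

theorem existsUnique_lambertBranch {a : ℝ} (ha : Real.exp (-1) ≤ a) (k : ℤ) :
    ∃! w : ℂ, w ∈ lambertBranch k ∧ w * Complex.exp w = ((-a : ℝ) : ℂ) := by
  have ha0 : 0 < a := (Real.exp_pos _).trans_le ha
  refine existsUnique_of_exists_of_unique ?_ ?_
  -- The only case in which the solution is real.
  · by_cases h : (k = 0 ∨ k = -1) ∧ a = Real.exp (-1)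
    · refine ⟨-1, (neg_one_mem_lambertBranch_iff k).2 h.1, ?_⟩
      rw [h.2, neg_one_mul_exp]
    · have h' : (k ≠ 0 ∧ k ≠ -1) ∨ Real.exp (-1) < a := by
        rw [not_and_or, not_or] at h
        exact h.imp id fun h => lt_of_le_of_ne ha fun h' => h h'.symm
      obtain ⟨w, h1, h2, h3⟩ := exists_im_add_arg ha0 h'
      exact ⟨w, (mem_lambertBranch_iff ha0 h1 h2 k).2 h3, h2⟩
  · have aux : ∀ v w : ℂ, v ∈ lambertBranch k → v * Complex.exp v = ((-a : ℝ) : ℂ) →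
        w ∈ lambertBranch k → w * Complex.exp w = ((-a : ℝ) : ℂ) → v.im = 0 → w.im = 0 := by
      intro v w hvk hv hwk hw hv0
      obtain ⟨rfl, hae⟩ := real_mul_exp_eq_neg ha hv0 hv
      by_contra hw0
      have := exp_neg_one_lt_of_branch ha0 hw0 hw
        ((mem_lambertBranch_iff ha0 hw0 hw k).1 hwk) ((neg_one_mem_lambertBranch_iff k).1 hvk)
      exact this.ne' hae
    rintro v w ⟨hvk, hv⟩ ⟨hwk, hw⟩
    by_cases hv0 : v.im = 0
    · rw [(real_mul_exp_eq_neg ha hv0 hv).1,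
        (real_mul_exp_eq_neg ha (aux v w hvk hv hwk hw hv0) hw).1]
    · have hw0 : w.im ≠ 0 := fun hw0 => hv0 (aux w v hwk hw hvk hv hw0)
      exact eq_of_im_add_arg ha0 hv0 hw0 hv hw ((mem_lambertBranch_iff ha0 hv0 hv k).1 hvk)
        ((mem_lambertBranch_iff ha0 hw0 hw k).1 hwk)

theorem lambertW_spec {a : ℝ} (ha : Real.exp (-1) ≤ a) (k : ℤ) :
    lambertW k ((-a : ℝ) : ℂ) ∈ lambertBranch k ∧
      lambertW k ((-a : ℝ) : ℂ) * Complex.exp (lambertW k ((-a : ℝ) : ℂ)) = ((-a : ℝ) : ℂ) :=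
  Classical.epsilon_spec (existsUnique_lambertBranch ha k).exists

theorem lambertW_eq {a : ℝ} (ha : Real.exp (-1) ≤ a) {k : ℤ} {w : ℂ} (hk : w ∈ lambertBranch k)
    (hw : w * Complex.exp w = ((-a : ℝ) : ℂ)) : lambertW k ((-a : ℝ) : ℂ) = w :=
  (existsUnique_lambertBranch ha k).unique (lambertW_spec ha k) ⟨hk, hw⟩

/-! ### The roots of `τ` -/

theorem exp_neg_one_le {lam : ℝ} (h0 : 0 < lam) (h1 : lam ≤ 1) :
    Real.exp (-1) ≤ (Real.exp 1 * lam)⁻¹ := by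
  rw [Real.exp_neg]
  exact inv_anti₀ (by positivity) (by nlinarith [Real.exp_pos 1])

theorem tauFun_eq_zero_iff {lam : ℝ} (h0 : 0 < lam) (s : ℂ) :
    tauFun lam s = 0 ↔
      (s - 1) * Complex.exp (s - 1) = ((-(Real.exp 1 * lam)⁻¹ : ℝ) : ℂ) := by
  have he : Complex.exp 1 ≠ 0 := Complex.exp_ne_zero 1
  have hl : (lam : ℂ) ≠ 0 := by exact_mod_cast h0.ne'
  have hs : tauFun lam s = Complex.exp 1 * ((s - 1) * Complex.exp (s - 1) -
      ((-(Real.exp 1 * lam)⁻¹ : ℝ) : ℂ)) := by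
    rw [tauFun, Complex.exp_sub]
    push_cast
    field_simp
    ring
  rw [hs, mul_eq_zero, or_iff_right he, sub_eq_zero]

theorem tauRoot_eq (lam : ℝ) (k : ℤ) :
    tauRoot lam k = 1 + lambertW k ((-(Real.exp 1 * lam)⁻¹ : ℝ) : ℂ) := by
  rw [tauRoot, neg_div, one_div]

theorem bijOn_tauRoot {lam : ℝ} (h0 : 0 < lam) (h1 : lam < 1) :
    BijOn (tauRoot lam) univ {s : ℂ | tauFun lam s = 0} := by
  have ha := exp_neg_one_le h0 h1.le
  set a := (Real.exp 1 * lam)⁻¹ with hadef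
  have ha0 : 0 < a := (Real.exp_pos _).trans_le ha
  have hne : a ≠ Real.exp (-1) := by
    rw [hadef, Real.exp_neg, Ne, inv_inj]
    nlinarith [Real.exp_pos 1]
  have him : ∀ w : ℂ, w * Complex.exp w = ((-a : ℝ) : ℂ) → w.im ≠ 0 := fun w hw hw0 =>
    hne (real_mul_exp_eq_neg ha hw0 hw).2
  refine ⟨fun k _ => ?_, fun k _ j _ hkj => ?_, fun s hs => ?_⟩
  · rw [mem_ofPred_eq, tauFun_eq_zero_iff h0, tauRoot_eq, add_sub_cancel_left]
    exact (lambertW_spec ha k).2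
  · rw [tauRoot_eq, tauRoot_eq, add_right_inj] at hkj
    obtain ⟨h2, h3⟩ := lambertW_spec ha k
    obtain ⟨h4, h5⟩ := lambertW_spec ha j
    rw [mem_lambertBranch_iff ha0 (him _ h3) h3] at h2
    rw [mem_lambertBranch_iff ha0 (him _ h5) h5] at h4
    refine branch_index_unique ?_
    rw [← h2, ← h4, hkj]
  · have hs' := (tauFun_eq_zero_iff h0 s).1 hs
    obtain ⟨-, k, hk⟩ := (mul_exp_eq_neg_iff ha0).1 hs'
    refine ⟨k, mem_univ _, ?_⟩
    rw [tauRoot_eq, lambertW_eq ha ((mem_lambertBranch_iff ha0 (him _ hs') hs' k).2 hk) hs']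
    ring

theorem lambertW_exp_neg_one {k : ℤ} (hk : k = 0 ∨ k = -1) :
    lambertW k ((-(Real.exp 1 * 1)⁻¹ : ℝ) : ℂ) = -1 := by
  refine lambertW_eq (exp_neg_one_le one_pos le_rfl)
    ((neg_one_mem_lambertBranch_iff k).2 hk) ?_
  rw [neg_one_mul_exp, Real.exp_neg, mul_one]

theorem tauRoot_one_eq_zero {k : ℤ} (hk : k = 0 ∨ k = -1) : tauRoot 1 k = 0 := by
  rw [tauRoot_eq, lambertW_exp_neg_one hk]; ring

theorem bijOn_tauRoot_one : BijOn (tauRoot 1) {k : ℤ | k ≠ -1} {s : ℂ | tauFun 1 s = 0} := by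
  have ha := exp_neg_one_le one_pos le_rfl
  set a := (Real.exp 1 * 1)⁻¹ with hadef
  have ha0 : 0 < a := (Real.exp_pos _).trans_le ha
  have hae : a = Real.exp (-1) := by rw [hadef, Real.exp_neg, mul_one]
  refine ⟨fun k _ => ?_, fun k hk j hj hkj => ?_, fun s hs => ?_⟩
  · rw [mem_ofPred_eq, tauFun_eq_zero_iff one_pos, tauRoot_eq, add_sub_cancel_left]
    exact (lambertW_spec ha k).2
  · rw [tauRoot_eq, tauRoot_eq, add_right_inj] at hkj
    obtain ⟨h2, h3⟩ := lambertW_spec ha k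
    obtain ⟨h4, h5⟩ := lambertW_spec ha j
    by_cases him : (lambertW k ((-a : ℝ) : ℂ)).im = 0
    · rw [(real_mul_exp_eq_neg ha him h3).1, neg_one_mem_lambertBranch_iff] at h2
      rw [← hkj, (real_mul_exp_eq_neg ha him h3).1, neg_one_mem_lambertBranch_iff] at h4
      rw [h2.resolve_right hk, h4.resolve_right hj]
    · have him' : (lambertW j ((-a : ℝ) : ℂ)).im ≠ 0 := hkj ▸ him
      rw [mem_lambertBranch_iff ha0 him h3] at h2
      rw [mem_lambertBranch_iff ha0 him' h5] at h4
      refine branch_index_unique ?_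
      rw [← h2, ← h4, hkj]
  · have hs' := (tauFun_eq_zero_iff one_pos s).1 hs
    by_cases him : (s - 1).im = 0
    · refine ⟨0, by simp, ?_⟩
      rw [tauRoot_one_eq_zero (Or.inl rfl)]
      linear_combination -(real_mul_exp_eq_neg ha him hs').1
    · obtain ⟨-, k, hk⟩ := (mul_exp_eq_neg_iff ha0).1 hs'
      refine ⟨k, fun hk1 => ?_, ?_⟩
      · exact (exp_neg_one_lt_of_branch ha0 him hs' hk (Or.inr hk1)).ne' hae
      · rw [tauRoot_eq, lambertW_eq ha ((mem_lambertBranch_iff ha0 him hs' k).2 hk) hs']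
        ring

/-! ### The non-zero roots of `τ` -/

/-- The non-zero roots of `τ`. -/
abbrev TauZero (lam : ℝ) : Type := {s : ℂ // tauFun lam s = 0 ∧ s ≠ 0}

/-- The index of the horizontal strip that contains `s`. -/
noncomputable def stripIndex (s : ℂ) : ℕ := ⌊|s.im| / (2 * Real.pi)⌋₊

theorem stripIndex_eq {s : ℂ} {k : ℕ}
    (h : |s.im| ∈ Ioo (2 * k * Real.pi) ((2 * k + 1) * Real.pi)) : stripIndex s = k := by
  have hpi := Real.pi_pos
  rw [stripIndex, Nat.floor_eq_iff (by positivity), le_div_iff₀ (by positivity),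
    div_lt_iff₀ (by positivity)]
  exact ⟨by linarith [h.1], by nlinarith [h.2]⟩

theorem stripIndex_conj (s : ℂ) : stripIndex ((starRingEnd ℂ) s) = stripIndex s := by
  simp [stripIndex]

theorem tauFun_conj {lam : ℝ} {s : ℂ} (h : tauFun lam s = 0) :
    tauFun lam ((starRingEnd ℂ) s) = 0 := by
  have := congrArg (starRingEnd ℂ) h
  rw [map_zero] at this
  rw [← this, tauFun, tauFun, Complex.exp_conj]
  simp

namespace TauZero

variable {lam : ℝ}

theorem mul_exp_eq (h0 : 0 < lam) (s : TauZero lam) :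
    ((s : ℂ) - 1) * Complex.exp ((s : ℂ) - 1) = ((-(Real.exp 1 * lam)⁻¹ : ℝ) : ℂ) :=
  (tauFun_eq_zero_iff h0 _).1 s.2.1

theorem im_ne_zero (h0 : 0 < lam) (h1 : lam ≤ 1) (s : TauZero lam) : (s : ℂ).im ≠ 0 := by
  intro h
  refine s.2.2 ?_
  have := (real_mul_exp_eq_neg (exp_neg_one_le h0 h1) (by simpa using h) (s.mul_exp_eq h0)).1
  linear_combination this

/-- The complex conjugate root. -/
noncomputable def conj (s : TauZero lam) : TauZero lam :=
  ⟨(starRingEnd ℂ) s, tauFun_conj s.2.1, by simpa using s.2.2⟩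

theorem exists_mem (h0 : 0 < lam) (h1 : lam ≤ 1) (s : TauZero lam) :
    ∃ k : ℕ, |(s : ℂ).im| ∈ Ioo (2 * k * Real.pi) ((2 * k + 1) * Real.pi) ∧
      1 ≤ ‖(s : ℂ) - 1‖ := by
  wlog him : 0 < (s : ℂ).im generalizing s
  · obtain ⟨k, hk, hn⟩ := this s.conj (by
      simpa [conj] using lt_of_le_of_ne (not_lt.1 him) (s.im_ne_zero h0 h1))
    refine ⟨k, by simpa [conj] using hk, ?_⟩
    rw [← Complex.norm_conj]
    simpa [conj] using hn
  · obtain ⟨k, hk, hp, -⟩ := eq_lambertPoint (a := (Real.exp 1 * lam)⁻¹) (by positivity)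
      (w := (s : ℂ) - 1) (by simpa using him) (s.mul_exp_eq h0)
    have hs := sin_pos_of_mem_branch hk
    refine ⟨k, ?_, ?_⟩
    · rw [abs_of_pos him]; simpa using hk
    · rw [hp, norm_lambertPoint hk, one_le_div hs]
      exact (Real.sin_lt (pos_of_mem_branch hk)).le

theorem mem_strip (h0 : 0 < lam) (h1 : lam ≤ 1) (s : TauZero lam) :
    |(s : ℂ).im| ∈ Ioo (2 * stripIndex s * Real.pi) ((2 * stripIndex s + 1) * Real.pi) := by
  obtain ⟨k, hk, -⟩ := s.exists_mem h0 h1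
  rwa [stripIndex_eq hk]

theorem index_lt (h0 : 0 < lam) (h1 : lam ≤ 1) (s : TauZero lam) :
    2 * Real.pi * stripIndex s < |(s : ℂ).im| := by
  linarith [(s.mem_strip h0 h1).1]

/-- For index `k ≥ 1` the imaginary part gives `2πk ≥ k + 1`; for index `0` it is `|s - 1| = η / sin
η ≥ 1`. -/
theorem index_add_one_le_norm_sub_one (h0 : 0 < lam) (h1 : lam ≤ 1) (s : TauZero lam) :
    (stripIndex s : ℝ) + 1 ≤ ‖(s : ℂ) - 1‖ := by
  rcases Nat.eq_zero_or_pos (stripIndex s) with h | h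
  · obtain ⟨k, -, hk⟩ := s.exists_mem h0 h1
    simpa [h] using hk
  · have h1' : (1 : ℝ) ≤ stripIndex s := by exact_mod_cast h
    have h2 := Complex.abs_im_le_norm ((s : ℂ) - 1)
    rw [Complex.sub_im, Complex.one_im, sub_zero] at h2
    have h3 := s.index_lt h0 h1
    have := Real.pi_gt_three
    nlinarith

/-- Each strip contains at most one conjugate pair; sums over the roots are compared through this
map with sums over `ℕ × Bool`. -/
theorem injective_index (h0 : 0 < lam) (h1 : lam ≤ 1) :
    Function.Injective fun s : TauZero lam => (stripIndex s, decide (0 < (s : ℂ).im)) := by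
  have key : ∀ s t : TauZero lam, stripIndex s = stripIndex t → 0 < (s : ℂ).im →
      0 < (t : ℂ).im → s = t := by
    intro s t hst hs ht
    have h2 := s.mem_strip h0 h1
    have h3 := t.mem_strip h0 h1
    rw [abs_of_pos hs, hst] at h2
    rw [abs_of_pos ht] at h3
    have := eq_of_mul_exp_eq (by positivity) (s.mul_exp_eq h0) (t.mul_exp_eq h0)
      (by simpa using h2) (by simpa using h3)
    exact Subtype.ext (by linear_combination this)
  intro s t hst
  simp only [Prod.mk.injEq, decide_eq_decide] at hst
  rcases lt_or_ge 0 (s : ℂ).im with hs | hs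
  · exact key s t hst.1 hs (hst.2.1 hs)
  · have ht : (t : ℂ).im ≤ 0 := not_lt.1 fun ht => absurd (hst.2.2 ht) (not_lt.2 hs)
    have := key s.conj t.conj (by simpa [conj, stripIndex_conj] using hst.1)
      (by simpa [conj] using lt_of_le_of_ne hs (s.im_ne_zero h0 h1))
      (by simpa [conj] using lt_of_le_of_ne ht (t.im_ne_zero h0 h1))
    have h2 := congrArg Subtype.val this
    exact Subtype.ext (star_injective h2)

/-- The constant depends on `λ`, because the pair of index `0` approaches the origin as `λ` tends to
`1`. The members of that pair have equal modulus, so one of them fixes the constant. -/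
theorem exists_le_norm (h0 : 0 < lam) (h1 : lam ≤ 1) :
    ∃ c : ℝ, 0 < c ∧ ∀ s : TauZero lam, c * (stripIndex s + 1) ≤ ‖(s : ℂ)‖ := by
  have key : ∀ c : ℝ, 0 < c → c ≤ 1 → (∀ s : TauZero lam, stripIndex s = 0 → c ≤ ‖(s : ℂ)‖) →
      ∀ s : TauZero lam, c * (stripIndex s + 1) ≤ ‖(s : ℂ)‖ := by
    intro c hc hc1 h s
    rcases Nat.eq_zero_or_pos (stripIndex s) with hs | hs
    · simpa [hs] using h s hs
    · have h1' : (1 : ℝ) ≤ stripIndex s := by exact_mod_cast hs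
      have h2 := Complex.abs_im_le_norm (s : ℂ)
      have h3 := s.index_lt h0 h1
      have := Real.pi_gt_three
      nlinarith
  by_cases h : ∃ s : TauZero lam, stripIndex s = 0
  · obtain ⟨t, ht⟩ := h
    have htn : 0 < ‖(t : ℂ)‖ := norm_pos_iff.2 t.2.2
    refine ⟨min 1 ‖(t : ℂ)‖, lt_min one_pos htn, key _ (lt_min one_pos htn) (min_le_left _ _) ?_⟩
    intro s hs
    refine (min_le_right _ _).trans (le_of_eq ?_)
    by_cases hst : decide (0 < (s : ℂ).im) = decide (0 < (t : ℂ).im)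
    · rw [injective_index h0 h1 (a₁ := s) (a₂ := t) (Prod.ext (hs.trans ht.symm) hst)]
    · have hsi := s.im_ne_zero h0 h1
      have hti := t.im_ne_zero h0 h1
      have : s.conj = t := injective_index h0 h1 (Prod.ext
        (by simpa [conj, stripIndex_conj] using hs.trans ht.symm) (by
          simp only [decide_eq_decide] at hst ⊢
          simp only [conj, Complex.conj_im]
          grind))
      rw [← this]
      exact Complex.norm_conj _
  · push Not at h
    exact ⟨1, one_pos, key 1 one_pos le_rfl fun s hs => absurd hs (h s)⟩

theorem exp_mul_one_sub (h0 : 0 < lam) (s : TauZero lam) :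
    (lam : ℂ) * (Complex.exp s * (1 - s)) = 1 := by
  have h := s.2.1
  have hl : (lam : ℂ) ≠ 0 := by exact_mod_cast h0.ne'
  rw [tauFun] at h
  field_simp at h
  linear_combination -h

/-- The root equation makes the real parts tend to `-∞` logarithmically. Hence `|e^{su}|` decays
like the `-u`-th power of the index, and division by `s` makes the series absolutely convergent for
`u > 0`. -/
theorem exp_re (h0 : 0 < lam) (s : TauZero lam) :
    Real.exp (s : ℂ).re = (lam * ‖(s : ℂ) - 1‖)⁻¹ := by
  have h := congrArg norm (s.exp_mul_one_sub h0)
  rw [norm_mul, norm_mul, Complex.norm_exp, Complex.norm_real, Real.norm_of_nonneg h0.le,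
    norm_one, norm_sub_rev] at h
  refine eq_inv_of_mul_eq_one_left ?_
  rw [← h]; ring

theorem norm_exp_mul (h0 : 0 < lam) (s : TauZero lam) (u : ℝ) :
    ‖Complex.exp ((s : ℂ) * u)‖ = (lam * ‖(s : ℂ) - 1‖) ^ (-u) := by
  rw [Complex.norm_exp, Complex.re_mul_ofReal, Real.exp_mul, s.exp_re h0,
    Real.inv_rpow (by positivity), Real.rpow_neg (by positivity)]

theorem norm_exp_mul_le (h0 : 0 < lam) (h1 : lam ≤ 1) (s : TauZero lam) {u : ℝ} (hu : 0 ≤ u) :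
    ‖Complex.exp ((s : ℂ) * u)‖ ≤ lam ^ (-u) * ((stripIndex s : ℝ) + 1) ^ (-u) := by
  rw [s.norm_exp_mul h0, ← Real.mul_rpow h0.le (by positivity)]
  exact Real.rpow_le_rpow_of_nonpos (by positivity)
    (mul_le_mul_of_nonneg_left (s.index_add_one_le_norm_sub_one h0 h1) h0.le) (by linarith)

theorem summable_index (h0 : 0 < lam) (h1 : lam ≤ 1) {p : ℝ} (hp : 1 < p) :
    Summable fun s : TauZero lam => ((stripIndex s : ℝ) + 1) ^ (-p) := by
  have h2 : Summable fun k : ℕ => ((k : ℝ) + 1) ^ (-p) := by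
    have := (summable_nat_add_iff 1).2 (Real.summable_nat_rpow.2 (show -p < -1 by linarith))
    simpa using this
  have h3 : Summable fun q : ℕ × Bool => ((q.1 : ℝ) + 1) ^ (-p) * 1 :=
    h2.mul_of_nonneg (g := fun _ : Bool => (1 : ℝ)) (Summable.of_finite) (fun _ => by positivity)
      fun _ => zero_le_one
  simpa [Function.comp_def] using h3.comp_injective (injective_index h0 h1)

theorem norm_term_le (h0 : 0 < lam) (h1 : lam ≤ 1) {c : ℝ} (hc : 0 < c)
    (s : TauZero lam) (hs : c * (stripIndex s + 1) ≤ ‖(s : ℂ)‖) {u : ℝ} (hu : 0 ≤ u) :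
    ‖Complex.exp ((s : ℂ) * u) / s‖ ≤
      lam ^ (-u) / c * ((stripIndex s : ℝ) + 1) ^ (-(1 + u)) := by
  have hk : (0 : ℝ) < stripIndex s + 1 := by positivity
  rw [norm_div]
  refine (div_le_div₀ (by positivity) (s.norm_exp_mul_le h0 h1 hu) (by positivity) hs).trans_eq ?_
  rw [show -(1 + u) = -u - 1 by ring, Real.rpow_sub_one hk.ne']
  field_simp

theorem summable_exp_div (h0 : 0 < lam) (h1 : lam ≤ 1) {u : ℝ} (hu : 0 < u) :
    Summable fun s : TauZero lam => Complex.exp ((s : ℂ) * u) / s := by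
  obtain ⟨c, hc, hcs⟩ := exists_le_norm h0 h1
  refine Summable.of_norm_bounded
    ((summable_index h0 h1 (show 1 < 1 + u by linarith)).mul_left (lam ^ (-u) / c)) fun s => ?_
  exact s.norm_term_le h0 h1 hc (hcs s) hu.le

end TauZero

/-! ### Partial fractions of `e^{zu} / τ` at `z = 1` -/

/-- Riemann's theorem on removable singularities, applied to one point of `S` after another. -/
theorem exists_differentiableOn_extension {U : Set ℂ} (hU : IsOpen U) (S : Finset ℂ) {q : ℂ → ℂ}
    (hd : DifferentiableOn ℂ q (U \ S))
    (ho : ∀ s ∈ S, Filter.Tendsto (fun z => (z - s) * q z) (nhdsWithin s {s}ᶜ) (nhds 0)) :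
    ∃ Q : ℂ → ℂ, DifferentiableOn ℂ Q U ∧ ∀ z, z ∉ S → Q z = q z := by
  classical
  induction S using Finset.induction_on generalizing U with
  | empty => exact ⟨q, by simpa using hd, fun _ _ => rfl⟩
  | insert a S ha ih =>
    obtain ⟨Q, hQd, hQ⟩ := ih (U := U \ {a}) (hU.sdiff isClosed_singleton)
      (hd.mono fun z hz => ⟨hz.1.1, by
        simp only [Finset.coe_insert, mem_insert_iff, not_or]
        exact ⟨hz.1.2, hz.2⟩⟩)
      fun s hs => ho s (Finset.mem_insert_of_mem hs)
    by_cases haU : a ∈ U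
    · have hlim : Filter.Tendsto (fun z => (z - a) * Q z) (nhdsWithin a {a}ᶜ) (nhds 0) := by
        refine (ho a (Finset.mem_insert_self a S)).congr' ?_
        have : (S : Set ℂ)ᶜ ∈ nhds a := S.finite_toSet.isClosed.isOpen_compl.mem_nhds ha
        filter_upwards [mem_nhdsWithin_of_mem_nhds this] with z hz
        rw [hQ z hz]
      have hlim2 : Filter.Tendsto (fun z => (z - a) * (Q z - Q a)) (nhdsWithin a {a}ᶜ)
          (nhds 0) := by
        have h1 : Filter.Tendsto (fun z => (z - a) * Q a) (nhdsWithin a {a}ᶜ)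
            (nhds ((a - a) * Q a)) :=
          (((continuous_id.sub continuous_const).mul continuous_const).tendsto a).mono_left
            nhdsWithin_le_nhds
        have h2 := hlim.sub h1
        rw [sub_self, zero_mul, sub_zero] at h2
        exact h2.congr fun z => by ring
      refine ⟨_, Complex.differentiableOn_update_limUnder_of_isLittleO (hU.mem_nhds haU) hQd ?_,
        fun z hz => ?_⟩
      · refine (Asymptotics.isLittleO_iff_tendsto' ?_).2 (hlim2.congr fun z => ?_)
        · filter_upwards [self_mem_nhdsWithin] with z hz h0
          exact absurd (sub_eq_zero.1 (inv_eq_zero.1 h0)) hz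
        · rw [div_inv_eq_mul, mul_comm]
      · rw [Finset.mem_insert, not_or] at hz
        rw [Function.update_of_ne hz.1, hQ z hz.2]
    · refine ⟨Q, ?_, fun z hz => hQ z fun h => hz (Finset.mem_insert_of_mem h)⟩
      rwa [sdiff_singleton_eq_self haU] at hQd

/-- A function holomorphic in a horizontal strip up to finitely many removable singularities, and
bounded far away, is bounded by its supremum over the boundary lines. -/
theorem norm_le_of_strip {Y M : ℝ} (S : Finset ℂ) (hS : ∀ s ∈ S, |s.im| < Y)
    {q : ℂ → ℂ} (hd : ∀ z : ℂ, |z.im| ≤ Y → z ∉ S → DifferentiableAt ℂ q z)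
    (ho : ∀ s ∈ S, Filter.Tendsto (fun z => (z - s) * q z) (nhdsWithin s {s}ᶜ) (nhds 0))
    (hb : ∃ R B : ℝ, ∀ z : ℂ, |z.im| ≤ Y → R ≤ |z.re| → ‖q z‖ ≤ B)
    (hM : ∀ z : ℂ, |z.im| = Y → ‖q z‖ ≤ M) {z : ℂ} (hz : |z.im| < Y) (hzS : z ∉ S) :
    ‖q z‖ ≤ M := by
  have hY : 0 < Y := (abs_nonneg _).trans_lt hz
  set U : Set ℂ := Complex.im ⁻¹' Ioo (-Y) Y with hUdef
  have hU : IsOpen U := isOpen_Ioo.preimage Complex.continuous_im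
  have hUmem : ∀ z : ℂ, z ∈ U ↔ |z.im| < Y := fun z => abs_lt.symm
  obtain ⟨Q, hQd, hQ⟩ := exists_differentiableOn_extension hU S
    (fun z hz => (hd z ((hUmem z).1 hz.1).le hz.2).differentiableWithinAt) ho
  rw [← hQ z hzS]
  have hcl : closure U ⊆ {z : ℂ | |z.im| ≤ Y} :=
    closure_minimal (fun z hz => ((hUmem z).1 hz).le)
      (isClosed_le (Complex.continuous_im.abs) continuous_const)
  have hbd : ∀ w : ℂ, |w.im| = Y → w ∉ S := fun w hw hwS => (hS w hwS).ne hw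
  have hQM : ∀ w : ℂ, |w.im| = Y → ‖Q w‖ ≤ M := fun w hw => by
    rw [hQ w (hbd w hw)]; exact hM w hw
  refine PhragmenLindelof.horizontal_strip (a := -Y) (b := Y) ⟨hQd, fun w hw => ?_⟩ ?_
    (fun w hw => hQM w (by rw [hw, abs_neg, abs_of_pos hY]))
    (fun w hw => hQM w (by rw [hw, abs_of_pos hY])) (abs_lt.1 hz).1.le (abs_lt.1 hz).2.le
  · rcases lt_or_eq_of_le (show |w.im| ≤ Y from hcl hw) with h | h
    · exact ((hQd w ((hUmem w).2 h)).differentiableAt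
        (hU.mem_nhds ((hUmem w).2 h))).continuousAt.continuousWithinAt
    · have hwS := hbd w h
      refine ContinuousAt.continuousWithinAt ?_
      refine (hd w h.le hwS).continuousAt.congr ?_
      filter_upwards [S.finite_toSet.isClosed.isOpen_compl.mem_nhds hwS] with v hv
      exact (hQ v hv).symm
  · obtain ⟨R, B, hRB⟩ := hb
    -- The function is bounded far away, so the growth condition is needed only with both constants
    -- `0`, that is, as `O(1)`.
    refine ⟨0, div_pos Real.pi_pos (by linarith), 0, ?_⟩
    refine Asymptotics.IsBigO.of_bound B ?_
    have hev1 : ∀ᶠ w : ℂ in Filter.comap (abs ∘ Complex.re) Filter.atTop, R ≤ |w.re| :=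
      Filter.tendsto_comap.eventually (Filter.eventually_ge_atTop R)
    obtain ⟨R', hR'⟩ : ∃ R' : ℝ, ∀ s ∈ S, |s.re| < R' := by
      refine ⟨∑ s ∈ S, |s.re| + 1, fun s hs => ?_⟩
      have := Finset.single_le_sum (f := fun s : ℂ => |s.re|) (fun _ _ => abs_nonneg _) hs
      linarith
    have hev2 : ∀ᶠ w : ℂ in Filter.comap (abs ∘ Complex.re) Filter.atTop, R' ≤ |w.re| :=
      Filter.tendsto_comap.eventually (Filter.eventually_ge_atTop R')
    filter_upwards [Filter.mem_inf_of_left hev1, Filter.mem_inf_of_left hev2,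
      Filter.mem_inf_of_right (Filter.mem_principal_self _)] with w h1 h2 h3
    have hwS : w ∉ S := fun h => absurd (hR' w h) (not_lt.2 h2)
    rw [hQ w hwS]
    simpa using hRB w ((hUmem w).1 h3).le h1

theorem hasDerivAt_tauFun (lam : ℝ) (s : ℂ) : HasDerivAt (tauFun lam) (s * Complex.exp s) s := by
  have h1 := Complex.hasDerivAt_exp s
  have h2 := (h1.const_sub (1 / (lam : ℂ))).add ((hasDerivAt_id s).mul h1)
  refine (h2.congr_deriv ?_)
  simp only [id]
  ring

theorem continuous_tauFun (lam : ℝ) : Continuous (tauFun lam) :=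
  continuous_iff_continuousAt.2 fun s => (hasDerivAt_tauFun lam s).continuousAt

theorem tauFun_one (lam : ℝ) : tauFun lam 1 = 1 / lam := by
  rw [tauFun]; ring

/-- The pole is simple because `τ'(s) = s e^s` vanishes only at `0`. -/
theorem tendsto_residue {lam : ℝ} (s : TauZero lam) (u : ℂ) :
    Filter.Tendsto (fun z => (z - s) * (Complex.exp (z * u) / tauFun lam z))
      (nhdsWithin (s : ℂ) {(s : ℂ)}ᶜ) (nhds (Complex.exp (s * u) / (s * Complex.exp s))) := by
  have h1 := (hasDerivAt_iff_tendsto_slope.1 (hasDerivAt_tauFun lam s)).inv₀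
    (mul_ne_zero s.2.2 (Complex.exp_ne_zero _))
  have h2 : Filter.Tendsto (fun z => Complex.exp (z * u)) (nhdsWithin (s : ℂ) {(s : ℂ)}ᶜ)
      (nhds (Complex.exp (s * u))) :=
    ((Complex.continuous_exp.comp (continuous_id.mul continuous_const)).tendsto
      (s : ℂ)).mono_left nhdsWithin_le_nhds
  refine (h2.mul h1).congr fun z => ?_
  rw [slope_def_field, s.2.1, sub_zero, inv_div]
  ring

/-- On the lines `|im z| = 2πn` the exponential is real and positive, so real and imaginary part of
`τ` are explicit. With `Y = 2πn` and `v = Y e^{re z}`, the imaginary part gives `v ≤ |τ|`, enough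
when `v ≥ 1` as `u ≤ 1`; when `v < 1` the real part keeps `|τ|` above `1/10`. -/
theorem norm_exp_div_tauFun_le {lam : ℝ} (h0 : 0 < lam) (h1 : lam ≤ 1) {u : ℝ} (hu0 : 0 ≤ u)
    (hu1 : u ≤ 1) {n : ℕ} (hn : 1 ≤ n) {z : ℂ} (hz : |z.im| = 2 * Real.pi * n) :
    ‖Complex.exp (z * u) / tauFun lam z‖ ≤ 10 * (2 * Real.pi * n) ^ (-u) := by
  have hn1 : (1 : ℝ) ≤ n := by exact_mod_cast hn
  have hpi := Real.pi_gt_three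
  set Y := 2 * Real.pi * n with hY
  have hY6 : 6 ≤ Y := by nlinarith
  have hsin : Real.sin z.im = 0 := by
    rcases abs_eq (by positivity) |>.1 hz with h | h <;> rw [h]
    · rw [hY, show 2 * Real.pi * n = ((2 * n : ℕ) : ℝ) * Real.pi by push_cast; ring]
      exact Real.sin_nat_mul_pi _
    · rw [Real.sin_neg, hY, show 2 * Real.pi * n = ((2 * n : ℕ) : ℝ) * Real.pi by push_cast; ring,
        Real.sin_nat_mul_pi, neg_zero]
  have hcos : Real.cos z.im = 1 := by
    rw [← Real.cos_abs, hz, hY, mul_comm]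
    exact Real.cos_nat_mul_two_pi n
  have hexp : Complex.exp z = (Real.exp z.re : ℂ) := by
    apply Complex.ext
    · rw [Complex.exp_re, hcos, Complex.ofReal_re, mul_one]
    · rw [Complex.exp_im, hsin, Complex.ofReal_im, mul_zero]
  have hre : (tauFun lam z).re = 1 / lam + (z.re - 1) * Real.exp z.re := by
    rw [tauFun, hexp, Complex.add_re, Complex.sub_re, Complex.re_mul_ofReal, Complex.ofReal_re,
      ← Complex.ofReal_one, ← Complex.ofReal_div, Complex.ofReal_re]
    ring
  have him : (tauFun lam z).im = z.im * Real.exp z.re := by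
    rw [tauFun, hexp, Complex.add_im, Complex.sub_im, Complex.im_mul_ofReal, Complex.ofReal_im,
      ← Complex.ofReal_one, ← Complex.ofReal_div, Complex.ofReal_im]
    ring
  have hE := Real.exp_pos z.re
  have hn1 : Y * Real.exp z.re ≤ ‖tauFun lam z‖ := by
    have := Complex.abs_im_le_norm (tauFun lam z)
    rwa [him, abs_mul, hz, abs_of_pos hE] at this
  have key : (Y * Real.exp z.re) ^ u ≤ 10 * ‖tauFun lam z‖ := by
    rcases le_or_gt 1 (Y * Real.exp z.re) with h | h
    · have := Real.rpow_le_rpow_of_exponent_le h hu1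
      rw [Real.rpow_one] at this
      nlinarith [norm_nonneg (tauFun lam z)]
    · have h2 : (Y * Real.exp z.re) ^ u ≤ 1 := Real.rpow_le_one (by positivity) h.le hu0
      have h3 := Complex.re_le_norm (tauFun lam z)
      rw [hre] at h3
      have h4 : 1 ≤ 1 / lam := by rw [one_le_div h0]; exact h1
      -- From `Y ≥ 6` follows `6t² < 1`, hence `t < 0.42`; then `(1 - x) e^x ≤ 2 (1 - x/2) t · t ≤
      -- 2t ≤ 0.84` for `x = re z`.
      set t := Real.exp (z.re / 2) with ht
      have htt : Real.exp z.re = t ^ 2 := by rw [ht, ← Real.exp_nat_mul]; congr 1; push_cast; ring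
      have ht0 : 0 < t := Real.exp_pos _
      have ht1 : t < 0.42 := by
        by_contra! h5
        rw [htt] at h
        nlinarith
      have h5 : 1 - z.re / 2 ≤ t⁻¹ := by
        rw [ht, ← Real.exp_neg]
        have := Real.add_one_le_exp (-(z.re / 2))
        linarith
      have h6 : (1 - z.re) * Real.exp z.re ≤ 0.84 := by
        rw [htt]
        have h7 : (1 - z.re / 2) * t ≤ 1 := by
          calc (1 - z.re / 2) * t ≤ t⁻¹ * t := mul_le_mul_of_nonneg_right h5 ht0.le
            _ = 1 := inv_mul_cancel₀ ht0.ne'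
        nlinarith
      nlinarith
  have hτ : 0 < ‖tauFun lam z‖ := lt_of_lt_of_le (by positivity) hn1
  rw [norm_div, div_le_iff₀ hτ, Complex.norm_exp, Complex.re_mul_ofReal, Real.exp_mul]
  rw [Real.mul_rpow (by positivity) hE.le] at key
  rw [Real.rpow_neg (by positivity)]
  have hYu : 0 < Y ^ u := by positivity
  calc Real.exp z.re ^ u = (Y ^ u)⁻¹ * (Y ^ u * Real.exp z.re ^ u) := by field_simp
    _ ≤ (Y ^ u)⁻¹ * (10 * ‖tauFun lam z‖) := mul_le_mul_of_nonneg_left key (by positivity)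
    _ = 10 * (Y ^ u)⁻¹ * ‖tauFun lam z‖ := by ring

/-- Far to the right `|τ| ≥ e^{re z}`, which dominates the numerator as `u ≤ 1`; far to the left `τ`
is close to `1/λ ≥ 1` and the numerator is at most `1`, as `u ≥ 0`. -/
theorem exists_bound_exp_div_tauFun {lam : ℝ} (h0 : 0 < lam) (h1 : lam ≤ 1) {u : ℝ} (hu0 : 0 ≤ u)
    (hu1 : u ≤ 1) {Y : ℝ} (hY : 0 ≤ Y) :
    ∃ R : ℝ, ∀ z : ℂ, |z.im| ≤ Y → R ≤ |z.re| → ‖Complex.exp (z * u) / tauFun lam z‖ ≤ 2 := by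
  have hl : 1 ≤ 1 / lam := by rw [one_le_div h0]; exact h1
  refine ⟨4 + 2 * Y + 1 / lam, fun z hz hR => ?_⟩
  have hτ : tauFun lam z = (z - 1) * Complex.exp z + 1 / lam := by rw [tauFun]; ring
  have hnl : ‖(1 / lam : ℂ)‖ = 1 / lam := by
    rw [← Complex.ofReal_one, ← Complex.ofReal_div, Complex.norm_real,
      Real.norm_of_nonneg (by positivity)]
  have hnum : ‖Complex.exp (z * u)‖ = Real.exp (z.re * u) := by
    rw [Complex.norm_exp, Complex.re_mul_ofReal]
  rcases le_total 0 z.re with h | h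
  · rw [abs_of_nonneg h] at hR
    have h2 : z.re - 1 ≤ ‖z - 1‖ := by
      have := Complex.re_le_norm (z - 1)
      simpa using this
    have h3 : ‖(z - 1) * Complex.exp z‖ - 1 / lam ≤ ‖tauFun lam z‖ := by
      have := norm_sub_le_norm_add ((z - 1) * Complex.exp z) (1 / lam : ℂ)
      rwa [hnl, ← hτ] at this
    rw [norm_mul, Complex.norm_exp] at h3
    have hE : 1 ≤ Real.exp z.re := Real.one_le_exp h
    have h4 : Real.exp z.re ≤ ‖tauFun lam z‖ := by nlinarith
    have h5 : Real.exp (z.re * u) ≤ Real.exp z.re := Real.exp_le_exp.2 (by nlinarith)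
    rw [norm_div, hnum, div_le_iff₀ (by linarith)]
    linarith
  · rw [abs_of_nonpos h] at hR
    set y := -z.re with hy
    have h2 : ‖z - 1‖ ≤ y + 1 + Y := by
      have := Complex.norm_le_abs_re_add_abs_im (z - 1)
      rw [Complex.sub_re, Complex.sub_im, Complex.one_re, Complex.one_im, sub_zero,
        abs_of_nonpos (by linarith)] at this
      linarith
    have h3 : 1 / lam - ‖(z - 1) * Complex.exp z‖ ≤ ‖tauFun lam z‖ := by
      have := norm_sub_le_norm_add (1 / lam : ℂ) ((z - 1) * Complex.exp z)
      rwa [hnl, add_comm, ← hτ] at this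
    rw [norm_mul, Complex.norm_exp] at h3
    have h4 := Real.quadratic_le_exp_of_nonneg (x := y) (by linarith)
    have h5 : Real.exp z.re * Real.exp y = 1 := by rw [← Real.exp_add, hy]; simp
    have hE := Real.exp_pos z.re
    have h6 : 2 * (y + 1 + Y) ≤ Real.exp y := by
      have hy4 : 4 + 2 * Y ≤ y := by linarith
      nlinarith
    have h7 : ‖z - 1‖ * Real.exp z.re ≤ 1 / 2 := by nlinarith
    have h8 : Real.exp (z.re * u) ≤ 1 := Real.exp_le_one_iff.2 (mul_nonpos_of_nonpos_of_nonneg h hu0)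
    rw [norm_div, hnum, div_le_iff₀ (by linarith)]
    linarith

/-! ### A convolution estimate for the sums of residues. -/

theorem rpow_neg_mul_inv_le {u : ℝ} (hu0 : 0 < u) (hu1 : u ≤ 1) {a b n : ℝ} (ha : 1 ≤ a)
    (hb : 1 ≤ b) (hn : 1 ≤ n) (hab : a + b = n + 1) :
    a ^ (-u) * b⁻¹ ≤ n ^ (-(u / 4)) * (a ^ (-(1 + u / 2)) + b ^ (-(1 + u / 2))) := by
  have ha0 : 0 < a := by linarith
  have hb0 : 0 < b := by linarith
  -- A factor `(ab)^{-u/4}`, at most `n^{-u/4}` because `(a-1)(b-1) ≥ 0`, is split off; the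
  -- remaining exponents still add up to `1 + u/2`, which is summable.
  have h1 : a ^ (-u) * b⁻¹ =
      (a * b) ^ (-(u / 4)) * (a ^ (-(3 * u / 4)) * b ^ (-(1 - u / 4))) := by
    rw [Real.mul_rpow ha0.le hb0.le, ← Real.rpow_neg_one b, mul_mul_mul_comm, ← Real.rpow_add ha0,
      ← Real.rpow_add hb0]
    congr 2 <;> ring
  have h2 : (a * b) ^ (-(u / 4)) ≤ n ^ (-(u / 4)) :=
    Real.rpow_le_rpow_of_nonpos (by linarith) (by nlinarith) (by linarith)
  have h3 : a ^ (-(3 * u / 4)) * b ^ (-(1 - u / 4)) ≤ a ^ (-(1 + u / 2)) + b ^ (-(1 + u / 2)) := by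
    have hexp : -(1 + u / 2) = -(3 * u / 4) + -(1 - u / 4) := by ring
    rcases le_total a b with h | h
    · have : b ^ (-(1 - u / 4)) ≤ a ^ (-(1 - u / 4)) :=
        Real.rpow_le_rpow_of_nonpos ha0 h (by linarith)
      calc _ ≤ a ^ (-(3 * u / 4)) * a ^ (-(1 - u / 4)) :=
            mul_le_mul_of_nonneg_left this (by positivity)
        _ = a ^ (-(1 + u / 2)) := by rw [hexp, Real.rpow_add ha0]
        _ ≤ _ := le_add_of_nonneg_right (by positivity)
    · have : a ^ (-(3 * u / 4)) ≤ b ^ (-(3 * u / 4)) :=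
        Real.rpow_le_rpow_of_nonpos hb0 h (by linarith)
      calc _ ≤ b ^ (-(3 * u / 4)) * b ^ (-(1 - u / 4)) :=
            mul_le_mul_of_nonneg_right this (by positivity)
        _ = b ^ (-(1 + u / 2)) := by rw [hexp, Real.rpow_add hb0]
        _ ≤ _ := le_add_of_nonneg_left (by positivity)
  rw [h1]
  exact mul_le_mul h2 h3 (by positivity) (by positivity)

theorem tendsto_convolution {u : ℝ} (hu0 : 0 < u) (hu1 : u ≤ 1) :
    Filter.Tendsto (fun n : ℕ => ∑ m ∈ Finset.range n, ((m : ℝ) + 1) ^ (-u) * ((n : ℝ) - m)⁻¹)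
      Filter.atTop (nhds 0) := by
  have hsum : Summable fun k : ℕ => ((k : ℝ) + 1) ^ (-(1 + u / 2)) := by
    have := (summable_nat_add_iff 1).2
      (Real.summable_nat_rpow.2 (show -(1 + u / 2) < -1 by linarith))
    simpa using this
  set A := ∑' k : ℕ, ((k : ℝ) + 1) ^ (-(1 + u / 2)) with hA
  have hlim : Filter.Tendsto (fun n : ℕ => (n : ℝ) ^ (-(u / 4)) * (A + A)) Filter.atTop
      (nhds 0) := by
    have := (tendsto_rpow_neg_atTop (show 0 < u / 4 by linarith)).comp
      tendsto_natCast_atTop_atTop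
    simpa using this.mul_const (A + A)
  refine squeeze_zero' (Filter.Eventually.of_forall fun n => Finset.sum_nonneg fun m hm => ?_) ?_
    hlim
  · have : (m : ℝ) < n := by exact_mod_cast Finset.mem_range.1 hm
    have : 0 < (n : ℝ) - m := by linarith
    positivity
  · filter_upwards [Filter.eventually_ge_atTop 1] with n hn
    have hn1 : (1 : ℝ) ≤ n := by exact_mod_cast hn
    have hfin : ∑ m ∈ Finset.range n, ((m : ℝ) + 1) ^ (-(1 + u / 2)) ≤ A :=
      hsum.sum_le_tsum _ fun m _ => by positivity
    have hrefl : ∑ m ∈ Finset.range n, ((n : ℝ) - m) ^ (-(1 + u / 2)) =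
        ∑ m ∈ Finset.range n, ((m : ℝ) + 1) ^ (-(1 + u / 2)) := by
      rw [← Finset.sum_range_reflect]
      refine Finset.sum_congr rfl fun m hm => ?_
      have hm' := Finset.mem_range.1 hm
      rw [Nat.cast_sub (by omega), Nat.cast_sub (by omega)]
      congr 1
      push_cast
      ring
    calc _ ≤ ∑ m ∈ Finset.range n, (n : ℝ) ^ (-(u / 4)) *
          (((m : ℝ) + 1) ^ (-(1 + u / 2)) + ((n : ℝ) - m) ^ (-(1 + u / 2))) := by
          refine Finset.sum_le_sum fun m hm => ?_
          have hm' : (m : ℝ) + 1 ≤ n := by exact_mod_cast Finset.mem_range.1 hm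
          have hm0 : (0 : ℝ) ≤ m := by positivity
          exact rpow_neg_mul_inv_le hu0 hu1 (by linarith) (by linarith) hn1 (by ring)
      _ = (n : ℝ) ^ (-(u / 4)) * (∑ m ∈ Finset.range n, ((m : ℝ) + 1) ^ (-(1 + u / 2)) +
          ∑ m ∈ Finset.range n, ((m : ℝ) + 1) ^ (-(1 + u / 2))) := by
          rw [← Finset.mul_sum, Finset.sum_add_distrib, hrefl]
      _ ≤ _ := mul_le_mul_of_nonneg_left (add_le_add hfin hfin) (by positivity)

/-! ### Truncated partial fractions and their limit at `z = 1`. -/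

namespace TauZero

variable {lam : ℝ}

/-- The roots with imaginary part in `(-2πn, 2πn)`. -/
noncomputable def below (h0 : 0 < lam) (h1 : lam ≤ 1) (n : ℕ) : Finset (TauZero lam) :=
  (Finset.range n ×ˢ Finset.univ).preimage
    (fun s : TauZero lam => (stripIndex s, decide (0 < (s : ℂ).im))) (injective_index h0 h1).injOn

theorem mem_below (h0 : 0 < lam) (h1 : lam ≤ 1) {n : ℕ} {s : TauZero lam} :
    s ∈ below h0 h1 n ↔ stripIndex s < n := by
  simp [below, lt_or_ge]

theorem tendsto_below (h0 : 0 < lam) (h1 : lam ≤ 1) :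
    Filter.Tendsto (below h0 h1) Filter.atTop Filter.atTop := by
  refine Filter.tendsto_atTop_finset_of_monotone (fun m n hmn s hs => ?_) fun s =>
    ⟨stripIndex s + 1, ?_⟩
  · rw [mem_below] at hs ⊢
    omega
  · rw [mem_below]
    omega

theorem sum_below_le (h0 : 0 < lam) (h1 : lam ≤ 1) (n : ℕ) {f : ℕ → ℝ}
    (hf : ∀ m < n, 0 ≤ f m) :
    ∑ s ∈ below h0 h1 n, f (stripIndex s) ≤ 2 * ∑ m ∈ Finset.range n, f m := by
  classical
  have h2 : ∑ s ∈ below h0 h1 n, f (stripIndex s) =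
      ∑ p ∈ (below h0 h1 n).image
        (fun s : TauZero lam => (stripIndex s, decide (0 < (s : ℂ).im))), f p.1 :=
    (Finset.sum_image (f := fun p : ℕ × Bool => f p.1) (injective_index h0 h1).injOn).symm
  have h3 : 2 * ∑ m ∈ Finset.range n, f m =
      ∑ p ∈ Finset.range n ×ˢ (Finset.univ : Finset Bool), f p.1 := by
    rw [Finset.sum_product, Finset.mul_sum]
    exact Finset.sum_congr rfl fun m _ => by simp
  rw [h2, h3]
  refine Finset.sum_le_sum_of_subset_of_nonneg ?_ fun p hp _ => ?_
  · intro p hp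
    obtain ⟨s, hs, rfl⟩ := Finset.mem_image.1 hp
    rw [mem_below] at hs
    simpa [lt_or_ge] using hs
  · exact hf _ (by simpa using hp)

/-- Since `e^{-s} = λ(1 - s)`, the residue is `λ e^{su} (1 - s)/s`, in which the last factor is
bounded. -/
theorem norm_residue_le (h0 : 0 < lam) (h1 : lam ≤ 1) {c : ℝ} (hc : 0 < c) (s : TauZero lam)
    (hs : c * (stripIndex s + 1) ≤ ‖(s : ℂ)‖) {u : ℝ} (hu : 0 ≤ u) :
    ‖Complex.exp (s * u) / (s * Complex.exp s)‖ ≤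
      lam ^ (-u) * (1 + 1 / c) * ((stripIndex s : ℝ) + 1) ^ (-u) := by
  have hexp : Complex.exp s ≠ 0 := Complex.exp_ne_zero _
  have hs0 := s.2.2
  have hcs : c ≤ ‖(s : ℂ)‖ := by
    refine le_trans ?_ hs
    have : (0 : ℝ) ≤ stripIndex (s : ℂ) := by positivity
    nlinarith
  have hn : 0 < ‖(s : ℂ)‖ := hc.trans_le hcs
  have h2 : Complex.exp (s * u) / (s * Complex.exp s) =
      lam * (Complex.exp (s * u) * ((1 - s) / s)) := by
    have := s.exp_mul_one_sub h0
    field_simp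
    linear_combination -this
  have h3 : ‖(1 - (s : ℂ)) / s‖ ≤ 1 + 1 / c := by
    rw [norm_div, div_le_iff₀ hn]
    have h4 : ‖1 - (s : ℂ)‖ ≤ 1 + ‖(s : ℂ)‖ := by
      simpa using norm_sub_le (1 : ℂ) s
    have h5 : 1 ≤ 1 / c * ‖(s : ℂ)‖ := by
      rw [one_div, inv_mul_eq_div, one_le_div hc]; exact hcs
    linarith
  rw [h2, norm_mul, norm_mul, Complex.norm_real, Real.norm_of_nonneg h0.le]
  calc lam * (‖Complex.exp (s * u)‖ * ‖(1 - (s : ℂ)) / s‖)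
      ≤ 1 * (‖Complex.exp (s * u)‖ * ‖(1 - (s : ℂ)) / s‖) :=
        mul_le_mul_of_nonneg_right h1 (by positivity)
    _ ≤ 1 * (lam ^ (-u) * ((stripIndex s : ℝ) + 1) ^ (-u) * (1 + 1 / c)) := by
        gcongr
        exact s.norm_exp_mul_le h0 h1 hu
    _ = _ := by ring

theorem sub_index_le_norm (h0 : 0 < lam) (h1 : lam ≤ 1) (s : TauZero lam) {n : ℕ}
    (hs : stripIndex (s : ℂ) < n) {z : ℂ} (hz : |z.im| = 2 * Real.pi * n) :
    (n : ℝ) - stripIndex (s : ℂ) ≤ ‖z - s‖ := by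
  have h2 := Complex.abs_im_le_norm (z - s)
  rw [Complex.sub_im] at h2
  have h3 := abs_sub_abs_le_abs_sub z.im (s : ℂ).im
  have h4 := (s.mem_strip h0 h1).2
  have h5 : (stripIndex (s : ℂ) : ℝ) + 1 ≤ n := by exact_mod_cast hs
  have h6 := Real.pi_gt_three
  rw [hz] at h3
  nlinarith

theorem sum_residue_le (h0 : 0 < lam) (h1 : lam ≤ 1) {u : ℝ} (hu : 0 ≤ u) :
    ∃ K : ℝ, ∀ (n : ℕ) (z : ℂ), |z.im| = 2 * Real.pi * n →
      ‖∑ s ∈ below h0 h1 n, Complex.exp (s * u) / (s * Complex.exp s) / (z - s)‖ ≤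
        K * ∑ m ∈ Finset.range n, ((m : ℝ) + 1) ^ (-u) * ((n : ℝ) - m)⁻¹ := by
  obtain ⟨c, hc, hcs⟩ := exists_le_norm h0 h1
  refine ⟨lam ^ (-u) * (1 + 1 / c) * 2, fun n z hz => ?_⟩
  refine (norm_sum_le _ _).trans ?_
  rw [mul_assoc]
  refine le_trans ?_ (mul_le_mul_of_nonneg_left (sum_below_le h0 h1 n
    (f := fun m => ((m : ℝ) + 1) ^ (-u) * ((n : ℝ) - m)⁻¹) fun m hm => ?_) (by positivity))
  · rw [Finset.mul_sum]
    refine Finset.sum_le_sum fun s hs => ?_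
    rw [mem_below] at hs
    have h5 : (stripIndex (s : ℂ) : ℝ) + 1 ≤ n := by exact_mod_cast hs
    have h6 := s.sub_index_le_norm h0 h1 hs hz
    rw [norm_div, div_eq_mul_inv, ← mul_assoc]
    refine mul_le_mul (s.norm_residue_le h0 h1 hc (hcs s) hu)
      (inv_anti₀ (by linarith) h6) (by positivity) (by positivity)
  · have : (m : ℝ) + 1 ≤ n := by exact_mod_cast hm
    have : 0 ≤ (n : ℝ) - m := by linarith
    positivity

/-- The function `P` is the principal part at `0`, present only for `λ = 1`. The three terms of the
bound are the sizes, on the lines `|im z| = 2πn`, of the quotient, of `P` and of the residue sum. -/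
theorem norm_partial_fraction_le (h0 : 0 < lam) (h1 : lam ≤ 1) {u : ℝ} (hu0 : 0 ≤ u) (hu1 : u ≤ 1)
    {P : ℂ → ℂ} (hP : ∀ z, z ≠ 0 → DifferentiableAt ℂ P z)
    (hP0 : Filter.Tendsto (fun z => z * (Complex.exp (z * u) / tauFun lam z - P z))
      (nhdsWithin 0 {0}ᶜ) (nhds 0))
    {B : ℝ} (hB : ∀ z : ℂ, 1 ≤ ‖z‖ → ‖P z‖ ≤ B / ‖z‖) {n : ℕ} (hn : 1 ≤ n) {M : ℝ}
    (hM : ∀ z : ℂ, |z.im| = 2 * Real.pi * n →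
      ‖∑ s ∈ below h0 h1 n, Complex.exp (s * u) / (s * Complex.exp s) / (z - s)‖ ≤ M) :
    ‖Complex.exp u / tauFun lam 1 - P 1 -
      ∑ s ∈ below h0 h1 n, Complex.exp (s * u) / (s * Complex.exp s) / (1 - s)‖ ≤
        10 * (2 * Real.pi * n) ^ (-u) + B / (2 * Real.pi * n) + M := by
  classical
  have hn1 : (1 : ℝ) ≤ n := by exact_mod_cast hn
  have hpi := Real.pi_gt_three
  have hY1 : 1 ≤ 2 * Real.pi * n := by nlinarith
  have hB0 : 0 ≤ B := by
    have := (norm_nonneg _).trans (hB 1 (by simp))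
    simpa using this
  set T := below h0 h1 n with hT
  set r : TauZero lam → ℂ := fun s => Complex.exp (s * u) / (s * Complex.exp s) with hr
  set q : ℂ → ℂ := fun z => Complex.exp (z * u) / tauFun lam z - P z - ∑ s ∈ T, r s / (z - s)
    with hq
  -- The origin is always included; it is treated as a removable singularity even when `τ` does not
  -- vanish there.
  set S : Finset ℂ := insert 0 (T.image Subtype.val) with hSdef
  have hτ1 : tauFun lam 1 ≠ 0 := by
    rw [tauFun_one]
    exact one_div_ne_zero (by exact_mod_cast h0.ne')
  have hTS : ∀ s ∈ T, (s : ℂ) ∈ S := fun s hs =>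
    Finset.mem_insert_of_mem (Finset.mem_image_of_mem _ hs)
  have hzero : ∀ z : ℂ, |z.im| ≤ 2 * Real.pi * n → z ∉ S → tauFun lam z ≠ 0 := by
    intro z hz hzS hτ
    have hz0 : z ≠ 0 := fun h => hzS (by rw [h]; exact Finset.mem_insert_self _ _)
    refine hzS (hTS ⟨z, hτ, hz0⟩ ?_)
    rw [hT, mem_below]
    have := (index_lt h0 h1 ⟨z, hτ, hz0⟩).trans_le hz
    have h2 := lt_of_mul_lt_mul_left this (by positivity)
    exact_mod_cast h2
  have hnum : ∀ z : ℂ, DifferentiableAt ℂ (fun z : ℂ => Complex.exp (z * u)) z := fun z => by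
    fun_prop
  have hsumd : ∀ (A : Finset (TauZero lam)) (z : ℂ), (∀ s ∈ A, (s : ℂ) ≠ z) →
      DifferentiableAt ℂ (fun z => ∑ s ∈ A, r s / (z - s)) z := by
    intro A z hz
    refine DifferentiableAt.fun_sum fun s hs => ?_
    exact (differentiableAt_const _).div (differentiableAt_id.sub (differentiableAt_const _))
      (sub_ne_zero.2 (hz s hs).symm)
  have hlimz : ∀ (a : ℂ) (f : ℂ → ℂ), ContinuousAt f a →
      Filter.Tendsto (fun z => (z - a) * f z) (nhdsWithin a {a}ᶜ) (nhds 0) := by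
    intro a f hf
    have h2 : ContinuousAt (fun z => (z - a) * f z) a :=
      (continuousAt_id.sub continuousAt_const).mul hf
    have h3 := h2.tendsto
    simp only [sub_self, zero_mul] at h3
    exact h3.mono_left nhdsWithin_le_nhds
  have h1S : (1 : ℂ) ∉ S := by
    rw [hSdef, Finset.mem_insert, not_or]
    refine ⟨one_ne_zero, fun h => ?_⟩
    obtain ⟨s, -, hs⟩ := Finset.mem_image.1 h
    exact hτ1 (hs ▸ s.2.1)
  have hmain := norm_le_of_strip (Y := 2 * Real.pi * n)
    (M := 10 * (2 * Real.pi * n) ^ (-u) + B / (2 * Real.pi * n) + M) S ?_ (q := q) ?_ ?_ ?_ ?_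
    (z := 1) (by simp; positivity) h1S
  · simpa [hq, hr] using hmain
  · intro s hs
    rcases Finset.mem_insert.1 hs with rfl | hs
    · simp; positivity
    · obtain ⟨s, hsT, rfl⟩ := Finset.mem_image.1 hs
      rw [hT, mem_below] at hsT
      have h2 := (mem_strip h0 h1 s).2
      have h3 : (stripIndex (s : ℂ) : ℝ) + 1 ≤ n := by exact_mod_cast hsT
      nlinarith
  · intro z hz hzS
    have hz0 : z ≠ 0 := fun h => hzS (by rw [h]; exact Finset.mem_insert_self _ _)
    refine (((hnum z).div (hasDerivAt_tauFun lam z).differentiableAt (hzero z hz hzS)).sub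
      (hP z hz0)).sub (hsumd T z fun s hs h => hzS (h ▸ hTS s hs))
  · intro s hs
    rcases Finset.mem_insert.1 hs with rfl | hs
    · have h2 := hP0.sub (hlimz 0 (fun z => ∑ s ∈ T, r s / (z - s))
        (hsumd T 0 fun s _ => s.2.2).continuousAt)
      rw [sub_zero] at h2
      refine h2.congr fun z => ?_
      simp only [hq]
      ring
    · obtain ⟨s, hsT, rfl⟩ := Finset.mem_image.1 hs
      have h2 : Filter.Tendsto (fun z => (z - (s : ℂ)) * (r s / (z - s)))
          (nhdsWithin (s : ℂ) {(s : ℂ)}ᶜ) (nhds (r s)) := by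
        refine tendsto_const_nhds.congr' ?_
        filter_upwards [self_mem_nhdsWithin] with z hz
        have : z - (s : ℂ) ≠ 0 := sub_ne_zero.2 hz
        field_simp
      have h3 := ((tendsto_residue s (u : ℂ)).sub h2).sub
        ((hlimz s P (hP s s.2.2).continuousAt).add (hlimz s
          (fun z => ∑ t ∈ T.erase s, r t / (z - t)) (hsumd (T.erase s) s fun t ht h =>
            Finset.ne_of_mem_erase ht (Subtype.ext h)).continuousAt))
      rw [sub_self, add_zero, sub_zero] at h3
      refine h3.congr fun z => ?_
      simp only [hq]
      rw [← Finset.add_sum_erase T _ hsT]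
      ring
  · obtain ⟨R, hR⟩ := exists_bound_exp_div_tauFun h0 h1 hu0 hu1
      (show 0 ≤ 2 * Real.pi * n by positivity)
    refine ⟨max R (1 + ∑ s ∈ T, ‖(s : ℂ)‖), 2 + B + ∑ s ∈ T, ‖r s‖, fun z hz hzR => ?_⟩
    have hz1 := (le_max_left _ _).trans hzR
    have hz2 := ((le_max_right _ _).trans hzR).trans (Complex.abs_re_le_norm z)
    have hzn : 1 ≤ ‖z‖ := by
      have : 0 ≤ ∑ s ∈ T, ‖(s : ℂ)‖ := Finset.sum_nonneg fun _ _ => norm_nonneg _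
      linarith
    refine (norm_sub_le _ _).trans (add_le_add ((norm_sub_le _ _).trans
      (add_le_add (hR z hz hz1) ((hB z hzn).trans (div_le_self hB0 hzn)))) ?_)
    refine (norm_sum_le _ _).trans (Finset.sum_le_sum fun s hs => ?_)
    rw [norm_div]
    refine div_le_self (norm_nonneg _) ?_
    have h2 := Finset.single_le_sum (f := fun s : TauZero lam => ‖(s : ℂ)‖)
      (fun _ _ => norm_nonneg _) hs
    have h3 := norm_sub_norm_le z s
    linarith
  · intro z hz
    have hzn : 2 * Real.pi * n ≤ ‖z‖ := hz ▸ Complex.abs_im_le_norm z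
    refine (norm_sub_le _ _).trans (add_le_add ((norm_sub_le _ _).trans
      (add_le_add (norm_exp_div_tauFun_le h0 h1 hu0 hu1 hn hz) ?_)) (hM z hz))
    exact (hB z (hY1.trans hzn)).trans (div_le_div_of_nonneg_left hB0 (by linarith) hzn)

/-- At `z = 1` one has `τ(1) = 1/λ`, and the root equation turns the residue over `1 - s` into `λ
e^{su}/s`. The strips give the limit along particular finite sets only; absolute convergence
identifies it with the full sum. -/
theorem hasSum_of_principal_part (h0 : 0 < lam) (h1 : lam ≤ 1) {u : ℝ} (hu0 : 0 < u) (hu1 : u ≤ 1)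
    {P : ℂ → ℂ} (hP : ∀ z, z ≠ 0 → DifferentiableAt ℂ P z)
    (hP0 : Filter.Tendsto (fun z => z * (Complex.exp (z * u) / tauFun lam z - P z))
      (nhdsWithin 0 {0}ᶜ) (nhds 0))
    {B : ℝ} (hB : ∀ z : ℂ, 1 ≤ ‖z‖ → ‖P z‖ ≤ B / ‖z‖) :
    HasSum (fun s : TauZero lam => Complex.exp ((s : ℂ) * u) / s)
      (Complex.exp u - P 1 / lam) := by
  have hl : (lam : ℂ) ≠ 0 := by exact_mod_cast h0.ne'
  obtain ⟨K, hK⟩ := sum_residue_le h0 h1 hu0.le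
  have hbound : ∀ n : ℕ, 1 ≤ n → ‖(lam : ℂ) * (Complex.exp u - P 1 / lam) -
      lam * ∑ s ∈ below h0 h1 n, Complex.exp ((s : ℂ) * u) / s‖ ≤
      10 * (2 * Real.pi * n) ^ (-u) + B / (2 * Real.pi * n) +
        K * ∑ m ∈ Finset.range n, ((m : ℝ) + 1) ^ (-u) * ((n : ℝ) - m)⁻¹ := by
    intro n hn
    refine (le_of_eq ?_).trans (norm_partial_fraction_le h0 h1 hu0.le hu1 hP hP0 hB hn (hK n))
    congr 1
    rw [tauFun_one, Finset.mul_sum]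
    congr 1
    · field_simp
    · refine Finset.sum_congr rfl fun s _ => ?_
      have h2 := s.exp_mul_one_sub h0
      have hs := s.2.2
      have hs1 : (1 : ℂ) - s ≠ 0 := fun h => by simp [h] at h2
      have he := Complex.exp_ne_zero (s : ℂ)
      field_simp
      linear_combination h2
  have hlin : Filter.Tendsto (fun n : ℕ => 2 * Real.pi * (n : ℝ)) Filter.atTop Filter.atTop :=
    tendsto_natCast_atTop_atTop.const_mul_atTop (by positivity)
  have herr : Filter.Tendsto (fun n : ℕ => 10 * (2 * Real.pi * (n : ℝ)) ^ (-u) +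
      B / (2 * Real.pi * n) + K * ∑ m ∈ Finset.range n, ((m : ℝ) + 1) ^ (-u) * ((n : ℝ) - m)⁻¹)
      Filter.atTop (nhds 0) := by
    have e1 := ((tendsto_rpow_neg_atTop hu0).comp hlin).const_mul 10
    have e2 : Filter.Tendsto (fun n : ℕ => B / (2 * Real.pi * (n : ℝ))) Filter.atTop (nhds 0) :=
      tendsto_const_nhds.div_atTop hlin
    have e3 := (tendsto_convolution hu0 hu1).const_mul K
    simpa using (e1.add e2).add e3
  have hlim : Filter.Tendsto (fun n : ℕ => (lam : ℂ) * (Complex.exp u - P 1 / lam) -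
      lam * ∑ s ∈ below h0 h1 n, Complex.exp ((s : ℂ) * u) / s) Filter.atTop (nhds 0) := by
    refine squeeze_zero_norm' ?_ herr
    filter_upwards [Filter.eventually_ge_atTop 1] with n hn using hbound n hn
  have hs := (summable_exp_div h0 h1 hu0).hasSum
  have h2 : Filter.Tendsto (fun n : ℕ => (lam : ℂ) * (Complex.exp u - P 1 / lam) -
      lam * ∑ s ∈ below h0 h1 n, Complex.exp ((s : ℂ) * u) / s) Filter.atTop
      (nhds ((lam : ℂ) * (Complex.exp u - P 1 / lam) -
        lam * ∑' s : TauZero lam, Complex.exp ((s : ℂ) * u) / s)) :=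
    tendsto_const_nhds.sub ((hs.comp (tendsto_below h0 h1)).const_mul (lam : ℂ))
  have h3 := tendsto_nhds_unique hlim h2
  have h4 : Complex.exp u - P 1 / lam = ∑' s : TauZero lam, Complex.exp ((s : ℂ) * u) / s := by
    refine mul_left_cancel₀ hl ?_
    linear_combination -h3
  rw [h4]
  exact hs

end TauZero

/-! ### The expansion of `g` over the roots of `τ` -/

/-- The sum over the roots is not controlled at `0`, so the delay equation is assumed only for `y >
1`, where the integral avoids `0`. Continuity at `1` links the new interval to the known one. -/
theorem eq_zero_of_delay {v : ℝ → ℂ} {t : ℂ} (hc : ContinuousOn v (Ioi 0))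
    (h0 : ∀ x, 0 < x → x ≤ 1 → v x = 0)
    (h : ∀ y x, 1 < y → y ≤ x → v x - v y = t * ∫ u in (y - 1)..(x - 1), v u) :
    ∀ x, 0 < x → v x = 0 := by
  have key : ∀ n : ℕ, ∀ x : ℝ, 0 < x → x ≤ n + 1 → v x = 0 := by
    intro n
    induction n with
    | zero => intro x hx hx1; exact h0 x hx (by simpa using hx1)
    | succ n ih =>
      intro x hx hxn
      push_cast at hxn
      rcases le_or_gt x 1 with hx1 | hx1
      · exact h0 x hx hx1
      have heq : ∀ y ∈ Ioo (1 : ℝ) x, v y = v x := by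
        intro y hy
        have h2 := h y x hy.1 hy.2.le
        rw [intervalIntegral.integral_congr (g := fun _ => (0 : ℂ)),
          intervalIntegral.integral_zero, mul_zero, sub_eq_zero] at h2
        · exact h2.symm
        · intro u hu
          rw [uIcc_of_le (by linarith [hy.2])] at hu
          exact ih u (by linarith [hu.1, hy.1]) (by linarith [hu.2])
      have h1 : Filter.Tendsto v (nhdsWithin 1 (Ioi 1)) (nhds (v 1)) :=
        ((hc.continuousAt (Ioi_mem_nhds one_pos)).tendsto).mono_left nhdsWithin_le_nhds
      have h2 : Filter.Tendsto v (nhdsWithin 1 (Ioi 1)) (nhds (v x)) := by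
        refine tendsto_const_nhds.congr' ?_
        filter_upwards [Ioo_mem_nhdsGT hx1] with y hy using (heq y hy).symm
      rw [tendsto_nhds_unique h2 h1, h0 1 one_pos le_rfl]
  intro x hx
  obtain ⟨n, hn⟩ := exists_nat_ge x
  exact key n x hx (by linarith)

namespace TauZero

variable {lam : ℝ}

theorem countable (h0 : 0 < lam) (h1 : lam ≤ 1) : Countable (TauZero lam) :=
  (injective_index h0 h1).countable

/-- The sum over the roots, multiplied by `e^{-x}`. -/
noncomputable def rootSum (lam : ℝ) (x : ℝ) : ℂ :=
  ∑' s : TauZero lam, Complex.exp (((s : ℂ) - 1) * x) / s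

theorem exp_sub_one_mul (s : ℂ) (x : ℝ) :
    Complex.exp ((s - 1) * x) / s = (Real.exp (-x) : ℂ) * (Complex.exp (s * x) / s) := by
  rw [sub_mul, one_mul, Complex.exp_sub, Real.exp_neg]
  push_cast
  ring

theorem summable_exp_sub_one (h0 : 0 < lam) (h1 : lam ≤ 1) {x : ℝ} (hx : 0 < x) :
    Summable fun s : TauZero lam => Complex.exp (((s : ℂ) - 1) * x) / s := by
  simp_rw [exp_sub_one_mul]
  exact (summable_exp_div h0 h1 hx).mul_left _

theorem rootSum_eq (x : ℝ) :
    rootSum lam x = (Real.exp (-x) : ℂ) * ∑' s : TauZero lam, Complex.exp ((s : ℂ) * x) / s := by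
  simp_rw [rootSum, exp_sub_one_mul, tsum_mul_left]

theorem exists_uniform_bound (h0 : 0 < lam) (h1 : lam ≤ 1) {a b : ℝ} (ha : 0 < a) :
    ∃ B : TauZero lam → ℝ, Summable B ∧ ∀ s : TauZero lam, ∀ x ∈ Icc a b,
      ‖Complex.exp (((s : ℂ) - 1) * x) / s‖ ≤ B s := by
  obtain ⟨c, hc, hcs⟩ := exists_le_norm h0 h1
  refine ⟨_, (summable_index h0 h1 (show 1 < 1 + a by linarith)).mul_left (lam ^ (-b) / c),
    fun s x hx => ?_⟩
  have hx0 : 0 < x := ha.trans_le hx.1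
  rw [exp_sub_one_mul, norm_mul, Complex.norm_real, Real.norm_of_nonneg (Real.exp_pos _).le]
  have h2 : Real.exp (-x) ≤ 1 := Real.exp_le_one_iff.2 (by linarith)
  refine (mul_le_of_le_one_left (norm_nonneg _) h2).trans
    ((s.norm_term_le h0 h1 hc (hcs s) hx0.le).trans ?_)
  have h3 : lam ^ (-x) ≤ lam ^ (-b) :=
    Real.rpow_le_rpow_of_exponent_ge h0 h1 (by linarith [hx.2])
  have h4 : ((stripIndex (s : ℂ) : ℝ) + 1) ^ (-(1 + x)) ≤
      ((stripIndex (s : ℂ) : ℝ) + 1) ^ (-(1 + a)) :=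
    Real.rpow_le_rpow_of_exponent_le (le_add_of_nonneg_left (by positivity)) (by linarith [hx.1])
  gcongr

theorem continuousOn_rootSum (h0 : 0 < lam) (h1 : lam ≤ 1) : ContinuousOn (rootSum lam) (Ioi 0) := by
  intro x hx
  have hx' : 0 < x := hx
  obtain ⟨B, hB, hle⟩ := exists_uniform_bound h0 h1 (a := x / 2) (b := x + 1) (by linarith)
  have hcont : ContinuousOn (rootSum lam) (Icc (x / 2) (x + 1)) := by
    refine continuousOn_tsum (fun s => ?_) hB hle
    fun_prop
  exact (hcont.continuousAt (Icc_mem_nhds (by linarith) (by linarith))).continuousWithinAt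

/-- Each term solves the delay equation, because `(s - 1) e^{s-1} = -1/(λe)`; dominated convergence
on a compact part of `(0, ∞)` sums the terms. -/
theorem rootSum_sub (h0 : 0 < lam) (h1 : lam ≤ 1) {y x : ℝ} (hy : 1 < y) (hyx : y ≤ x) :
    rootSum lam x - rootSum lam y =
      -((lam : ℂ) * Real.exp 1)⁻¹ * ∫ u in (y - 1)..(x - 1), rootSum lam u := by
  have := countable h0 h1
  obtain ⟨B, hB, hle⟩ := exists_uniform_bound h0 h1 (a := y - 1) (b := x - 1) (by linarith)
  have hmem : ∀ {u}, u ∈ uIoc (y - 1) (x - 1) → u ∈ Icc (y - 1) (x - 1) := fun hu => by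
    rw [uIoc_of_le (by linarith)] at hu
    exact Ioc_subset_Icc_self hu
  have hint := intervalIntegral.hasSum_integral_of_dominated_convergence (μ := volume)
    (a := y - 1) (b := x - 1) (f := rootSum lam)
    (F := fun (s : TauZero lam) (u : ℝ) => Complex.exp (((s : ℂ) - 1) * u) / s)
    (fun s _ => B s) (fun s => Continuous.aestronglyMeasurable (by fun_prop))
    (fun s => Filter.Eventually.of_forall fun u hu => hle s u (hmem hu))
    (Filter.Eventually.of_forall fun u _ => hB) intervalIntegrable_const
    (Filter.Eventually.of_forall fun u hu =>
      (summable_exp_sub_one h0 h1 (by linarith [(hmem hu).1])).hasSum)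
  have hterm : ∀ s : TauZero lam, -((lam : ℂ) * Real.exp 1)⁻¹ *
      ∫ u in (y - 1)..(x - 1), Complex.exp (((s : ℂ) - 1) * u) / s =
      Complex.exp (((s : ℂ) - 1) * x) / s - Complex.exp (((s : ℂ) - 1) * y) / s := by
    intro s
    have hs := s.mul_exp_eq h0
    have hs1 : (s : ℂ) - 1 ≠ 0 := fun h => by
      have := s.exp_mul_one_sub h0
      rw [← neg_sub, h] at this
      simp at this
    have hs0 := s.2.2
    rw [intervalIntegral.integral_div, integral_exp_mul_complex hs1]
    have ht : -((lam : ℂ) * Real.exp 1)⁻¹ = ((s : ℂ) - 1) * Complex.exp ((s : ℂ) - 1) := by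
      rw [hs]; push_cast; rw [mul_comm]
    have hexp : ∀ r : ℝ, Complex.exp (((s : ℂ) - 1) * r) =
        Complex.exp ((s : ℂ) - 1) * Complex.exp (((s : ℂ) - 1) * (r - 1 : ℝ)) := by
      intro r
      rw [← Complex.exp_add]
      congr 1
      push_cast
      ring
    rw [ht, hexp x, hexp y]
    field_simp
  have h2 := (hint.mul_left (-((lam : ℂ) * Real.exp 1)⁻¹))
  simp_rw [hterm] at h2
  have h3 := (summable_exp_sub_one h0 h1 (by linarith : 0 < x)).hasSum.sub
    (summable_exp_sub_one h0 h1 (by linarith : 0 < y)).hasSum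
  exact h3.unique h2

/-- An expansion valid on `(0, 1]` extends to `(0, ∞)`. -/
theorem hasSum_of_hasSum_le_one (h0 : 0 < lam) (h1 : lam ≤ 1) {W : ℝ → ℂ} (hW : Continuous W)
    (hWd : ∀ y x, 1 < y → y ≤ x → W x - W y =
      -((lam : ℂ) * Real.exp 1)⁻¹ * ∫ u in (y - 1)..(x - 1), W u)
    (h : ∀ x : ℝ, 0 < x → x ≤ 1 → HasSum (fun s : TauZero lam => Complex.exp ((s : ℂ) * x) / s)
      (Real.exp x - Real.exp x * W x)) {x : ℝ} (hx : 0 < x) :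
    HasSum (fun s : TauZero lam => Complex.exp ((s : ℂ) * x) / s)
      (gFun lam x - Real.exp x * W x) := by
  set t : ℂ := -((lam : ℂ) * Real.exp 1)⁻¹ with ht
  have hee : ∀ x : ℝ, (Real.exp (-x) : ℂ) * Real.exp x = 1 := fun x => by
    rw [← Complex.ofReal_mul, ← Real.exp_add]; simp
  have hD := continuous_delayExp t
  have hroot := continuousOn_rootSum h0 h1
  have hv := eq_zero_of_delay (v := fun x => delayExp t x - W x - rootSum lam x) (t := t)
    ((hD.sub hW).continuousOn.sub hroot) ?_ ?_ x hx
  · have h2 : ∑' s : TauZero lam, Complex.exp ((s : ℂ) * x) / s = gFun lam x - Real.exp x * W x := by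
      rw [gFun_eq_exp_mul_delayExp _ hx.le, ← ht, show delayExp t x = W x + rootSum lam x by
        linear_combination hv, rootSum_eq]
      linear_combination (-∑' s : TauZero lam, Complex.exp ((s : ℂ) * x) / s) * hee x
    rw [← h2]
    exact (summable_exp_div h0 h1 hx).hasSum
  · intro x hx hx1
    rw [delayExp_of_le_one t hx1, rootSum_eq, (h x hx hx1).tsum_eq]
    linear_combination (-1 + W x) * hee x
  · intro y x hy hyx
    have hi : IntervalIntegrable (rootSum lam) volume (y - 1) (x - 1) := by
      refine (hroot.mono fun u hu => ?_).intervalIntegrable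
      rw [uIcc_of_le (by linarith)] at hu
      exact lt_of_lt_of_le (by linarith) hu.1
    rw [intervalIntegral.integral_sub
      (f := fun u => delayExp t u - W u) ((hD.sub hW).intervalIntegrable _ _) hi,
      intervalIntegral.integral_sub (hD.intervalIntegrable _ _) (hW.intervalIntegrable _ _)]
    have e1 := delayExp_sub t hy.le (hy.le.trans hyx)
    have e2 := hWd y x hy hyx
    have e3 := rootSum_sub h0 h1 hy hyx
    linear_combination e1 - e2 - e3

theorem hasSum_of_lt_one (h0 : 0 < lam) (h1 : lam < 1) {x : ℝ} (hx : 0 < x) :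
    HasSum (fun s : TauZero lam => Complex.exp ((s : ℂ) * x) / s) (gFun lam x) := by
  have := hasSum_of_hasSum_le_one h0 h1.le (W := fun _ => 0) continuous_const (by simp) ?_ hx
  · simpa using this
  · intro u hu0 hu1
    have hτ : tauFun lam 0 ≠ 0 := by
      intro h
      simp only [tauFun, Complex.exp_zero, zero_mul, add_zero, sub_eq_zero] at h
      have hl : (lam : ℂ) ≠ 0 := by exact_mod_cast h0.ne'
      rw [div_eq_one_iff_eq hl] at h
      exact h1.ne' (by exact_mod_cast h)
    have h2 := hasSum_of_principal_part h0 h1.le hu0 hu1 (P := fun _ => 0) (B := 0)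
      (fun z _ => differentiableAt_const _) ?_ (by simp)
    · simpa using h2
    · have hc : ContinuousAt (fun z : ℂ => z * (Complex.exp (z * u) / tauFun lam z - 0)) 0 := by
        refine continuousAt_id.mul (ContinuousAt.sub (ContinuousAt.div (by fun_prop)
          (continuous_tauFun lam).continuousAt hτ) continuousAt_const)
      have h3 := hc.tendsto
      rw [zero_mul] at h3
      exact h3.mono_left nhdsWithin_le_nhds

/-! ### The double zero of `τ` at the origin for `λ = 1`. -/

theorem tendsto_tauFun_one_sub_div :
    Filter.Tendsto (fun z => (tauFun 1 z - z ^ 2 / 2 - z ^ 3 / 3) / z ^ 3) (nhdsWithin 0 {0}ᶜ)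
      (nhds 0) := by
  have h1 := (Complex.exp_sub_sum_range_isBigO_pow 4).trans_isLittleO
    (Asymptotics.isLittleO_pow_pow (𝕜 := ℂ) (show 3 < 4 by norm_num))
  have h2 := (h1.tendsto_div_nhds_zero.mono_left (nhdsWithin_le_nhds (s := ({0} : Set ℂ)ᶜ)))
  have hid : Filter.Tendsto (fun z : ℂ => z) (nhdsWithin 0 {0}ᶜ) (nhds 0) :=
    Filter.tendsto_id.mono_left nhdsWithin_le_nhds
  have h3 := ((hid.sub_const 1).mul h2).add (hid.div_const 6)
  rw [mul_zero, zero_div, add_zero] at h3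
  refine h3.congr' ?_
  filter_upwards [self_mem_nhdsWithin] with z hz
  have hz0 : z ≠ 0 := hz
  simp only [tauFun, Finset.sum_range_succ, Finset.sum_range_zero, Nat.factorial]
  push_cast
  field_simp
  ring

/-- From `τ = z²/2 + z³/3 + ⋯` follows `1/τ = (2/z²)(1 - 2z/3 + ⋯)`; multiply by `1 + zu + ⋯`. At `z
= 1` the principal part is `2(u + 1/3)`. -/
theorem tendsto_principal_part_one (u : ℂ) :
    Filter.Tendsto (fun z => z * (Complex.exp (z * u) / tauFun 1 z -
      (2 / z ^ 2 + (2 * u - 4 / 3) / z))) (nhdsWithin 0 {0}ᶜ) (nhds 0) := by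
  have ha := tendsto_tauFun_one_sub_div
  have hid : Filter.Tendsto (fun z : ℂ => z) (nhdsWithin 0 {0}ᶜ) (nhds 0) :=
    Filter.tendsto_id.mono_left nhdsWithin_le_nhds
  have hb : Filter.Tendsto (fun z : ℂ => (Complex.exp (z * u) - 1 - z * u) / z)
      (nhdsWithin 0 {0}ᶜ) (nhds 0) := by
    have hd : HasDerivAt (fun z : ℂ => Complex.exp (z * u)) u 0 := by
      have := ((hasDerivAt_id (0 : ℂ)).mul_const u).cexp
      simpa using this
    have h2 := (hasDerivAt_iff_tendsto_slope.1 hd).sub_const u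
    rw [sub_self] at h2
    refine h2.congr' ?_
    filter_upwards [self_mem_nhdsWithin] with z hz
    have hz0 : z ≠ 0 := hz
    rw [slope_def_field]
    simp only [zero_mul, Complex.exp_zero, sub_zero]
    field_simp
  set κ : ℂ := 2 * u - 4 / 3 with hκ
  have hnum := (hb.sub ((hid.const_mul (κ / 3)))).sub (((hid.const_mul κ).const_add 2).mul ha)
  have hden := ((hid.div_const 3).const_add (1 / 2)).add (hid.mul ha)
  have hq := hnum.div hden (by norm_num)
  simp only [mul_zero, sub_zero, zero_div] at hq
  have hne : ∀ᶠ z in nhdsWithin (0 : ℂ) {0}ᶜ, 1 / 2 + z / 3 +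
      z * ((tauFun 1 z - z ^ 2 / 2 - z ^ 3 / 3) / z ^ 3) ≠ 0 :=
    hden.eventually_ne (by norm_num)
  refine hq.congr' ?_
  filter_upwards [self_mem_nhdsWithin, hne] with z hz hz2
  have hz0 : z ≠ 0 := hz
  have hτ : 1 / 2 + z / 3 + z * ((tauFun 1 z - z ^ 2 / 2 - z ^ 3 / 3) / z ^ 3) =
      tauFun 1 z / z ^ 2 := by
    field_simp
    ring
  simp only [Pi.div_apply] at *
  rw [hτ] at hz2 ⊢
  have hτ0 : tauFun 1 z ≠ 0 := fun h => hz2 (by rw [h, zero_div])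
  rw [hκ]
  field_simp
  ring

theorem hasSum_one {x : ℝ} (hx : 0 < x) :
    HasSum (fun s : TauZero 1 => Complex.exp ((s : ℂ) * x) / s)
      (gFun 1 x - 2 * ((x : ℂ) + 1 / 3)) := by
  have hee : ∀ x : ℝ, (Real.exp x : ℂ) * Real.exp (-x) = 1 := fun x => by
    rw [← Complex.ofReal_mul, ← Real.exp_add]; simp
  have := hasSum_of_hasSum_le_one one_pos le_rfl
    (W := fun x => (Real.exp (-x) : ℂ) * (2 * ((x : ℂ) + 1 / 3))) (by fun_prop) ?_ ?_ hx
  · rw [← mul_assoc, hee, one_mul, Complex.ofReal_one] at this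
    exact this
  · intro y x hy hyx
    -- An explicit antiderivative: shifting its argument by `1` turns `2u + 8/3` into `2u + 2/3`, so
    -- the contribution of the root `0` solves the same delay equation.
    have hd : ∀ u : ℝ, HasDerivAt (fun u : ℝ => -((Real.exp (-u) : ℂ) * (2 * u + 8 / 3)))
        ((Real.exp (-u) : ℂ) * (2 * ((u : ℂ) + 1 / 3))) u := by
      intro u
      have e1 : HasDerivAt (fun u : ℝ => (Real.exp (-u) : ℂ)) (-(Real.exp (-u) : ℂ)) u := by
        have := ((hasDerivAt_neg u).exp).ofReal_comp
        simpa using this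
      have e2 : HasDerivAt (fun u : ℝ => (2 * (u : ℂ) + 8 / 3)) 2 u := by
        have := (((hasDerivAt_id u).ofReal_comp).const_mul (2 : ℂ)).add_const (8 / 3)
        simpa using this
      refine (e1.mul e2).neg.congr_deriv ?_
      ring
    rw [intervalIntegral.integral_eq_sub_of_hasDerivAt (fun u _ => hd u)
      (Continuous.intervalIntegrable (by fun_prop) _ _)]
    have e3 : ∀ r : ℝ, (Real.exp (-(r - 1)) : ℂ) = Real.exp 1 * Real.exp (-r) := fun r => by
      rw [← Complex.ofReal_mul, ← Real.exp_add]; congr 2; ring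
    have he : (Real.exp 1 : ℂ) ≠ 0 := by exact_mod_cast (Real.exp_pos 1).ne'
    rw [e3, e3, Complex.ofReal_one, one_mul]
    field_simp
    push_cast
    ring
  · intro u hu0 hu1
    have h2 := hasSum_of_principal_part one_pos le_rfl hu0 hu1
      (P := fun z => 2 / z ^ 2 + (2 * (u : ℂ) - 4 / 3) / z) (B := 2 + ‖2 * (u : ℂ) - 4 / 3‖)
      (fun z hz => by fun_prop (disch := simpa using hz)) (tendsto_principal_part_one u) ?_
    · rw [← mul_assoc, hee, one_mul]
      convert h2 using 1
      push_cast
      ring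
    · intro z hz
      have hz0 : 0 < ‖z‖ := by linarith
      refine (norm_add_le _ _).trans ?_
      rw [norm_div, norm_div, norm_pow, add_div]
      gcongr
      · simp
      · nlinarith

end TauZero

/-! ### Asymptotics of the first zero -/

/-- The real part of the root `1 + lambertPoint η` of `τ`. -/
noncomputable def rootRe (η : ℝ) : ℝ := 1 - η * Real.cos η / Real.sin η

/-- The phase of the leading term of the expansion. -/
noncomputable def rootPhase (η : ℝ) : ℝ := Real.arctan (rootRe η / η)

theorem rootRe_nonneg {η : ℝ} (h0 : 0 < η) (h1 : η ≤ 1) : 0 ≤ rootRe η := by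
  have hs : 0 < Real.sin η := Real.sin_pos_of_pos_of_le_one h0 h1
  have hpi := Real.pi_gt_three
  have hc : 0 < Real.cos η := Real.cos_pos_of_mem_Ioo ⟨by linarith, by linarith⟩
  have ht := Real.lt_tan h0 (by linarith)
  rw [Real.tan_eq_sin_div_cos, lt_div_iff₀ hc] at ht
  rw [rootRe, sub_nonneg, div_le_one hs]
  exact ht.le

theorem rootRe_le {η : ℝ} (h0 : 0 < η) (h1 : η ≤ 1) : rootRe η ≤ η ^ 2 / 2 := by
  have hs : 0 < Real.sin η := Real.sin_pos_of_pos_of_le_one h0 h1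
  have hc := Real.one_sub_sq_div_two_le_cos (x := η)
  have : Real.cos η ≤ η * Real.cos η / Real.sin η := by
    rw [le_div_iff₀ hs]
    have : 0 ≤ Real.cos η := by nlinarith
    nlinarith [Real.sin_lt h0]
  rw [rootRe]
  linarith

theorem abs_rootRe_sub_le {η : ℝ} (h0 : 0 < η) (h1 : η ≤ 1) :
    |rootRe η - η ^ 2 / 3| ≤ η ^ 3 / 5 := by
  have hs : 0 < Real.sin η := Real.sin_pos_of_pos_of_le_one h0 h1
  have hηa : |η| ≤ 1 := by rwa [abs_of_pos h0]
  have hb1 := abs_le.1 (Real.cos_bound hηa)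
  have hb2 := abs_le.1 (Real.sin_bound hηa)
  rw [abs_of_pos h0] at hb1 hb2
  have hs3 := Real.sin_gt_sub_cube h0
  have hsl := Real.sin_lt h0
  have h4 : η ^ 5 ≤ η ^ 4 := pow_le_pow_of_le_one h0.le h1 (by norm_num)
  have h5 : 0 < η ^ 4 := by positivity
  have e : rootRe η - η ^ 2 / 3 =
      (Real.sin η - η * Real.cos η - η ^ 2 / 3 * Real.sin η) / Real.sin η := by
    rw [rootRe]; field_simp
  have hsin56 : 5 / 6 * η ≤ Real.sin η := by
    have : η ^ 3 ≤ η := by nlinarith [mul_nonneg h0.le (show 0 ≤ 1 - η ^ 2 by nlinarith)]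
    linarith
  have hc1 := mul_le_mul_of_nonneg_left hb1.1 h0.le
  have hc2 := mul_le_mul_of_nonneg_left hb1.2 h0.le
  have hm1 := mul_le_mul_of_nonneg_left hs3.le (show 0 ≤ η ^ 2 / 3 by positivity)
  have hm2 := mul_le_mul_of_nonneg_left hsl.le (show 0 ≤ η ^ 2 / 3 by positivity)
  have hr := mul_le_mul_of_nonneg_left hsin56 (show 0 ≤ η ^ 3 / 5 by positivity)
  rw [e, abs_div, abs_of_pos hs, div_le_iff₀ hs, abs_le]
  constructor <;> nlinarith

/-- The derivative is `η + rootRe η ^ 2 / η` with `0 ≤ rootRe η ≤ η²/2`; integrate from `0`, where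
the limit is `-1`. As `lambertLog η + 1 = δ`, this is the relation between `δ` and the frequency
`η`. -/
theorem lambertLog_bounds {η : ℝ} (h0 : 0 < η) (h1 : η ≤ 1) :
    η ^ 2 / 2 ≤ lambertLog η + 1 ∧ lambertLog η + 1 ≤ η ^ 2 / 2 + η ^ 4 / 16 := by
  have hd : ∀ x ∈ Ioc (0 : ℝ) 1, HasDerivAt lambertLog ((rootRe x ^ 2 + x ^ 2) / x) x :=
    fun x hx => hasDerivAt_lambertLog hx.1 (Real.sin_pos_of_pos_of_le_one hx.1 hx.2)
  have hpow2 : ∀ x : ℝ, HasDerivAt (fun x : ℝ => x ^ 2 / 2) x x := fun x =>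
    ((hasDerivAt_pow 2 x).div_const 2).congr_deriv (by ring)
  have hpow4 : ∀ x : ℝ, HasDerivAt (fun x : ℝ => x ^ 4 / 16) (x ^ 3 / 4) x := fun x =>
    ((hasDerivAt_pow 4 x).div_const 16).congr_deriv (by ring)
  have hd1 : ∀ x ∈ Ioc (0 : ℝ) 1, HasDerivAt (fun x => lambertLog x - x ^ 2 / 2)
      ((rootRe x ^ 2 + x ^ 2) / x - x) x := fun x hx => (hd x hx).sub (hpow2 x)
  have hd2 : ∀ x ∈ Ioc (0 : ℝ) 1, HasDerivAt (fun x => x ^ 2 / 2 + x ^ 4 / 16 - lambertLog x)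
      (x + x ^ 3 / 4 - (rootRe x ^ 2 + x ^ 2) / x) x := fun x hx =>
    ((hpow2 x).add (hpow4 x)).sub (hd x hx)
  have hm1 : MonotoneOn (fun x => lambertLog x - x ^ 2 / 2) (Ioc 0 1) := by
    refine monotoneOn_of_deriv_nonneg (convex_Ioc 0 1)
      (fun x hx => (hd1 x hx).continuousAt.continuousWithinAt)
      (fun x hx => (hd1 x (interior_subset hx)).differentiableAt.differentiableWithinAt)
      fun x hx => ?_
    have hx' := interior_subset hx
    rw [(hd1 x hx').deriv]
    have hx0 : 0 < x := hx'.1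
    have : (rootRe x ^ 2 + x ^ 2) / x - x = rootRe x ^ 2 / x := by field_simp; ring
    rw [this]
    positivity
  have hm2 : MonotoneOn (fun x => x ^ 2 / 2 + x ^ 4 / 16 - lambertLog x) (Ioc 0 1) := by
    refine monotoneOn_of_deriv_nonneg (convex_Ioc 0 1)
      (fun x hx => (hd2 x hx).continuousAt.continuousWithinAt)
      (fun x hx => (hd2 x (interior_subset hx)).differentiableAt.differentiableWithinAt)
      fun x hx => ?_
    have hx' := interior_subset hx
    rw [(hd2 x hx').deriv]
    have hx0 : 0 < x := hx'.1
    have e : x + x ^ 3 / 4 - (rootRe x ^ 2 + x ^ 2) / x =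
        ((x ^ 2 / 2) ^ 2 - rootRe x ^ 2) / x := by field_simp; ring
    rw [e]
    have := pow_le_pow_left₀ (rootRe_nonneg hx0 hx'.2) (rootRe_le hx0 hx'.2) 2
    exact div_nonneg (by linarith) hx0.le
  have hlim : Filter.Tendsto (fun ε : ℝ => ε ^ 2) (nhdsWithin 0 (Ioi 0)) (nhds 0) := by
    have : Filter.Tendsto (fun ε : ℝ => ε ^ 2) (nhds 0) (nhds (0 ^ 2)) :=
      (continuous_pow 2).tendsto 0
    rw [zero_pow two_ne_zero] at this
    exact this.mono_left nhdsWithin_le_nhds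
  have hpi := Real.pi_gt_three
  constructor
  · have : (0 : ℝ) ≤ lambertLog η + 1 - η ^ 2 / 2 := by
      have h2 : Filter.Tendsto (fun ε : ℝ => -(ε ^ 2) / 2) (nhdsWithin 0 (Ioi 0)) (nhds 0) := by
        simpa using hlim.neg.div_const 2
      refine le_of_tendsto h2 ?_
      filter_upwards [Ioo_mem_nhdsGT h0] with ε hε
      have h3 := hm1 ⟨hε.1, hε.2.le.trans h1⟩ ⟨h0, h1⟩ hε.2.le
      have h4 := neg_one_lt_lambertLog hε.1 (by linarith [hε.2])
      simp only at h3
      linarith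
    linarith
  · have : (0 : ℝ) ≤ η ^ 2 / 2 + η ^ 4 / 16 - lambertLog η - 1 := by
      have h2 : Filter.Tendsto (fun ε : ℝ => -(ε ^ 2)) (nhdsWithin 0 (Ioi 0)) (nhds 0) := by
        simpa using hlim.neg
      refine le_of_tendsto h2 ?_
      filter_upwards [Ioo_mem_nhdsGT h0] with ε hε
      have h3 := hm2 ⟨hε.1, hε.2.le.trans h1⟩ ⟨h0, h1⟩ hε.2.le
      have h4 := lambertLog_le hε.1 (hε.2.le.trans h1)
      have h5 : 0 < ε ^ 4 := by have := hε.1; positivity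
      have h6 : 0 < ε ^ 2 := by have := hε.1; positivity
      simp only at h3
      linarith
    linarith

/-- The third bound is the origin of the shift `1/3` in the first zero: `1 - η cot η = η²/3 +
O(η³)`, and the phase is close to this divided by `η`. -/
theorem rootPhase_bounds {η : ℝ} (h0 : 0 < η) (h1 : η ≤ 1 / 2) :
    0 ≤ rootPhase η ∧ rootPhase η ≤ η / 2 ∧ |rootPhase η / η - 1 / 3| ≤ η / 2 := by
  have hr0 := rootRe_nonneg h0 (by linarith)
  have hr1 := rootRe_le h0 (by linarith)
  have hr2 := abs_le.1 (abs_rootRe_sub_le h0 (by linarith))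
  set y := rootRe η / η with hy
  have hyη : y * η = rootRe η := by rw [hy]; field_simp
  have hy0 : 0 ≤ y := by positivity
  have hy1 : y ≤ η / 2 := by
    rw [hy, div_le_iff₀ h0]; nlinarith
  have hθ0 : 0 ≤ rootPhase η := Real.arctan_nonneg.2 hy0
  have hθy : rootPhase η ≤ y := by
    have := Real.le_tan hθ0 (Real.arctan_lt_pi_div_two y)
    rwa [rootPhase, Real.tan_arctan] at this
  have hθl : y * (1 - y ^ 2 / 2) ≤ rootPhase η := by
    have h2 := Real.sin_le hθ0
    have h3 : Real.sin (rootPhase η) = y * Real.cos (rootPhase η) := by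
      have h4 := Real.tan_arctan y
      rw [Real.tan_eq_sin_div_cos, div_eq_iff (Real.cos_arctan_pos y).ne'] at h4
      exact h4
    have h4 := Real.one_sub_sq_div_two_le_cos (x := rootPhase η)
    have h5 : rootPhase η ^ 2 ≤ y ^ 2 := pow_le_pow_left₀ hθ0 hθy 2
    rw [h3] at h2
    refine le_trans (mul_le_mul_of_nonneg_left ?_ hy0) h2
    linarith
  refine ⟨hθ0, hθy.trans hy1, ?_⟩
  have hyl : η * (1 / 3 - η / 5) ≤ y := by
    rw [hy, le_div_iff₀ h0]; nlinarith
  have hyu : y ≤ η * (1 / 3 + η / 5) := by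
    rw [hy, div_le_iff₀ h0]; nlinarith
  have hy3 : y * (y ^ 2 / 2) ≤ η * (η / 4) := by
    have : y ^ 2 ≤ η / 4 := by nlinarith
    nlinarith
  rw [abs_le]
  constructor
  · rw [neg_le_sub_iff_le_add, ← sub_le_iff_le_add, le_div_iff₀ h0]
    nlinarith
  · rw [sub_le_iff_le_add, div_le_iff₀ h0]
    nlinarith

/-- The modulus of the root `1 + lambertPoint η`. -/
noncomputable def rootNorm (η : ℝ) : ℝ := η / Real.cos (rootPhase η)

theorem rootNorm_polar {η : ℝ} (h0 : 0 < η) :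
    0 < rootNorm η ∧ η = rootNorm η * Real.cos (rootPhase η) ∧
      rootRe η = rootNorm η * Real.sin (rootPhase η) := by
  have hc : 0 < Real.cos (rootPhase η) := Real.cos_arctan_pos _
  have ht : Real.tan (rootPhase η) = rootRe η / η := Real.tan_arctan _
  rw [Real.tan_eq_sin_div_cos] at ht
  refine ⟨by rw [rootNorm]; positivity, by rw [rootNorm]; field_simp, ?_⟩
  rw [rootNorm]
  field_simp at ht ⊢
  linarith

theorem rootNorm_le {η : ℝ} (h0 : 0 < η) (h1 : η ≤ 1 / 2) : rootNorm η ≤ 3 / 2 * η := by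
  obtain ⟨hθ0, hθ1, -⟩ := rootPhase_bounds h0 h1
  have h2 := Real.one_sub_sq_div_two_le_cos (x := rootPhase η)
  have h3 : 2 / 3 ≤ Real.cos (rootPhase η) := by nlinarith
  rw [rootNorm, div_le_iff₀ (by linarith)]
  nlinarith

/-- The angle `θ` is measured from the imaginary axis, so twice the real part of `e^{sx}/s` is a
sine with phase shift `θ`. -/
theorem exp_div_add_conj {s : ℂ} {x σ η r θ : ℝ} (hs : s = ⟨σ, η⟩) (hr : 0 < r)
    (hη : η = r * Real.cos θ) (hσ : σ = r * Real.sin θ) :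
    Complex.exp (s * x) / s + Complex.exp ((starRingEnd ℂ) s * x) / (starRingEnd ℂ) s =
      ((2 * Real.exp (σ * x) / r * Real.sin (η * x + θ) : ℝ) : ℂ) := by
  have hconj : Complex.exp ((starRingEnd ℂ) s * x) / (starRingEnd ℂ) s =
      (starRingEnd ℂ) (Complex.exp (s * x) / s) := by
    rw [map_div₀, ← Complex.exp_conj, map_mul, Complex.conj_ofReal]
  have hre : s.re = σ := by rw [hs]
  have him : s.im = η := by rw [hs]
  have hn : Complex.normSq s = r ^ 2 := by
    rw [Complex.normSq_apply, hre, him, hη, hσ]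
    linear_combination r ^ 2 * Real.sin_sq_add_cos_sq θ
  rw [hconj, Complex.add_conj, Complex.div_re, hn, Complex.exp_re, Complex.exp_im,
    Complex.re_mul_ofReal, Complex.im_mul_ofReal, hre, him, Real.sin_add]
  congr 1
  have e : ∀ c d : ℝ, Real.exp (σ * x) * c * σ / r ^ 2 + Real.exp (σ * x) * d * η / r ^ 2 =
      Real.exp (σ * x) / r * (c * Real.sin θ + d * Real.cos θ) := by
    intro c d
    rw [← add_div, div_eq_iff (by positivity)]
    have h : c * σ + d * η = r * (c * Real.sin θ + d * Real.cos θ) := by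
      linear_combination c * hσ + d * hη
    field_simp
    linear_combination h
  rw [e]
  ring

/-- The roots of index `0` are exactly the conjugate pair given by `η`. All others satisfy `λ|s - 1|
≥ 3k` and `|s| ≥ 6k`, so they contribute at most `e^{-(x-1)}/(18k²)` each. -/
theorem abs_gFun_sub_le {lam η : ℝ} (hl0 : 1 / 2 ≤ lam) (hl1 : lam < 1) (h0 : 0 < η)
    (h1 : η ≤ 1 / 2) (hη : lambertLog η = Real.log (Real.exp 1 * lam)⁻¹) {x : ℝ} (hx : 1 ≤ x) :
    |Real.exp x * delayExp (-(lam * Real.exp 1)⁻¹) x -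
      2 * Real.exp (rootRe η * x) / rootNorm η * Real.sin (η * x + rootPhase η)| ≤
        1 / 4 * Real.exp (-(x - 1)) := by
  have hlam : 0 < lam := by linarith
  have hpi := Real.pi_gt_three
  have hmem : η ∈ Ioo (2 * ((0 : ℕ) : ℝ) * Real.pi) ((2 * ((0 : ℕ) : ℝ) + 1) * Real.pi) :=
    ⟨by simpa using h0, by simp; linarith⟩
  have hroot := lambertPoint_mul_exp (a := (Real.exp 1 * lam)⁻¹) (by positivity) hmem hη
  obtain ⟨hr, hpc, hps⟩ := rootNorm_polar h0
  set s : ℂ := 1 + lambertPoint η with hs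
  have hsre : s = ⟨rootRe η, η⟩ := by
    apply Complex.ext
    · simp only [hs, lambertPoint, rootRe, Complex.add_re, Complex.one_re]; ring
    · simp [hs, lambertPoint]
  have hsim : s.im = η := by rw [hsre]
  have hsτ : tauFun lam s = 0 := by
    rw [tauFun_eq_zero_iff hlam, hs, add_sub_cancel_left]; exact hroot
  have hs0 : s ≠ 0 := fun h => by rw [h] at hsim; exact h0.ne hsim
  set s₀ : TauZero lam := ⟨s, hsτ, hs0⟩ with hs₀
  have hidx : stripIndex s = 0 := stripIndex_eq (k := 0) (by rw [hsim, abs_of_pos h0]; exact hmem)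
  have hne : s₀ ≠ s₀.conj := by
    intro h
    have h2 := congrArg (fun t : TauZero lam => (t : ℂ).im) h
    simp only [TauZero.conj, hs₀, Complex.conj_im, hsim] at h2
    linarith
  have hf := TauZero.hasSum_of_lt_one hlam hl1 (show 0 < x by linarith)
  set f : TauZero lam → ℂ := fun s => Complex.exp ((s : ℂ) * x) / s with hfdef
  set F : TauZero lam → ℂ := fun s => if stripIndex (s : ℂ) = 0 then 0 else f s with hF
  classical
  have hf0 : HasSum (fun s : TauZero lam => if stripIndex (s : ℂ) = 0 then f s else 0)
      (f s₀ + f s₀.conj) := by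
    have h2 := hasSum_sum_of_ne_finset_zero
      (f := fun s : TauZero lam => if stripIndex (s : ℂ) = 0 then f s else 0)
      (s := {s₀, s₀.conj}) (L := SummationFilter.unconditional _) (fun t ht => by
        rw [if_neg]
        intro ht0
        refine ht ?_
        rw [Finset.mem_insert, Finset.mem_singleton]
        rcases lt_or_gt_of_ne (t.im_ne_zero hlam hl1.le) with hti | hti
        · right
          refine TauZero.injective_index hlam hl1.le (Prod.ext ?_ ?_)
          · simp [TauZero.conj, stripIndex_conj, ht0, hs₀, hidx]
          · simp only [TauZero.conj, hs₀, Complex.conj_im, hsim, decide_eq_decide]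
            constructor <;> intro <;> linarith
        · left
          refine TauZero.injective_index hlam hl1.le (Prod.ext ?_ ?_)
          · simp [ht0, hs₀, hidx]
          · simp only [hs₀, hsim, decide_eq_decide]
            exact ⟨fun _ => h0, fun _ => hti⟩)
    rw [Finset.sum_pair hne, if_pos (by simpa [hs₀] using hidx),
      if_pos (by simpa [hs₀, TauZero.conj, stripIndex_conj] using hidx)] at h2
    exact h2
  have hFsum : HasSum F (gFun lam x - (f s₀ + f s₀.conj)) := by
    refine (hf.sub hf0).congr_fun ?_
    intro t
    simp only [hF]
    split_ifs <;> simp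
  have hpair : f s₀ + f s₀.conj = _ := exp_div_add_conj (x := x) hsre hr hpc hps
  rw [hpair, gFun_ofReal_eq lam (by linarith), ← Complex.ofReal_sub] at hFsum
  have hFb : ∀ t : TauZero lam, ‖F t‖ ≤
      Real.exp (-(x - 1)) / 18 * (1 / (stripIndex (t : ℂ) : ℝ) ^ 2) := by
    intro t
    simp only [hF]
    split_ifs with ht
    · simp [ht]
    · have hk : (1 : ℝ) ≤ stripIndex (t : ℂ) := by
        exact_mod_cast Nat.one_le_iff_ne_zero.2 ht
      set k : ℝ := (stripIndex (t : ℂ) : ℝ) with hkdef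
      have hi := t.index_lt hlam hl1.le
      have hn1 : 2 * Real.pi * k ≤ ‖(t : ℂ)‖ := hi.le.trans (Complex.abs_im_le_norm _)
      have hn2 : 2 * Real.pi * k ≤ ‖(t : ℂ) - 1‖ := by
        have h2 := Complex.abs_im_le_norm ((t : ℂ) - 1)
        rw [Complex.sub_im, Complex.one_im, sub_zero] at h2
        exact hi.le.trans h2
      have hk3 : 3 * k ≤ lam * ‖(t : ℂ) - 1‖ := le_trans (by nlinarith)
        (mul_le_mul hl0 hn2 (by positivity) hlam.le)
      have hk6 : 6 * k ≤ ‖(t : ℂ)‖ := by nlinarith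
      have hexp : ‖Complex.exp ((t : ℂ) * x)‖ ≤ (3 * k)⁻¹ * Real.exp (-(x - 1)) := by
        rw [t.norm_exp_mul hlam]
        have e1 : (lam * ‖(t : ℂ) - 1‖) ^ (-x) ≤ (3 * k) ^ (-x) :=
          Real.rpow_le_rpow_of_nonpos (by positivity) hk3 (by linarith)
        refine e1.trans ?_
        rw [show -x = -1 + -(x - 1) by ring, Real.rpow_add (by positivity), Real.rpow_neg_one]
        refine mul_le_mul_of_nonneg_left ?_ (by positivity)
        have e2 : (3 * k) ^ (-(x - 1)) ≤ Real.exp 1 ^ (-(x - 1)) :=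
          Real.rpow_le_rpow_of_nonpos (Real.exp_pos 1)
            (by linarith [Real.exp_one_lt_d9]) (by linarith)
        rwa [← Real.exp_mul, one_mul] at e2
      rw [hfdef]
      simp only
      rw [norm_div]
      refine (div_le_div₀ (by positivity) hexp (by positivity) hk6).trans_eq ?_
      field_simp
      norm_num
  -- Two roots for each index `k ≥ 1`; the index `0` counts as `1/0 = 0`, in agreement with the
  -- removal of the leading pair.
  have hb : Summable fun p : ℕ × Bool => 1 / (p.1 : ℝ) ^ 2 * 1 :=
    hasSum_zeta_two.summable.mul_of_nonneg (g := fun _ : Bool => (1 : ℝ)) Summable.of_finite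
      (fun _ => by positivity) fun _ => zero_le_one
  have hbt : ∑' p : ℕ × Bool, 1 / (p.1 : ℝ) ^ 2 * 1 = Real.pi ^ 2 / 6 * 2 := by
    rw [hb.tsum_prod]
    simp only [tsum_fintype, Fintype.sum_bool]
    rw [← hasSum_zeta_two.tsum_eq, ← tsum_mul_right]
    exact tsum_congr fun k => by ring
  have hcs : Summable fun t : TauZero lam => 1 / (stripIndex (t : ℂ) : ℝ) ^ 2 := by
    simpa [Function.comp_def] using hb.comp_injective (TauZero.injective_index hlam hl1.le)
  have hct : ∑' t : TauZero lam, 1 / (stripIndex (t : ℂ) : ℝ) ^ 2 ≤ Real.pi ^ 2 / 6 * 2 := by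
    have h2 := tsum_comp_le_tsum_of_inj hb (fun _ => by positivity)
      (TauZero.injective_index hlam hl1.le)
    rw [hbt] at h2
    simpa [Function.comp_def] using h2
  have hfin : ‖∑' t, F t‖ ≤ Real.exp (-(x - 1)) / 18 * (Real.pi ^ 2 / 6 * 2) := by
    refine (tsum_of_norm_bounded ((hcs.mul_left _).hasSum) hFb).trans ?_
    rw [tsum_mul_left]
    exact mul_le_mul_of_nonneg_left hct (by positivity)
  rw [hFsum.tsum_eq, Complex.norm_real, Real.norm_eq_abs] at hfin
  refine hfin.trans ?_
  have hpi2 : Real.pi ^ 2 / 6 * 2 ≤ 9 / 2 := by nlinarith [Real.pi_lt_d2]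
  have hE := Real.exp_pos (-(x - 1))
  nlinarith

theorem half_mul_le_sin {ψ : ℝ} (h0 : 0 ≤ ψ) (h1 : ψ ≤ Real.pi / 2) : ψ / 2 ≤ Real.sin ψ := by
  have h := Real.mul_le_sin h0 h1
  have hpi : 1 / 2 ≤ 2 / Real.pi := by
    rw [le_div_iff₀ Real.pi_pos]; linarith [Real.pi_le_four]
  nlinarith

/-- The first zero of `g`, up to an error of order `η`. -/
theorem exists_least_zero {lam η : ℝ} (hl0 : 1 / 2 ≤ lam) (hl1 : lam < 1) (h0 : 0 < η)
    (h1 : η ≤ 1 / 2) (hη : lambertLog η = Real.log (Real.exp 1 * lam)⁻¹) :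
    ∃ z : ℝ, 1 < z ∧ delayExp (-(lam * Real.exp 1)⁻¹) z = 0 ∧
      (∀ x, x < z → 0 < delayExp (-(lam * Real.exp 1)⁻¹) x) ∧
      |z - (Real.pi - rootPhase η) / η| ≤ 2 * η := by
  set D := delayExp (-(lam * Real.exp 1)⁻¹) with hD
  have hDc : Continuous D := continuous_delayExp _
  have hpi := Real.pi_gt_three
  obtain ⟨hθ0, hθ1, -⟩ := rootPhase_bounds h0 h1
  set θ := rootPhase η with hθ
  obtain ⟨hr, -, -⟩ := rootNorm_polar h0
  have hr2 := rootNorm_le h0 h1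
  have hσ := rootRe_nonneg h0 (by linarith)
  have happ := fun {x : ℝ} (hx : 1 ≤ x) => abs_le.1 (abs_gFun_sub_le hl0 hl1 h0 h1 hη hx)
  have hlead : ∀ x : ℝ, 1 ≤ x → 4 / (3 * η) ≤ 2 * Real.exp (rootRe η * x) / rootNorm η := by
    intro x hx
    have hE : 1 ≤ Real.exp (rootRe η * x) := Real.one_le_exp (by positivity)
    rw [div_le_div_iff₀ (by positivity) hr]
    nlinarith
  have hsmall : ∀ x : ℝ, 1 / η ≤ x → 1 / 4 * Real.exp (-(x - 1)) ≤ 3 / 4 * η := by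
    intro x hx
    have e1 : Real.exp (-(x - 1)) ≤ Real.exp 1 * Real.exp (-(1 / η)) := by
      rw [← Real.exp_add]; exact Real.exp_le_exp.2 (by linarith)
    have e2 : Real.exp (-(1 / η)) ≤ η := by
      rw [Real.exp_neg, inv_le_comm₀ (Real.exp_pos _) h0, ← one_div]
      linarith [Real.add_one_le_exp (1 / η)]
    have e3 : Real.exp 1 ≤ 3 := by linarith [Real.exp_one_lt_d9]
    have e4 := Real.exp_pos (-(1 / η))
    nlinarith
  -- In the first half of the arch the leading term is at least `2/3`, against an error of at most
  -- `1/4`. In the second half `x ≥ 1/η`, which makes the error at most `3η/4`, against a leading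
  -- term of at least `4η/3`.
  have hpos : ∀ x : ℝ, η * x + θ < Real.pi - 2 * η ^ 2 → 0 < D x := by
    intro x hx
    rcases le_total x 1 with hx1 | hx1
    · rw [hD, delayExp_of_le_one _ hx1]; exact one_pos
    have hψ0 : 0 ≤ η * x + θ := by positivity
    have hmain : 1 / 4 * Real.exp (-(x - 1)) <
        2 * Real.exp (rootRe η * x) / rootNorm η * Real.sin (η * x + θ) := by
      rcases le_total (η * x + θ) (Real.pi / 2) with h | h
      · have hs := half_mul_le_sin hψ0 h
        have hs' : η / 2 ≤ Real.sin (η * x + θ) := by nlinarith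
        have h2 := mul_le_mul (hlead x hx1) hs' (by positivity)
          ((by positivity : (0 : ℝ) ≤ 4 / (3 * η)).trans (hlead x hx1))
        have h3 : 4 / (3 * η) * (η / 2) = 2 / 3 := by field_simp; norm_num
        have h4 : Real.exp (-(x - 1)) ≤ 1 := Real.exp_le_one_iff.2 (by linarith)
        linarith
      · have hs := half_mul_le_sin (ψ := Real.pi - (η * x + θ))
          (by nlinarith) (by linarith)
        rw [Real.sin_pi_sub] at hs
        have hs' : η ^ 2 ≤ Real.sin (η * x + θ) := by nlinarith
        have h2 := mul_le_mul (hlead x hx1) hs' (by positivity)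
          ((by positivity : (0 : ℝ) ≤ 4 / (3 * η)).trans (hlead x hx1))
        have h3 : 4 / (3 * η) * η ^ 2 = 4 / 3 * η := by field_simp
        have h4 : 1 / η ≤ x := by
          rw [div_le_iff₀ h0]; linarith
        linarith [hsmall x h4]
    have hG := (happ hx1).1
    exact (pos_iff_pos_of_mul_pos (show 0 < Real.exp x * D x by linarith)).1 (Real.exp_pos x)
  -- The point where the phase has passed `π` by `2η²`; there the leading term is at most `-4η/3`.
  set b := (Real.pi - θ + 2 * η ^ 2) / η with hb
  have hbη : η * b + θ = Real.pi + 2 * η ^ 2 := by rw [hb]; field_simp; ring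
  have hb1 : 1 / η ≤ b := by
    rw [hb]
    exact div_le_div_of_nonneg_right (by nlinarith) h0.le
  have hb2 : 2 ≤ b := le_trans (by rw [le_div_iff₀ h0]; linarith) hb1
  have hneg : D b < 0 := by
    have hs := half_mul_le_sin (ψ := 2 * η ^ 2) (by positivity) (by nlinarith)
    have hsin : Real.sin (η * b + θ) ≤ -(η ^ 2) := by
      rw [hbη, add_comm, Real.sin_add_pi]; linarith
    have h2 := mul_le_mul (hlead b (by linarith)) (show η ^ 2 ≤ -Real.sin (η * b + θ) by linarith)
      (by positivity) ((by positivity : (0 : ℝ) ≤ 4 / (3 * η)).trans (hlead b (by linarith)))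
    have h3 : 4 / (3 * η) * η ^ 2 = 4 / 3 * η := by field_simp
    have hG := (happ (show 1 ≤ b by linarith)).2
    have hlt : Real.exp b * D b < 0 := by linarith [hsmall b hb1]
    by_contra! hcon
    exact absurd hlt (not_lt.2 (mul_nonneg (Real.exp_pos b).le hcon))
  have hD1 : D 1 = 1 := delayExp_of_le_one _ le_rfl
  obtain ⟨y, hy, hy0⟩ := intermediate_value_Icc' (show (1 : ℝ) ≤ b by linarith) hDc.continuousOn
    (show (0 : ℝ) ∈ Icc (D b) (D 1) from ⟨hneg.le, by rw [hD1]; exact zero_le_one⟩)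
  have hZc : IsCompact (Icc 1 b ∩ {x | D x = 0}) :=
    isCompact_Icc.inter_right (isClosed_eq hDc continuous_const)
  obtain ⟨z, ⟨hzI, hz0⟩, hzmin⟩ := hZc.exists_isLeast ⟨y, hy, hy0⟩
  have hz0' : D z = 0 := hz0
  have hz1 : 1 < z := lt_of_le_of_ne hzI.1 fun h => by
    rw [← h, hD1] at hz0'; exact one_ne_zero hz0'
  refine ⟨z, hz1, hz0', fun x hx => delayExp_pos_of_ne_zero (fun u _ huz hu0 => ?_) hx, ?_⟩
  · have hu1 : 1 ≤ u := by
      by_contra! h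
      rw [delayExp_of_le_one _ h.le] at hu0
      exact one_ne_zero hu0
    exact absurd (hzmin ⟨⟨hu1, huz.le.trans hzI.2⟩, hu0⟩) (not_le.2 huz)
  · have hlow : Real.pi - 2 * η ^ 2 ≤ η * z + θ := by
      by_contra! h
      exact (hpos z h).ne' hz0'
    have e1 : (Real.pi - θ) / η * η = Real.pi - θ := by field_simp
    have hzb := hzI.2
    have e2 : b = (Real.pi - θ) / η + 2 * η := by rw [hb]; field_simp
    rw [abs_le]
    constructor
    · by_contra! h
      nlinarith
    · linarith

/-- The location of the first zero for `λ = e^{-δ}`. -/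
theorem exists_least_zero_exp {δ : ℝ} (h0 : 0 < δ) (h1 : δ < 1 / 8) :
    ∃ z : ℝ, 1 < z ∧ delayExp (-(Real.exp (-δ) * Real.exp 1)⁻¹) z = 0 ∧
      (∀ x, x < z → 0 < delayExp (-(Real.exp (-δ) * Real.exp 1)⁻¹) x) ∧
      |z - (Real.pi / Real.sqrt (2 * δ) - 1 / 3)| ≤ 5 * Real.sqrt δ := by
  have hpi := Real.pi_gt_three
  have hlog : Real.log (Real.exp 1 * Real.exp (-δ))⁻¹ = δ - 1 := by
    rw [← Real.exp_add, ← Real.exp_neg, Real.log_exp]; ring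
  obtain ⟨η, hmem, hη⟩ := exists_lambertLog_eq (k := 0) (b := δ - 1) (Or.inr (by linarith))
  have hη0 : 0 < η := pos_of_mem_branch hmem
  -- The bound `1/8` on `δ` comes from `lambertLog (1/2) + 1 ≥ 1/8`.
  have hη1 : η ≤ 1 / 2 := by
    by_contra! h
    have h2 : (1 / 2 : ℝ) ∈ Ioo (2 * ((0 : ℕ) : ℝ) * Real.pi) ((2 * ((0 : ℕ) : ℝ) + 1) * Real.pi) :=
      ⟨by norm_num, by simp; linarith⟩
    have h3 := strictMonoOn_lambertLog 0 h2 hmem h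
    have h4 := (lambertLog_bounds (η := 1 / 2) (by norm_num) (by norm_num)).1
    rw [hη] at h3
    norm_num at h4
    linarith
  have hlam0 : 1 / 2 ≤ Real.exp (-δ) := by
    linarith [Real.add_one_le_exp (-δ)]
  have hlam1 : Real.exp (-δ) < 1 := Real.exp_lt_one_iff.2 (by linarith)
  obtain ⟨z, hz1, hz0, hzpos, hz⟩ := exists_least_zero hlam0 hlam1 hη0 hη1 (by rw [hη, hlog])
  refine ⟨z, hz1, hz0, hzpos, ?_⟩
  obtain ⟨hd1, hd2⟩ := lambertLog_bounds hη0 (by linarith)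
  rw [hη] at hd1 hd2
  obtain ⟨-, -, hθ⟩ := rootPhase_bounds hη0 hη1
  set ε := Real.sqrt (2 * δ) with hε
  have hε2 : ε ^ 2 = 2 * δ := Real.sq_sqrt (by linarith)
  have hεpos : 0 < ε := Real.sqrt_pos.2 (by linarith)
  have hηε : η ≤ ε := Real.le_sqrt_of_sq_le (by linarith)
  have hdiff : ε - η ≤ η ^ 3 / 16 := by
    have : (ε - η) * (2 * η) ≤ η ^ 4 / 8 := by nlinarith
    by_contra! h
    nlinarith
  -- Replacing `η` by `ε = √(2δ)` costs `O(η)` because their difference is `O(η³)`; together with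
  -- the phase error this is at most `η`, and `2η + η ≤ 5√δ`.
  have e1 : (Real.pi - rootPhase η) / η - (Real.pi / ε - 1 / 3) =
      Real.pi * ((ε - η) / (ε * η)) - (rootPhase η / η - 1 / 3) := by
    field_simp
    ring
  have e2 : (ε - η) / (ε * η) ≤ η / 16 := by
    rw [div_le_iff₀ (by positivity)]
    nlinarith [mul_le_mul_of_nonneg_left hηε (show 0 ≤ η ^ 2 / 16 by positivity)]
  have e3 : 0 ≤ (ε - η) / (ε * η) := div_nonneg (by linarith) (by positivity)
  have e4 : |(Real.pi - rootPhase η) / η - (Real.pi / ε - 1 / 3)| ≤ η := by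
    rw [e1]
    have := abs_le.1 hθ
    have hpi4 := Real.pi_le_four
    rw [abs_le]
    constructor <;> nlinarith
  have e5 : ε ≤ 3 / 2 * Real.sqrt δ := by
    rw [hε]
    refine Real.sqrt_le_iff.2 ⟨by positivity, ?_⟩
    rw [mul_pow, Real.sq_sqrt h0.le]
    linarith
  have e6 := abs_sub_le z ((Real.pi - rootPhase η) / η) (Real.pi / ε - 1 / 3)
  have e7 := Real.sqrt_nonneg δ
  linarith

/-! ### From the first zero to the interval length and back. -/

theorem isPrincipalEigenvalue_exp_iff {δ z : ℝ}
    (hz0 : delayExp (-(Real.exp (-δ) * Real.exp 1)⁻¹) z = 0)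
    (hzpos : ∀ x, x < z → 0 < delayExp (-(Real.exp (-δ) * Real.exp 1)⁻¹) x) {H : ℝ} (hH : 0 < H) :
    IsPrincipalEigenvalue oneMinusExpDensity H (Real.exp (-δ)) ↔ H = z - 1 := by
  rw [isPrincipalEigenvalue_iff_isLeast hH (Real.exp_pos _), isLeast_zero_iff hH.le]
  constructor
  · rintro ⟨h1, h2⟩
    rcases lt_trichotomy (H + 1) z with h | h | h
    · exact absurd h1 (hzpos _ h).ne'
    · linarith
    · exact absurd hz0 (h2 _ h).ne'
  · rintro rfl
    rw [sub_add_cancel]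
    exact ⟨hz0, hzpos⟩

theorem principal_interval_asymptotics {δ : ℝ} (h0 : 0 < δ) (h1 : δ < 1 / 8) :
    (∃! H : ℝ, 0 < H ∧ IsPrincipalEigenvalue oneMinusExpDensity H (Real.exp (-δ))) ∧
      ∀ H : ℝ, 0 < H → IsPrincipalEigenvalue oneMinusExpDensity H (Real.exp (-δ)) →
        |H - (Real.pi / Real.sqrt (2 * δ) - 4 / 3)| ≤ 5 * Real.sqrt δ := by
  obtain ⟨z, hz1, hz0, hzpos, hz⟩ := exists_least_zero_exp h0 h1
  refine ⟨⟨z - 1, ⟨by linarith, (isPrincipalEigenvalue_exp_iff hz0 hzpos (by linarith)).2 rfl⟩,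
    fun H hH => (isPrincipalEigenvalue_exp_iff hz0 hzpos hH.1).1 hH.2⟩, fun H hH h => ?_⟩
  rw [(isPrincipalEigenvalue_exp_iff hz0 hzpos hH).1 h]
  refine le_of_eq_of_le ?_ hz
  congr 1
  ring

theorem principal_eigenvalue_asymptotics :
    ∃ C H₀ : ℝ, 0 < C ∧ 0 < H₀ ∧ ∀ H : ℝ, H₀ ≤ H → ∀ δ : ℝ,
      IsPrincipalEigenvalue oneMinusExpDensity H (Real.exp (-δ)) →
        ∃ r : ℝ, |r| ≤ C / H ^ 2 ∧
          δ = Real.pi ^ 2 / 2 * ((1 + r) / (H + 4 / 3) ^ 2) := by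
  have hpi := Real.pi_gt_three
  obtain ⟨H₁, ⟨hH₁, hp₁⟩, -⟩ := (principal_interval_asymptotics
    (δ := 1 / 200) (by norm_num) (by norm_num)).1
  refine ⟨80, max H₁ 1, by norm_num, lt_max_of_lt_left hH₁, fun H hH δ hδ => ?_⟩
  have hHH₁ : H₁ ≤ H := (le_max_left _ _).trans hH
  have hH0 : 0 < H := hH₁.trans_le hHH₁
  have hδ0 : 0 < δ := by
    have := hδ.lt_one hH0
    rw [Real.exp_lt_one_iff] at this
    linarith
  -- Monotonicity of the principal eigenvalue in `H` shows that `δ` is small for every long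
  -- interval, so that the asymptotics in `δ` become available.
  have hδ1 : δ ≤ 1 / 200 := by
    have := hp₁.mono hH₁ hHH₁ hδ
    rw [Real.exp_le_exp] at this
    linarith
  have hasym := (principal_interval_asymptotics hδ0 (by linarith)).2 H hH0 hδ
  set ε := Real.sqrt (2 * δ) with hε
  have hε2 : ε ^ 2 = 2 * δ := Real.sq_sqrt (by linarith)
  have hεpos : 0 < ε := Real.sqrt_pos.2 (by linarith)
  have hε1 : ε ≤ 1 / 10 := Real.sqrt_le_iff.2 ⟨by norm_num, by linarith⟩
  have hsq : Real.sqrt δ ≤ ε := Real.sqrt_le_sqrt (by linarith)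
  set X := H + 4 / 3 with hX
  have hX0 : 0 < X := by linarith
  have h2 : |X * ε - Real.pi| ≤ 5 * ε ^ 2 := by
    have e : X * ε - Real.pi = (H - (Real.pi / ε - 4 / 3)) * ε := by
      rw [hX]; field_simp; ring
    rw [e, abs_mul, abs_of_pos hεpos]
    nlinarith
  have h3 := abs_le.1 h2
  have hpi4 := Real.pi_lt_d2
  have hXε : X * ε ≤ 4 := by nlinarith
  have hXε0 : 0 < X * ε := by positivity
  -- With `Xε = π + O(ε²)` and `ε² = 2δ`, the relative error of `δ` is that of `(Xε)²`, and `ε =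
  -- O(1/H)`.
  have hr : |(X * ε) ^ 2 - Real.pi ^ 2| ≤ 40 * ε ^ 2 := by
    rw [sq_sub_sq, abs_mul, abs_of_pos (by positivity : 0 < X * ε + Real.pi)]
    have := mul_le_mul (show X * ε + Real.pi ≤ 8 by linarith) h2 (abs_nonneg _) (by norm_num)
    linarith
  refine ⟨((X * ε) ^ 2 - Real.pi ^ 2) / Real.pi ^ 2, ?_, ?_⟩
  · rw [abs_div, abs_of_pos (by positivity : 0 < Real.pi ^ 2), div_le_div_iff₀ (by positivity)
      (by positivity)]
    have hHX : (H * ε) ^ 2 ≤ 16 := by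
      have : H * ε ≤ 4 := le_trans (mul_le_mul_of_nonneg_right (by linarith) hεpos.le) hXε
      have h0 : 0 ≤ H * ε := by positivity
      nlinarith
    have h4 := mul_le_mul_of_nonneg_right hr (show 0 ≤ H ^ 2 by positivity)
    nlinarith
  · rw [show δ = ε ^ 2 / 2 by linarith]
    field_simp
    ring

theorem principal_eigenvalue_exp_asymptotics :
    ∃ C A₀ : ℝ, 0 < C ∧ 0 < A₀ ∧ ∀ A : ℝ, A₀ ≤ A → ∀ lam : ℝ,
      IsPrincipalEigenvalue oneMinusExpDensity A lam →
        ∃ r : ℝ, |r| ≤ C / A ^ 3 ∧ lam = Real.exp (-(Real.pi ^ 2 / (2 * A ^ 2)) + r) := by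
  obtain ⟨C, H₀, hC, hH₀, h⟩ := principal_eigenvalue_asymptotics
  refine ⟨8 * (C + 5), max H₀ 1, by positivity, lt_max_of_lt_left hH₀, fun A hA lam hlam => ?_⟩
  have hA1 : 1 ≤ A := (le_max_right _ _).trans hA
  have hA0 : 0 < A := by linarith
  have hexp : lam = Real.exp (-(-Real.log lam)) := by rw [neg_neg, Real.exp_log hlam.1]
  set δ := -Real.log lam with hδ
  rw [hexp] at hlam
  obtain ⟨r, hr, hδr⟩ := h A ((le_max_left _ _).trans hA) δ hlam
  refine ⟨Real.pi ^ 2 / (2 * A ^ 2) - δ, ?_, by rw [hexp]; congr 1; ring⟩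
  have e : Real.pi ^ 2 / (2 * A ^ 2) - δ =
      Real.pi ^ 2 / 2 * ((8 / 3 * A + 16 / 9 - r * A ^ 2) / (A ^ 2 * (A + 4 / 3) ^ 2)) := by
    rw [hδr]
    field_simp
    ring
  have hpi2 : Real.pi ^ 2 / 2 ≤ 8 := by nlinarith [Real.pi_le_four, Real.pi_pos]
  -- The shift `4/3` causes the leading error `8A/3`; the constant `5` exceeds `8/3 + 16/9`, and `A
  -- ≥ 1`.
  have hnum : |8 / 3 * A + 16 / 9 - r * A ^ 2| ≤ (C + 5) * A := by
    have h2 : |r * A ^ 2| ≤ C := by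
      rw [abs_mul, abs_of_pos (by positivity : 0 < A ^ 2)]
      rwa [le_div_iff₀ (by positivity)] at hr
    have h3 := abs_le.1 h2
    rw [abs_le]
    constructor <;> nlinarith
  rw [e, abs_mul, abs_of_pos (by positivity : 0 < Real.pi ^ 2 / 2), abs_div,
    abs_of_pos (by positivity : 0 < A ^ 2 * (A + 4 / 3) ^ 2)]
  have h4 : |8 / 3 * A + 16 / 9 - r * A ^ 2| / (A ^ 2 * (A + 4 / 3) ^ 2) ≤ (C + 5) / A ^ 3 := by
    rw [div_le_div_iff₀ (by positivity) (by positivity)]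
    have h5 : A * A ^ 3 ≤ A ^ 2 * (A + 4 / 3) ^ 2 := by
      have : A ^ 2 ≤ (A + 4 / 3) ^ 2 := pow_le_pow_left₀ hA0.le (by linarith) 2
      nlinarith [mul_le_mul_of_nonneg_left this (show 0 ≤ A ^ 2 by positivity)]
    calc _ ≤ (C + 5) * A * A ^ 3 := mul_le_mul_of_nonneg_right hnum (by positivity)
      _ = (C + 5) * (A * A ^ 3) := by ring
      _ ≤ _ := mul_le_mul_of_nonneg_left h5 (by linarith)
  calc _ ≤ 8 * ((C + 5) / A ^ 3) := mul_le_mul hpi2 h4 (by positivity) (by norm_num)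
    _ = 8 * (C + 5) / A ^ 3 := by ring

theorem mainTheorem6 :
    -- the non-zero eigenvalues of the killed walk and their left eigenfunctions
    (∀ (H : ℝ) (lam : ℂ), 0 < H → lam ≠ 0 →
      (IsKilledEigenvalue oneMinusExpDensity H lam ↔ gFun lam (H + 1) = 0) ∧
      (∀ g : ℝ → ℂ, IsLeftEigenfunction oneMinusExpDensity H lam g ↔
        gFun lam (H + 1) = 0 ∧
          ∃ c : ℂ, c ≠ 0 ∧ g = (Set.Icc 0 H).indicator (fun x => c * gFun lam x))) ∧
    -- the roots of `τ` in terms of the Lambert function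
    (∀ lam : ℝ, 0 < lam → lam ≤ 1 → ∀ k : ℤ,
      ∃! w : ℂ, w ∈ lambertBranch k ∧
        w * Complex.exp w = ((-1 / (Real.exp 1 * lam) : ℝ) : ℂ)) ∧
    (∀ lam : ℝ, 0 < lam → lam < 1 →
      Set.BijOn (tauRoot lam) Set.univ {s : ℂ | tauFun lam s = 0}) ∧
    (tauRoot 1 0 = 0 ∧ tauRoot 1 (-1) = 0 ∧
      Set.BijOn (tauRoot 1) {k : ℤ | k ≠ -1} {s : ℂ | tauFun 1 s = 0}) ∧
    -- the expansion of `g_lam` over the roots of `τ`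
    (∀ lam : ℝ, 0 < lam → lam < 1 → ∀ x : ℝ, 0 < x →
      HasSum (fun s : {s : ℂ // tauFun lam s = 0} => Complex.exp ((s : ℂ) * (x : ℂ)) / (s : ℂ))
        (gFun (lam : ℂ) x)) ∧
    (∀ x : ℝ, 0 < x →
      HasSum (fun s : {s : ℂ // tauFun 1 s = 0 ∧ s ≠ 0} =>
          Complex.exp ((s : ℂ) * (x : ℂ)) / (s : ℂ))
        (gFun 1 x - 2 * ((x : ℂ) + 1 / 3))) ∧
    -- the principal eigenvalue: existence, and characterization by the smallest zero of `g_lam`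
    (∀ H : ℝ, 0 < H → ∃! lam : ℝ, IsPrincipalEigenvalue oneMinusExpDensity H lam) ∧
    (∀ H lam : ℝ, 0 < H → 0 < lam →
      (IsPrincipalEigenvalue oneMinusExpDensity H lam ↔
        IsLeast {x : ℝ | 0 < x ∧ gFun (lam : ℂ) x = 0} (H + 1))) ∧
    -- the interval `[0, H]` with principal eigenvalue `e^{-δ}`, as `δ ↓ 0`
    (∃ C δ₀ : ℝ, 0 < C ∧ 0 < δ₀ ∧ ∀ δ : ℝ, 0 < δ → δ < δ₀ →
      (∃! H : ℝ, 0 < H ∧ IsPrincipalEigenvalue oneMinusExpDensity H (Real.exp (-δ))) ∧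
      ∀ H : ℝ, 0 < H → IsPrincipalEigenvalue oneMinusExpDensity H (Real.exp (-δ)) →
        |H - (Real.pi / Real.sqrt (2 * δ) - 4 / 3)| ≤ C * Real.sqrt δ) ∧
    -- the principal eigenvalue `e^{-δ}` of `[0, H]`, as `H → ∞`
    (∃ C H₀ : ℝ, 0 < C ∧ 0 < H₀ ∧ ∀ H : ℝ, H₀ ≤ H → ∀ δ : ℝ,
      IsPrincipalEigenvalue oneMinusExpDensity H (Real.exp (-δ)) →
        ∃ r : ℝ, |r| ≤ C / H ^ 2 ∧
          δ = Real.pi ^ 2 / 2 * ((1 + r) / (H + 4 / 3) ^ 2)) ∧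
    -- the exp-minus-one walk has the same principal eigenvalue; its asymptotics
    (∀ A lam : ℝ, 0 < A →
      (IsPrincipalEigenvalue expMinusOneDensity A lam ↔
        IsPrincipalEigenvalue oneMinusExpDensity A lam)) ∧
    (∃ C A₀ : ℝ, 0 < C ∧ 0 < A₀ ∧ ∀ A : ℝ, A₀ ≤ A → ∀ lam : ℝ,
      IsPrincipalEigenvalue expMinusOneDensity A lam →
        ∃ r : ℝ, |r| ≤ C / A ^ 3 ∧ lam = Real.exp (-(Real.pi ^ 2 / (2 * A ^ 2)) + r)) := by
  refine ⟨fun H lam hH hlam => ⟨isKilledEigenvalue_iff hH hlam, isLeftEigenfunction_iff hH hlam⟩,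
    fun lam h0 h1 k => ?_, fun lam => bijOn_tauRoot,
    ⟨tauRoot_one_eq_zero (Or.inl rfl), tauRoot_one_eq_zero (Or.inr rfl), bijOn_tauRoot_one⟩,
    fun lam h0 h1 x hx => ?_, fun x => TauZero.hasSum_one,
    fun H => existsUnique_isPrincipalEigenvalue, fun H lam => isPrincipalEigenvalue_iff_isLeast,
    ⟨5, 1 / 8, by norm_num, by norm_num, fun δ => principal_interval_asymptotics⟩,
    principal_eigenvalue_asymptotics,
    fun A lam hA => isPrincipalEigenvalue_expMinusOne_iff hA lam, ?_⟩
  · rw [neg_div, one_div]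
    exact existsUnique_lambertBranch (exp_neg_one_le h0 h1) k
  -- For `λ < 1` the origin is not a root, as `τ(0) = 1/λ - 1`, so excluding it changes nothing.
  · have hne : ∀ s : ℂ, tauFun lam s = 0 ↔ tauFun lam s = 0 ∧ s ≠ 0 := by
      refine fun s => ⟨fun h => ⟨h, ?_⟩, fun h => h.1⟩
      rintro rfl
      simp only [tauFun, Complex.exp_zero, zero_mul, add_zero, sub_eq_zero] at h
      rw [div_eq_one_iff_eq (by exact_mod_cast h0.ne')] at h
      exact h1.ne' (by exact_mod_cast h)
    exact (Equiv.subtypeEquivRight hne).hasSum_iff.2 (TauZero.hasSum_of_lt_one h0 h1 hx)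
  · obtain ⟨C, A₀, hC, hA₀, h⟩ := principal_eigenvalue_exp_asymptotics
    exact ⟨C, A₀, hC, hA₀, fun A hA lam hlam => h A hA lam
      ((isPrincipalEigenvalue_expMinusOne_iff (hA₀.trans_le hA) lam).1 hlam)⟩
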